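/- Let $w=(w(k))_{k\ge1}$ be a decreasing sequence of positive numbers with $w(1)=1$, $w(k)\to0$ and $\sum_k w(k)=\infty$; let $n\ge1$ be an integer and $1\le p<\infty$. Write $r'=r/(r-1)$ for the conjugate exponent (with $1'=\infty$). All sequences are complex, and $x^\star(k)=\inf\{\sup_{j\notin J}|x(j)| : \operatorname{card}J<k\}$ is the decreasing rearrangement. For a decreasing positive sequence $v$ with $v(1)=1$ and $1\le q<\infty$, $d(v,q)$ is the space of sequences with $\|x\|=\sup_{\pi}\big(\sum_k|x(\pi(k))|^q v(k)\big)^{1/q}<\infty$ (supremum over permutations of $\mathbb N$). The Banach dual $d(w,p)^*$ is regarded as a sequence space through $\varphi\mapsto(\varphi(e_k))_k$. Let $\Psi(N)=\big(\sum_{k\le N}w(k)\big)^{n/p}$, let $m_\Psi$ be the space of sequences with $\|x\|_{m_\Psi}=\sup_N\Psi(N)^{-1}\sum_{k\le N}x^\star(k)<\infty$, and let $m_\Psi^0$ be its subspace of order continuous elements. For a normed sequence space $F$, $F^\times$ is its Köthe dual: the sequences $z$ with $\sum_k|z(k)x(k)|<\infty$ for all $x\in F$, normed by $\|z\|=\sup_{\|x\|_F\le1}\sum_k|z(k)x(k)|$.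 Let $d_*(w,1)$ be the space of $x\in c_0$ with $\sum_{k\le N}x^\star(k)/\sum_{k\le N}w(k)\to0$, normed by the supremum of these quotients. A continuous $n$-linear form $T$ on $E$ is integral if $T(x_1,\dots,x_n)=\int\gamma_1(x_1)\cdots\gamma_n(x_n)\,d\mu(\gamma_1,\dots,\gamma_n)$ for a positive finite Radon measure $\mu$ on $B_{E^*}\times\cdots\times B_{E^*}$ (weak$^*$ topologies); its integral norm is the infimum of the total masses of such $\mu$. It is nuclear if $T(x_1,\dots,x_n)=\sum_k\lambda(k)\gamma_{1,k}(x_1)\cdots\gamma_{n,k}(x_n)$ with $\lambda\in\ell_1$, $\gamma_{i,k}\in B_{E^*}$; its nuclear norm is the infimum of $\sum_k|\lambda(k)|\|\gamma_{1,k}\|\cdots\|\gamma_{n,k}\|$. For $\mathfrak A=\mathcal I$ (integral) or $\mathcal N$ (nuclear), $\ell_n(\mathfrak A,E)$ is the space of bounded sequences $\alpha$ such that the diagonal form $T_\alpha(x_1,\dots,x_n)=\sum_k\alpha(k)x_1(k)\cdots x_n(k)$ is in $\mathfrak A$, normed by $\|T_\alpha\|_{\mathfrak A}$. Below, equality of sequence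 spaces means that they have the same elements with the same norms. 1. $\ell_n(\mathcal I,d(w,p))$ equals - $d(w^n,1)^\times$ if $p=1$; - $d\big(w^{\frac{n'}{n'-p}},\frac{p'}{p'-n}\big)^\times$ if $1<p<n'$ (for $n=1$, where $n'=\infty$, this means $d(w,p)^\times$); - $\ell_1$ if $n'\le p$. In the first two cases, if the weight ($w^n$, respectively $w^{n'/(n'-p)}$) is not summable, the space is also isometrically the Banach dual $d(\cdot,\cdot)^*$, through the pairing $\sum_k z(k)x(k)$. 2. $\ell_n(\mathcal I,d(w,p)^*)$ equals - $m_\Psi^\times$ if $p<n$, and through the pairing $\sum_k z(k)x(k)$ this is isometrically the Banach dual $(m_\Psi^0)^*$; - $d(w,p/n)$ if $n\le p$. 3. If $1<p<\infty$, then $\ell_n(\mathcal N,d(w,p))=\ell_n(\mathcal I,d(w,p))$ and $\ell_n(\mathcal N,d(w,p)^*)=\ell_n(\mathcal I,d(w,p)^*)$. Moreover $\ell_n(\mathcal N,d_*(w,1))=\ell_n(\mathcal I,d_*(w,1))=\ell_n(\mathcal I,d(w,1)^*)$. -/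

import Mathlib

open Filter Topology MeasureTheory
open scoped ENNReal

namespace LorentzForms

noncomputable section

/-! ### Normed sequence spaces. Sequences are indexed by `ℕ`, so that index `k` in the code is
index `k + 1` in the usual `1`-based notation. -/

/-- An extended-real-valued norm on the space of all complex sequences. -/
structure SeqNorm where
  toFun : (ℕ → ℂ) → ℝ≥0∞
  eq_zero : ∀ x, toFun x = 0 → x = 0
  add_le : ∀ x y, toFun (x + y) ≤ toFun x + toFun y
  smul : ∀ (c : ℂ) x, toFun (c • x) = ‖c‖ₑ * toFun x

namespace SeqNorm

variable (ρ : SeqNorm)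

/-- The sequences of finite norm. -/
def sub : Submodule ℂ (ℕ → ℂ) where
  carrier := {x | ρ.toFun x < ∞}
  add_mem' {x y} hx hy := (ρ.add_le x y).trans_lt (ENNReal.add_lt_top.2 ⟨hx, hy⟩)
  zero_mem' := by
    have h := ρ.smul 0 0
    simp only [zero_smul, enorm_zero, zero_mul] at h
    simp [h]
  smul_mem' c x hx := by
    change ρ.toFun (c • x) < ∞
    rw [ρ.smul]
    exact ENNReal.mul_lt_top enorm_lt_top hx

/-- The normed space of all sequences of finite norm. (A separate type, so that its only topology
is the norm topology.) -/
def Space : Type := ρ.sub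

instance : AddCommGroup ρ.Space := inferInstanceAs (AddCommGroup ρ.sub)

instance : Module ℂ ρ.Space := inferInstanceAs (Module ℂ ρ.sub)

/-- The `k`-th coordinate is `coord x k`. -/
def coord : ρ.Space →ₗ[ℂ] (ℕ → ℂ) := ρ.sub.subtype

instance : Norm ρ.Space := ⟨fun x => (ρ.toFun (ρ.coord x)).toReal⟩

theorem coord_lt_top (x : ρ.Space) : ρ.toFun (ρ.coord x) < ∞ := x.2

theorem core : NormedSpace.Core ℂ ρ.Space where
  norm_nonneg _ := ENNReal.toReal_nonneg
  norm_smul c x := by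
    change (ρ.toFun (ρ.coord (c • x))).toReal = ‖c‖ * (ρ.toFun (ρ.coord x)).toReal
    rw [map_smul, ρ.smul, ENNReal.toReal_mul, toReal_enorm]
  norm_triangle x y := by
    change (ρ.toFun (ρ.coord (x + y))).toReal ≤
      (ρ.toFun (ρ.coord x)).toReal + (ρ.toFun (ρ.coord y)).toReal
    rw [map_add, ← ENNReal.toReal_add (ρ.coord_lt_top x).ne (ρ.coord_lt_top y).ne]
    exact ENNReal.toReal_mono
      (ENNReal.add_lt_top.2 ⟨ρ.coord_lt_top x, ρ.coord_lt_top y⟩).ne (ρ.add_le _ _)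
  norm_eq_zero_iff x := by
    constructor
    · intro h
      have h0 : ρ.toFun (ρ.coord x) = 0 :=
        ((ENNReal.toReal_eq_zero_iff _).1 h).resolve_right (ρ.coord_lt_top x).ne
      exact Subtype.ext (ρ.eq_zero _ h0)
    · rintro rfl
      have h := ρ.smul 0 0
      simp only [zero_smul, enorm_zero, zero_mul] at h
      change (ρ.toFun (ρ.coord 0)).toReal = 0
      rw [map_zero, h, ENNReal.toReal_zero]

instance : NormedAddCommGroup ρ.Space := NormedAddCommGroup.ofCore ρ.core

instance : NormedSpace ℂ ρ.Space := NormedSpace.ofCore ρ.core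

/-- The order continuous elements: `x` such that `‖y j‖ → 0` for all `|x| ≥ y 0 ≥ y 1 ≥ … ≥ 0` that
decrease to `0` (coordinatewise). -/
def orderContinuous : Submodule ℂ ρ.Space where
  carrier := {x | ∀ y : ℕ → ℕ → ℝ, (∀ j k, 0 ≤ y j k) → (∀ k, y 0 k ≤ ‖ρ.coord x k‖) →
    Antitone y → (∀ k, Tendsto (fun j => y j k) atTop (𝓝 0)) →
    Tendsto (fun j => ρ.toFun (fun k => (y j k : ℂ))) atTop (𝓝 0)}
  zero_mem' := by
    intro y hy h0 hanti _
    have : ∀ j, (fun k => (y j k : ℂ)) = (0 : ℂ) • (0 : ℕ → ℂ) := by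
      intro j
      funext k
      have h1 : y j k ≤ 0 := (hanti (Nat.zero_le j) k).trans (by simpa using h0 k)
      simp [le_antisymm h1 (hy j k)]
    simp only [this, ρ.smul]
    simp
  add_mem' := by
    intro x x' hx hx' y hy h0 hanti hlim
    have h1 := hx (fun j k => min (y j k) ‖ρ.coord x k‖)
      (fun j k => le_min (hy j k) (norm_nonneg _)) (fun k => min_le_right _ _)
      (fun i j hij k => min_le_min_right _ (hanti hij k))
      (fun k => squeeze_zero (fun j => le_min (hy j k) (norm_nonneg _))
        (fun j => min_le_left _ _) (hlim k))
    have h2 := hx' (fun j k => max (y j k - ‖ρ.coord x k‖) 0)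
      (fun j k => le_max_right _ _)
      (fun k => max_le (by
        have h := (h0 k).trans (by simpa using norm_add_le (ρ.coord x k) (ρ.coord x' k))
        linarith) (norm_nonneg _))
      (fun i j hij k => max_le_max_right _ (sub_le_sub_right (hanti hij k) _))
      (fun k => squeeze_zero (fun j => le_max_right _ _)
        (fun j => max_le (sub_le_self _ (norm_nonneg _)) (hy j k)) (hlim k))
    have h3 := h1.add h2
    rw [add_zero] at h3
    refine tendsto_of_tendsto_of_tendsto_of_le_of_le tendsto_const_nhds h3
      (fun _ => zero_le) (fun j => ?_)
    refine le_trans (le_of_eq ?_) (ρ.add_le _ _)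
    congr 1
    funext k
    simp only [Pi.add_apply]
    rw [← Complex.ofReal_add]
    congr 1
    rcases le_total (y j k) ‖ρ.coord x k‖ with h | h
    · rw [min_eq_left h, max_eq_right (by linarith), add_zero]
    · rw [min_eq_right h, max_eq_left (by linarith)]; ring
  smul_mem' := by
    intro c x hx y hy h0 hanti hlim
    by_cases hc : c = 0
    · subst hc
      have : ∀ j, (fun k => (y j k : ℂ)) = (0 : ℂ) • (0 : ℕ → ℂ) := by
        intro j
        funext k
        have h1 : y j k ≤ 0 := (hanti (Nat.zero_le j) k).trans (by simpa using h0 k)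
        simp [le_antisymm h1 (hy j k)]
      simp only [this, ρ.smul]
      simp
    · have hc' : 0 < ‖c‖ := norm_pos_iff.2 hc
      have h1 := hx (fun j k => ‖c‖⁻¹ * y j k)
        (fun j k => mul_nonneg (inv_nonneg.2 hc'.le) (hy j k))
        (fun k => by
          have h := h0 k
          rw [map_smul, Pi.smul_apply, norm_smul] at h
          exact (inv_mul_le_iff₀ hc').2 h)
        (fun i j hij k => mul_le_mul_of_nonneg_left (hanti hij k) (inv_nonneg.2 hc'.le))
        (fun k => by simpa using (hlim k).const_mul ‖c‖⁻¹)
      have h2 := ENNReal.Tendsto.const_mul (a := ‖(‖c‖ : ℂ)‖ₑ) h1 (Or.inr enorm_ne_top)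
      rw [mul_zero] at h2
      refine h2.congr (fun j => ?_)
      rw [← ρ.smul]
      congr 1
      funext k
      simp only [Pi.smul_apply, smul_eq_mul, Complex.ofReal_mul, Complex.ofReal_inv]
      rw [mul_inv_cancel_left₀ (Complex.ofReal_ne_zero.2 hc'.ne')]

end SeqNorm

/-! ### Lorentz spaces -/

/-- A positive decreasing sequence with first term `1`. -/
structure IsWeight (v : ℕ → ℝ) : Prop where
  pos : ∀ k, 0 < v k
  anti : Antitone v
  one : v 0 = 1

/-- A Lorentz weight: moreover the sequence tends to `0` and has a divergent series. -/
structure IsLorentzWeight (w : ℕ → ℝ) : Prop extends IsWeight w where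
  tendsto : Tendsto w atTop (𝓝 0)
  not_summable : ¬ Summable w

/-- `sup_π (∑ₖ |x (π k)|^q v k)^{1/q}`, the supremum over all permutations `π` of `ℕ`. -/
def lorentzENorm (v : ℕ → ℝ) (q : ℝ) (x : ℕ → ℂ) : ℝ≥0∞ :=
  ⨆ π : Equiv.Perm ℕ, (∑' k, ‖x (π k)‖ₑ ^ q * ENNReal.ofReal (v k)) ^ (1 / q)

theorem tsum_minkowski {q : ℝ} (hq : 1 ≤ q) (v : ℕ → ℝ) (f g : ℕ → ℝ≥0∞) :
    (∑' k, (f k + g k) ^ q * ENNReal.ofReal (v k)) ^ (1 / q) ≤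
      (∑' k, f k ^ q * ENNReal.ofReal (v k)) ^ (1 / q) +
      (∑' k, g k ^ q * ENNReal.ofReal (v k)) ^ (1 / q) := by
  have hq0 : 0 < q := by linarith
  have key : ∀ h : ℕ → ℝ≥0∞, ∑' k, h k ^ q * ENNReal.ofReal (v k) =
      ∫⁻ k, (h k * ENNReal.ofReal (v k) ^ (1 / q)) ^ q ∂Measure.count := by
    intro h
    rw [lintegral_count]
    refine tsum_congr fun k => ?_
    rw [ENNReal.mul_rpow_of_nonneg _ _ hq0.le, ← ENNReal.rpow_mul, one_div,
      inv_mul_cancel₀ hq0.ne', ENNReal.rpow_one]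
  rw [key, key, key]
  have := ENNReal.lintegral_Lp_add_le (μ := (Measure.count : Measure ℕ))
    (f := fun k => f k * ENNReal.ofReal (v k) ^ (1 / q))
    (g := fun k => g k * ENNReal.ofReal (v k) ^ (1 / q))
    (measurable_of_countable _).aemeasurable (measurable_of_countable _).aemeasurable hq
  simpa [add_mul] using this

/-- The Lorentz norm `d(v, q)`, `1 ≤ q < ∞`. -/
def lorentz (v : ℕ → ℝ) (q : ℝ) (hv : IsWeight v) (hq : 1 ≤ q) : SeqNorm where
  toFun := lorentzENorm v q
  eq_zero x hx := by
    have hq0 : 0 < q := by linarith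
    funext j
    have h1 : (∑' k, ‖x (Equiv.swap 0 j k)‖ₑ ^ q * ENNReal.ofReal (v k)) ^ (1 / q) = 0 :=
      le_antisymm (hx ▸ le_iSup (fun π : Equiv.Perm ℕ =>
        (∑' k, ‖x (π k)‖ₑ ^ q * ENNReal.ofReal (v k)) ^ (1 / q)) (Equiv.swap 0 j)) zero_le
    rw [ENNReal.rpow_eq_zero_iff_of_pos (by positivity), ENNReal.tsum_eq_zero] at h1
    have h2 := h1 0
    rw [mul_eq_zero, Equiv.swap_apply_left, ENNReal.rpow_eq_zero_iff_of_pos hq0] at h2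
    rcases h2 with h2 | h2
    · simpa using h2
    · exact absurd (ENNReal.ofReal_eq_zero.1 h2) (not_le.2 (hv.pos 0))
  add_le x y := by
    have hq0 : 0 < q := by linarith
    refine iSup_le fun π => ?_
    refine le_trans ?_ (add_le_add
      (le_iSup (fun π : Equiv.Perm ℕ =>
        (∑' k, ‖x (π k)‖ₑ ^ q * ENNReal.ofReal (v k)) ^ (1 / q)) π)
      (le_iSup (fun π : Equiv.Perm ℕ =>
        (∑' k, ‖y (π k)‖ₑ ^ q * ENNReal.ofReal (v k)) ^ (1 / q)) π))
    refine le_trans ?_ (tsum_minkowski hq v _ _)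
    refine ENNReal.rpow_le_rpow (ENNReal.tsum_le_tsum fun k => ?_) (by positivity)
    gcongr
    exact enorm_add_le _ _
  smul c x := by
    have hq0 : 0 < q := by linarith
    unfold lorentzENorm
    rw [ENNReal.mul_iSup]
    refine iSup_congr fun π => ?_
    have : ∀ k, ‖(c • x) (π k)‖ₑ ^ q * ENNReal.ofReal (v k) =
        ‖c‖ₑ ^ q * (‖x (π k)‖ₑ ^ q * ENNReal.ofReal (v k)) := by
      intro k
      rw [Pi.smul_apply, smul_eq_mul, enorm_mul, ENNReal.mul_rpow_of_nonneg _ _ hq0.le, mul_assoc]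
    simp only [this, ENNReal.tsum_mul_left]
    rw [ENNReal.mul_rpow_of_nonneg _ _ (by positivity), ← ENNReal.rpow_mul, one_div,
      mul_inv_cancel₀ hq0.ne', ENNReal.rpow_one]

theorem lorentz_single_lt_top (v : ℕ → ℝ) (q : ℝ) (hv : IsWeight v) (hq : 1 ≤ q) (j : ℕ) :
    lorentzENorm v q (Pi.single j 1) < ∞ := by
  have hq0 : 0 < q := by linarith
  refine lt_of_le_of_lt (iSup_le fun π => ?_) (ENNReal.one_lt_top)
  rw [tsum_eq_single (π.symm j)]
  · refine ENNReal.rpow_le_one ?_ (by positivity)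
    simpa [hv.one] using hv.anti (Nat.zero_le (π.symm j))
  · intro k hk
    have : π k ≠ j := fun h => hk (by simp [← h])
    simp [Pi.single_eq_of_ne this, hq0]

/-- The unit vector `e_j` in `d(v, q)`. -/
def unitVec (v : ℕ → ℝ) (q : ℝ) (hv : IsWeight v) (hq : 1 ≤ q) (j : ℕ) :
    (lorentz v q hv hq).Space :=
  ⟨Pi.single j 1, lorentz_single_lt_top v q hv hq j⟩

/-- The Banach dual `d(v, q)*`. -/
abbrev LorentzDual (v : ℕ → ℝ) (q : ℝ) (hv : IsWeight v) (hq : 1 ≤ q) : Type :=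
  StrongDual ℂ (lorentz v q hv hq).Space

/-- A functional on `d(v, q)` as a sequence: its `k`-th coordinate is its value at `e_k`. -/
def dualCoord (v : ℕ → ℝ) (q : ℝ) (hv : IsWeight v) (hq : 1 ≤ q)
    (φ : LorentzDual v q hv hq) (k : ℕ) : ℂ :=
  φ (unitVec v q hv hq k)

/-! ### Decreasing rearrangement and Marcinkiewicz spaces -/

/-- The decreasing rearrangement: `rearr x k` is the usual `x⋆(k + 1)`. -/
def rearr (x : ℕ → ℂ) (k : ℕ) : ℝ≥0∞ :=
  ⨅ (J : Finset ℕ) (_ : J.card < k + 1), ⨆ (j : ℕ) (_ : j ∉ J), ‖x j‖ₑ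

/-- `x⋆(1) + ⋯ + x⋆(N)`. -/
def rearrSum (x : ℕ → ℂ) (N : ℕ) : ℝ≥0∞ := ∑ k ∈ Finset.range N, rearr x k

theorem sum_le_rearrSum (x : ℕ → ℂ) : ∀ (N : ℕ) (J : Finset ℕ), J.card = N →
    ∑ j ∈ J, ‖x j‖ₑ ≤ rearrSum x N := by
  intro N
  induction N with
  | zero => intro J hJ; simp [Finset.card_eq_zero.1 hJ]
  | succ N ih =>
    intro J hJ
    obtain ⟨i, hi, hmin⟩ := Finset.exists_min_image J (fun j => ‖x j‖ₑ)
      (Finset.card_pos.1 (by omega))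
    rw [← Finset.sum_erase_add J _ hi, rearrSum, Finset.sum_range_succ]
    refine add_le_add (ih _ (by rw [Finset.card_erase_of_mem hi]; omega)) ?_
    refine le_iInf₂ fun K hK => ?_
    obtain ⟨j, hj, hjK⟩ : ∃ j ∈ J, j ∉ K := by
      by_contra! h
      have := Finset.card_le_card (show J ⊆ K from h)
      omega
    exact (hmin j hj).trans (le_iSup₂ (f := fun (j : ℕ) (_ : j ∉ K) => ‖x j‖ₑ) j hjK)

theorem exists_finset_of_lt_rearrSum (x : ℕ → ℂ) : ∀ (N : ℕ) (c : ℝ≥0∞), c < rearrSum x N →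
    ∃ J : Finset ℕ, J.card ≤ N ∧ c ≤ ∑ j ∈ J, ‖x j‖ₑ := by
  have step : ∀ (N : ℕ) (b : ℝ≥0∞) (J : Finset ℕ), J.card ≤ N → b < rearr x N →
      ∃ j, j ∉ J ∧ b < ‖x j‖ₑ := by
    intro N b J hJ hb
    have h1 : rearr x N ≤ ⨆ (j : ℕ) (_ : j ∉ J), ‖x j‖ₑ :=
      iInf₂_le (f := fun (J : Finset ℕ) (_ : J.card < N + 1) =>
        ⨆ (j : ℕ) (_ : j ∉ J), ‖x j‖ₑ) J (by omega)
    have h2 := hb.trans_le h1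
    simp only [lt_iSup_iff] at h2
    obtain ⟨j, hj, h⟩ := h2
    exact ⟨j, hj, h⟩
  intro N
  induction N with
  | zero => intro c hc; simp [rearrSum] at hc
  | succ N ih =>
    intro c hc
    have hc' : c < rearrSum x N + rearr x N := by
      rwa [rearrSum, Finset.sum_range_succ] at hc
    by_cases hB : rearr x N = 0
    · rw [hB, add_zero] at hc'
      obtain ⟨J, hJ, h⟩ := ih c hc'
      exact ⟨J, by omega, h⟩
    by_cases hA : rearrSum x N = 0
    · rw [hA, zero_add] at hc'
      obtain ⟨j, -, h⟩ := step N c ∅ (by simp) hc'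
      exact ⟨{j}, by simp, by simpa using h.le⟩
    obtain ⟨a, ha, b, hb, hab⟩ := ENNReal.exists_lt_add_of_lt_add hc' hA hB
    obtain ⟨J, hJ, h⟩ := ih a ha
    obtain ⟨j, hj, h'⟩ := step N b J hJ hb
    refine ⟨insert j J, (Finset.card_insert_le _ _).trans (by omega), ?_⟩
    rw [Finset.sum_insert hj, add_comm]
    exact hab.le.trans (add_le_add h h'.le)

theorem rearrSum_mono (x : ℕ → ℂ) {M N : ℕ} (h : M ≤ N) : rearrSum x M ≤ rearrSum x N :=
  Finset.sum_le_sum_of_subset (Finset.range_mono h)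

theorem rearrSum_eq (x : ℕ → ℂ) (N : ℕ) :
    rearrSum x N = ⨆ (J : Finset ℕ) (_ : J.card ≤ N), ∑ j ∈ J, ‖x j‖ₑ := by
  refine le_antisymm (le_of_forall_lt fun c hc => ?_) (iSup₂_le fun J hJ =>
    (sum_le_rearrSum x _ J rfl).trans (rearrSum_mono x hJ))
  obtain ⟨c', h1, h2⟩ := exists_between hc
  obtain ⟨J, hJ, h⟩ := exists_finset_of_lt_rearrSum x N c' h2
  exact h1.trans_le (h.trans
    (le_iSup₂ (f := fun (J : Finset ℕ) (_ : J.card ≤ N) => ∑ j ∈ J, ‖x j‖ₑ) J hJ))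

theorem rearrSum_add_le (x y : ℕ → ℂ) (N : ℕ) :
    rearrSum (x + y) N ≤ rearrSum x N + rearrSum y N := by
  rw [rearrSum_eq]
  refine iSup₂_le fun J hJ => ?_
  refine (Finset.sum_le_sum fun j _ => enorm_add_le (x j) (y j)).trans ?_
  rw [Finset.sum_add_distrib]
  exact add_le_add ((sum_le_rearrSum x _ J rfl).trans (rearrSum_mono x hJ))
    ((sum_le_rearrSum y _ J rfl).trans (rearrSum_mono y hJ))

theorem rearrSum_smul (c : ℂ) (x : ℕ → ℂ) (N : ℕ) :
    rearrSum (c • x) N = ‖c‖ₑ * rearrSum x N := by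
  simp only [rearrSum_eq, ENNReal.mul_iSup, Finset.mul_sum, Pi.smul_apply, smul_eq_mul, enorm_mul]

/-- The norm `sup_{N ≥ 1} (∑_{k ≤ N} x⋆(k)) / Ψ(N)` of the Marcinkiewicz space `m_Ψ`. -/
def marcinkiewicz (Ψ : ℕ → ℝ) : SeqNorm where
  toFun x := ⨆ N : ℕ, rearrSum x (N + 1) / ENNReal.ofReal (Ψ (N + 1))
  eq_zero x hx := by
    funext j
    have h1 : rearrSum x (0 + 1) / ENNReal.ofReal (Ψ (0 + 1)) = 0 :=
      le_antisymm (hx ▸ le_iSup (fun N : ℕ =>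
        rearrSum x (N + 1) / ENNReal.ofReal (Ψ (N + 1))) 0) zero_le
    have h2 := (ENNReal.div_eq_zero_iff.1 h1).resolve_right ENNReal.ofReal_ne_top
    have h3 := sum_le_rearrSum x 1 {j} (by simp)
    rw [show rearrSum x 1 = 0 from h2] at h3
    simpa using h3
  add_le x y := by
    refine iSup_le fun N => ?_
    refine (ENNReal.div_le_div_right (rearrSum_add_le x y _) _).trans ?_
    rw [ENNReal.add_div]
    exact add_le_add
      (le_iSup (fun N : ℕ => rearrSum x (N + 1) / ENNReal.ofReal (Ψ (N + 1))) N)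
      (le_iSup (fun N : ℕ => rearrSum y (N + 1) / ENNReal.ofReal (Ψ (N + 1))) N)
  smul c x := by
    rw [ENNReal.mul_iSup]
    refine iSup_congr fun N => ?_
    rw [rearrSum_smul, mul_div_assoc]

/-- `∑_{k ≤ N} w(k)`. -/
def partialSum (w : ℕ → ℝ) (N : ℕ) : ℝ := ∑ k ∈ Finset.range N, w k

/-- `d_*(w, 1)`: the sequences in `c₀` with `(∑_{k ≤ N} x⋆(k)) / ∑_{k ≤ N} w(k) → 0`, normed by the
supremum of these quotients. -/
def lorentzPredual (w : ℕ → ℝ) : Submodule ℂ (marcinkiewicz (partialSum w)).Space where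
  carrier := {x | Tendsto ((marcinkiewicz (partialSum w)).coord x) atTop (𝓝 0) ∧
    Tendsto (fun N => rearrSum ((marcinkiewicz (partialSum w)).coord x) N /
      ENNReal.ofReal (partialSum w N)) atTop (𝓝 0)}
  zero_mem' := by
    have h : ∀ N, rearrSum (0 : ℕ → ℂ) N = 0 := by
      intro N
      simpa using rearrSum_smul 0 0 N
    refine ⟨?_, ?_⟩
    · rw [map_zero]; exact tendsto_const_nhds
    · simp only [map_zero, h, ENNReal.zero_div]; exact tendsto_const_nhds
  add_mem' := by
    rintro x y ⟨hx, hx'⟩ ⟨hy, hy'⟩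
    refine ⟨?_, ?_⟩
    · have h := hx.add hy
      rw [add_zero] at h
      rw [map_add]
      exact h
    · have h := hx'.add hy'
      rw [add_zero] at h
      refine tendsto_of_tendsto_of_tendsto_of_le_of_le tendsto_const_nhds h
        (fun _ => zero_le) (fun N => ?_)
      simp only [map_add]
      rw [← ENNReal.add_div]
      exact ENNReal.div_le_div_right (rearrSum_add_le _ _ _) _
  smul_mem' := by
    rintro c x ⟨hx, hx'⟩
    refine ⟨?_, ?_⟩
    · have h := hx.const_smul c
      rw [smul_zero] at h
      rw [map_smul]
      exact h
    · have h := ENNReal.Tendsto.const_mul (a := ‖c‖ₑ) hx' (Or.inr enorm_ne_top)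
      rw [mul_zero] at h
      refine h.congr fun N => ?_
      rw [map_smul, rearrSum_smul, mul_div_assoc]

/-! ### Sequence spaces as sets with a norm, isometric equality, Köthe duals -/

/-- A set of sequences together with the values of its norm. -/
structure SeqSpace where
  carrier : Set (ℕ → ℂ)
  norm : (ℕ → ℂ) → ℝ

/-- The same sequences with the same norms. -/
def SeqSpace.IsoEq (S T : SeqSpace) : Prop :=
  S.carrier = T.carrier ∧ ∀ α ∈ S.carrier, S.norm α = T.norm α

/-- The sequences at which an extended norm is finite. -/
def seqSpaceOf (N : (ℕ → ℂ) → ℝ≥0∞) : SeqSpace where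
  carrier := {x | N x < ∞}
  norm x := (N x).toReal

/-- `ℓ₁`. -/
def ellOne : SeqSpace where
  carrier := {x | Summable fun k => ‖x k‖}
  norm x := ∑' k, ‖x k‖

/-- The Köthe dual of the space of all sequences at which the extended norm `N` is finite: its
norm is `sup {∑ₖ |z k x k| : N x ≤ 1}`. -/
def kotheDual (N : (ℕ → ℂ) → ℝ≥0∞) : SeqSpace where
  carrier := {z | ∀ x, N x < ∞ → Summable fun k => ‖z k * x k‖}
  norm z := (⨆ (x : ℕ → ℂ) (_ : N x ≤ 1), ∑' k, ‖z k * x k‖ₑ).toReal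

/-- The Banach dual of a space `X` of sequences (`c x k` is the `k`-th coordinate of `x`) is
identified isometrically with the sequence space `S` through the pairing `∑ₖ z k x k`. -/
def IsBanachDual {X : Type} [NormedAddCommGroup X] [NormedSpace ℂ X] (c : X → ℕ → ℂ)
    (S : SeqSpace) : Prop :=
  (∀ φ : StrongDual ℂ X,
    ∃! z : ℕ → ℂ, z ∈ S.carrier ∧ ∀ x, HasSum (fun k => z k * c x k) (φ x)) ∧
  ∀ z ∈ S.carrier, ∃ φ : StrongDual ℂ X,
    (∀ x, HasSum (fun k => z k * c x k) (φ x)) ∧ ‖φ‖ = S.norm z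

/-! ### Integral, nuclear and diagonal forms -/

section Forms

variable (E : Type) [NormedAddCommGroup E] [NormedSpace ℂ E] (n : ℕ)

/-- Continuous `n`-linear forms on `E`. -/
abbrev Form : Type := ContinuousMultilinearMap ℂ (fun _ : Fin n => E) ℂ

/-- `B_{E*} × ⋯ × B_{E*}` (`n` factors), with the product of the weak-star topologies. -/
def DualBallPow : Type := Fin n → {φ : WeakDual ℂ E // ‖WeakDual.toStrongDual φ‖ ≤ 1}

instance : TopologicalSpace (DualBallPow E n) :=
  inferInstanceAs (TopologicalSpace (Fin n →
    {φ : WeakDual ℂ E // ‖WeakDual.toStrongDual φ‖ ≤ 1}))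

instance : MeasurableSpace (DualBallPow E n) := borel _

instance : BorelSpace (DualBallPow E n) := ⟨rfl⟩

variable {E n}

/-- `μ` is a positive (finite) Radon measure that represents `T`. -/
def Represents (T : Form E n) (μ : Measure (DualBallPow E n)) : Prop :=
  IsFiniteMeasure μ ∧ μ.Regular ∧
    ∀ x : Fin n → E, T x = ∫ γ : DualBallPow E n, ∏ i, (γ i).1 (x i) ∂μ

def IsIntegralForm (T : Form E n) : Prop := ∃ μ, Represents T μ

/-- The integral norm: the least total mass of a representing measure. -/
def integralNorm (T : Form E n) : ℝ := sInf {r | ∃ μ, Represents T μ ∧ r = μ.real Set.univ}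

/-- `T = ∑ₖ l k · γ 1 k ⊗ ⋯ ⊗ γ n k` is a nuclear representation. -/
def NuclearRep (T : Form E n) (l : ℕ → ℂ) (γ : Fin n → ℕ → StrongDual ℂ E) : Prop :=
  (Summable fun k => ‖l k‖) ∧ (∀ i k, ‖γ i k‖ ≤ 1) ∧
    ∀ x : Fin n → E, HasSum (fun k => l k * ∏ i, γ i k (x i)) (T x)

def IsNuclearForm (T : Form E n) : Prop := ∃ l γ, NuclearRep T l γ

def nuclearNorm (T : Form E n) : ℝ :=
  sInf {r | ∃ l γ, NuclearRep T l γ ∧ r = ∑' k, ‖l k‖ * ∏ i, ‖γ i k‖}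

/-- `T` is the diagonal form `T_α (x₁, …, xₙ) = ∑ₖ α k x₁ k ⋯ xₙ k`. -/
def IsDiagonal (c : E → ℕ → ℂ) (α : ℕ → ℂ) (T : Form E n) : Prop :=
  ∀ x : Fin n → E, HasSum (fun k => α k * ∏ i, c (x i) k) (T x)

/-- `ℓₙ(𝔄, E)` for an ideal `𝔄` of forms with norm `ν`: the bounded sequences `α` such that the
diagonal form `T_α` exists and lies in `𝔄`, with the norm `ν T_α` (`T_α` is determined by `α`). -/
def diagSpace (c : E → ℕ → ℂ) (A : Form E n → Prop) (ν : Form E n → ℝ) : SeqSpace where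
  carrier := {α | (∃ C : ℝ, ∀ k, ‖α k‖ ≤ C) ∧ ∃ T : Form E n, IsDiagonal c α T ∧ A T}
  norm α := sInf {r | ∃ T : Form E n, IsDiagonal c α T ∧ r = ν T}

/-- `ℓₙ(𝓘, E)`, where `c x k` is the `k`-th coordinate of `x ∈ E`. -/
def diagIntegral (n : ℕ) (c : E → ℕ → ℂ) : SeqSpace :=
  diagSpace c (IsIntegralForm (n := n)) integralNorm

/-- `ℓₙ(𝓝, E)`, where `c x k` is the `k`-th coordinate of `x ∈ E`. -/
def diagNuclear (n : ℕ) (c : E → ℕ → ℂ) : SeqSpace :=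
  diagSpace c (IsNuclearForm (n := n)) nuclearNorm

end Forms

/-! ### Exponents -/

/-- The conjugate exponent `r' = r / (r - 1)`. -/
def conjExp (r : ℝ) : ℝ := r / (r - 1)

theorem IsWeight.rpow {w : ℕ → ℝ} (hw : IsWeight w) {s : ℝ} (hs : 0 ≤ s) :
    IsWeight (fun k => w k ^ s) where
  pos k := Real.rpow_pos_of_pos (hw.pos k) s
  anti i j hij := Real.rpow_le_rpow (hw.pos j).le (hw.anti hij) hs
  one := by simp [hw.one]

theorem IsWeight.pow {w : ℕ → ℝ} (hw : IsWeight w) (m : ℕ) : IsWeight (fun k => w k ^ m) where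
  pos k := pow_pos (hw.pos k) m
  anti i j hij := pow_le_pow_left₀ (hw.pos j).le (hw.anti hij) m
  one := by simp [hw.one]

theorem weightExp_nonneg {n : ℕ} {p : ℝ} (hn : 2 ≤ n) (h : p < conjExp n) :
    0 ≤ conjExp n / (conjExp n - p) := by
  have hn' : (2 : ℝ) ≤ n := by exact_mod_cast hn
  have h1 : 0 < conjExp n := div_pos (by linarith) (by linarith)
  exact (div_pos h1 (by linarith)).le

theorem one_le_lorentzExp {n : ℕ} {p : ℝ} (hn : 2 ≤ n) (hp : 1 < p) (h : p < conjExp n) :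
    1 ≤ conjExp p / (conjExp p - n) := by
  have hn' : (2 : ℝ) ≤ n := by exact_mod_cast hn
  have h1 : (n : ℝ) < conjExp p := by
    unfold conjExp at *
    rw [lt_div_iff₀ (by linarith)] at h ⊢
    linarith
  rw [le_div_iff₀ (by linarith)]
  linarith

end

end LorentzForms

open LorentzForms

/-! Everything rests on one formula. Let `E` have a normalized 1-unconditional system `e`, let B be
the set of coordinate sequences of functionals in the unit ball, and let U be the polar of {|g|ⁿ : g
∈ B}. Then the integral norm of `T_α` is the supremum of ∑ |α(k) x(k)| over x ∈ U. For the lower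
bound a representing measure is tested at (e_k, …, e_k): by the arithmetic-geometric mean inequality
∏ |γ_i(e_k)| is at most the mean of the |γ_i(e_k)|ⁿ, so pairing with x ∈ U costs at most the total
mass (`Represents.polarENorm_le`). For the upper bound, averaging over Rademacher signs writes ∑_k
∏_i g_i(k) x_i(k), with g_i ∈ B, as a convex combination of products of functionals of norm at most
one (`IsUncond.hasConvRep_prod`). Hahn-Banach in finite dimension then reaches every finite section
of α up to ε (`IsUncond.hasConvRep_of_pos`), and a Riesz-Markov limit of atomic measures reaches α
itself (`exists_represents`).

Nuclear representations obey the same lower bound. If the polar norms of the tails of α vanish, α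
can be cut into blocks of rapidly decreasing norm whose atomic representations are simply added
(`IsUncond.hasConvRep_diag`), so the two norms agree. The tails are controlled by order continuity
of Lorentz norms (`lorentz_tail`) and by gliding humps in Köthe duals (`lorentz_polar_tail`,
`marcinkiewicz_polar_tail`).

It remains to compute U. For d(w,p) put D = n - p(n-1). If D > 0, Hölder's inequality and its
extremal case give the unit ball of d(w^{n/D}, p/D) (`powPolar_dualBall_lorentz`); if D ≤ 0, U is
the unit ball of ℓ_∞. For d(w,p)* the set B is the unit ball of d(w,p). When p ≤ n, Abel summation
and convexity of t ↦ t^{n/p} identify U with the ball of m_Ψ (`powPolar_lorentz_ball`); when n ≤ p,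
the powers |g|ⁿ fill the positive part of the ball of d(w,p/n), which is its own second Köthe dual.
The space d_*(w,1) has the same B as d(w,1)*. Köthe dual norms are polar norms by a uniform
boundedness argument, and Banach duals are Köthe duals as soon as sections converge
(`SeqNorm.IsModel.isBanachDual`). -/

namespace LorentzForms

noncomputable section

section ConvRep

variable {E : Type} [NormedAddCommGroup E] [NormedSpace ℂ E] {n : ℕ}

/-! ### Absolutely convergent representations by products of functionals -/

/-- `f` is a series `∑ₖ l k · γ k 1 ⊗ ⋯ ⊗ γ k n` with `l k ≥ 0`, `∑ₖ l k ≤ C` and functionals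
`γ k i` of norm at most one. -/
def HasConvRep (f : (Fin n → E) → ℂ) (C : ℝ) : Prop :=
  ∃ (l : ℕ → ℝ) (γ : ℕ → Fin n → StrongDual ℂ E), (∀ k, 0 ≤ l k) ∧ (∀ k i, ‖γ k i‖ ≤ 1) ∧
    Summable l ∧ ∑' k, l k ≤ C ∧ ∀ x, HasSum (fun k => (l k : ℂ) * ∏ i, γ k i (x i)) (f x)

theorem norm_prod_apply_le {γ : Fin n → StrongDual ℂ E} (hγ : ∀ i, ‖γ i‖ ≤ 1) (x : Fin n → E) :
    ‖∏ i, γ i (x i)‖ ≤ ∏ i, ‖x i‖ := by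
  rw [norm_prod]
  exact Finset.prod_le_prod (fun _ _ => norm_nonneg _)
    fun i _ => ((γ i).le_of_opNorm_le (hγ i) _).trans (by rw [one_mul])

theorem HasConvRep.mono {f : (Fin n → E) → ℂ} {C C' : ℝ} (h : HasConvRep f C) (hC : C ≤ C') :
    HasConvRep f C' := by
  obtain ⟨l, γ, h1, h2, h3, h4, h5⟩ := h
  exact ⟨l, γ, h1, h2, h3, h4.trans hC, h5⟩

theorem HasConvRep.norm_le {f : (Fin n → E) → ℂ} {C : ℝ} (h : HasConvRep f C) (x : Fin n → E) :
    ‖f x‖ ≤ C * ∏ i, ‖x i‖ := by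
  obtain ⟨l, γ, h1, h2, h3, h4, h5⟩ := h
  have hx : 0 ≤ ∏ i, ‖x i‖ := Finset.prod_nonneg fun i _ => norm_nonneg _
  have hb : ∀ k, ‖(l k : ℂ) * ∏ i, γ k i (x i)‖ ≤ l k * ∏ i, ‖x i‖ := fun k => by
    rw [norm_mul, Complex.norm_of_nonneg (h1 k)]
    exact mul_le_mul_of_nonneg_left (norm_prod_apply_le (h2 k) x) (h1 k)
  rw [← (h5 x).tsum_eq]
  refine (tsum_of_norm_bounded (h3.mul_right _).hasSum hb).trans ?_
  rw [tsum_mul_right]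
  exact mul_le_mul_of_nonneg_right h4 hx

theorem HasConvRep.real_mul {f : (Fin n → E) → ℂ} {C t : ℝ} (h : HasConvRep f C) (ht : 0 ≤ t) :
    HasConvRep (fun x => (t : ℂ) * f x) (t * C) := by
  obtain ⟨l, γ, h1, h2, h3, h4, h5⟩ := h
  refine ⟨fun k => t * l k, γ, fun k => mul_nonneg ht (h1 k), h2, h3.mul_left t, ?_, fun x => ?_⟩
  · rw [tsum_mul_left]; exact mul_le_mul_of_nonneg_left h4 ht
  · simpa [mul_assoc] using (h5 x).mul_left (t : ℂ)

/-- The coefficients of a representation are nonnegative, so the phase `a / ‖a‖` is absorbed by the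
first functional; this needs `1 ≤ n`. For `a = 0` the quotient is `0` by convention and the norm
bound survives. -/
theorem hasConvRep_prod (hn : 1 ≤ n) (a : ℂ) {γ : Fin n → StrongDual ℂ E}
    (hγ : ∀ i, ‖γ i‖ ≤ 1) : HasConvRep (fun x => a * ∏ i, γ i (x i)) ‖a‖ := by
  obtain ⟨m, rfl⟩ : ∃ m, n = m + 1 := ⟨n - 1, by omega⟩
  refine ⟨Pi.single 0 ‖a‖, fun _ => Fin.cons ((a / ‖a‖) • γ 0) (fun i => γ i.succ), ?_, ?_,
    (hasSum_pi_single 0 ‖a‖).summable, (hasSum_pi_single 0 ‖a‖).tsum_eq.le, fun x => ?_⟩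
  · intro k
    by_cases hk : k = 0
    · subst hk; simp
    · simp [Pi.single_eq_of_ne hk]
  · intro _ i
    refine Fin.cases ?_ (fun j => ?_) i
    · simp only [Fin.cons_zero]
      rw [norm_smul, norm_div, Complex.norm_real, norm_norm]
      exact mul_le_one₀ (div_self_le_one _) (norm_nonneg _) (hγ 0)
    · simpa using hγ j.succ
  · have : a * ∏ i, γ i (x i) = ((Pi.single 0 ‖a‖ : ℕ → ℝ) 0 : ℂ) *
        ∏ i, (Fin.cons ((a / ‖a‖) • γ 0) (fun i => γ i.succ) : Fin (m + 1) → StrongDual ℂ E) i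
          (x i) := by
      rw [Fin.prod_univ_succ, Fin.prod_univ_succ]
      by_cases ha : a = 0
      · simp [ha]
      · have : (‖a‖ : ℂ) ≠ 0 := by simpa using ha
        simp only [Pi.single_eq_same, Fin.cons_zero, Fin.cons_succ,
          smul_apply, smul_eq_mul]
        field_simp
    change HasSum _ (a * ∏ i, γ i (x i))
    rw [this]
    refine hasSum_single 0 fun k hk => ?_
    simp [Pi.single_eq_of_ne hk]

/-- Countably many representations merge into one: the double series converges absolutely, and
`Nat.unpair` lists its terms in a single sequence. -/
theorem HasConvRep.hasSum {f : ℕ → (Fin n → E) → ℂ} {g : (Fin n → E) → ℂ} {C : ℕ → ℝ}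
    (h : ∀ j, HasConvRep (f j) (C j)) (hC : Summable C)
    (hg : ∀ x, HasSum (fun j => f j x) (g x)) : HasConvRep g (∑' j, C j) := by
  choose l γ h1 h2 h3 h4 h5 using h
  have hs : Summable fun q : ℕ × ℕ => l q.1 q.2 := by
    rw [summable_prod_of_nonneg fun q => h1 q.1 q.2]
    exact ⟨h3, Summable.of_nonneg_of_le (fun j => tsum_nonneg (h1 j)) h4 hC⟩
  refine ⟨fun k => l k.unpair.1 k.unpair.2, fun k => γ k.unpair.1 k.unpair.2, fun k => h1 _ _,
    fun k => h2 _ _, (Nat.pairEquiv.symm.summable_iff (f := fun q : ℕ × ℕ => l q.1 q.2)).2 hs,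
    ?_, fun x => ?_⟩
  · refine (Nat.pairEquiv.symm.tsum_eq fun q : ℕ × ℕ => l q.1 q.2).trans_le ?_
    rw [hs.tsum_prod' h3]
    exact (hs.prod_factor |> fun _ => Summable.tsum_le_tsum h4
      (Summable.of_nonneg_of_le (fun j => tsum_nonneg (h1 j)) h4 hC) hC)
  · refine (Nat.pairEquiv.symm.hasSum_iff
      (f := fun q : ℕ × ℕ => (l q.1 q.2 : ℂ) * ∏ i, γ q.1 q.2 i (x i))).2 ?_
    have hsum : Summable fun q : ℕ × ℕ => (l q.1 q.2 : ℂ) * ∏ i, γ q.1 q.2 i (x i) := by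
      refine Summable.of_norm_bounded (hs.mul_right (∏ i, ‖x i‖)) fun q => ?_
      rw [norm_mul, Complex.norm_of_nonneg (h1 _ _)]
      exact mul_le_mul_of_nonneg_left (norm_prod_apply_le (h2 _ _) x) (h1 _ _)
    have := (hsum.hasSum.prod_fiberwise fun j => h5 j x).unique (hg x)
    rw [← this]
    exact hsum.hasSum

theorem hasConvRep_zero : HasConvRep (fun _ : Fin n → E => (0 : ℂ)) 0 :=
  ⟨fun _ => 0, fun _ _ => 0, fun _ => le_rfl, by simp, summable_zero, by simp, by simp⟩

theorem HasConvRep.add {f g : (Fin n → E) → ℂ} {C D : ℝ} (hf : HasConvRep f C)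
    (hg : HasConvRep g D) : HasConvRep (fun x => f x + g x) (C + D) := by
  have h := HasConvRep.hasSum (f := fun j => if j = 0 then f else if j = 1 then g else fun _ => 0)
    (C := fun j => if j = 0 then C else if j = 1 then D else 0) (g := fun x => f x + g x)
    (fun j => by
      rcases Nat.lt_or_ge j 2 with hj | hj
      · interval_cases j
        · simpa using hf
        · simpa using hg
      · simpa [show j ≠ 0 by omega, show j ≠ 1 by omega] using hasConvRep_zero)
    (summable_of_ne_finset_zero (s := {0, 1}) (by
      intro b hb
      simp only [Finset.mem_insert, Finset.mem_singleton, not_or] at hb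
      simp [hb.1, hb.2])) (fun x => by
      have : HasSum (fun j : ℕ => (if j = 0 then f else if j = 1 then g else fun _ => 0) x) _ :=
        hasSum_sum_of_ne_finset_zero (s := {0, 1}) (by
          intro b hb
          simp only [Finset.mem_insert, Finset.mem_singleton, not_or] at hb
          simp [hb.1, hb.2])
      convert! this using 1
      simp)
  refine h.mono (le_of_eq ?_)
  rw [tsum_eq_sum (s := {0, 1})]
  · simp
  · intro b hb
    simp only [Finset.mem_insert, Finset.mem_singleton, not_or] at hb
    simp [hb.1, hb.2]

theorem HasConvRep.sum {ι : Type*} {f : ι → (Fin n → E) → ℂ} {C : ι → ℝ} (s : Finset ι)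
    (h : ∀ j ∈ s, HasConvRep (f j) (C j)) :
    HasConvRep (fun x => ∑ j ∈ s, f j x) (∑ j ∈ s, C j) := by
  classical
  induction s using Finset.induction_on with
  | empty => simpa using hasConvRep_zero
  | insert a s ha ih =>
    simp only [Finset.sum_insert ha]
    exact (h a (Finset.mem_insert_self _ _)).add
      (ih fun j hj => h j (Finset.mem_insert_of_mem hj))

theorem HasConvRep.cons {f : (Fin n → E) → ℂ} {C : ℝ} (hf : HasConvRep f C)
    {φ : StrongDual ℂ E} (hφ : ‖φ‖ ≤ 1) :
    HasConvRep (fun x : Fin (n + 1) → E => φ (x 0) * f (fun i => x i.succ)) C := by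
  obtain ⟨l, γ, h1, h2, h3, h4, h5⟩ := hf
  refine ⟨l, fun k => Fin.cons φ (γ k), h1, fun k i => ?_, h3, h4, fun x => ?_⟩
  · refine Fin.cases ?_ (fun j => ?_) i
    · simpa using hφ
    · simpa using h2 k j
  · simpa [Fin.prod_univ_succ, mul_left_comm] using (h5 fun i => x i.succ).mul_left (φ (x 0))

/-- Orthogonality of the Rademacher signs. -/
theorem sum_powerset_sign_mul (F : Finset ℕ) (u v : ℕ → ℂ) :
    ∑ S ∈ F.powerset, (∑ k ∈ F, (if k ∈ S then 1 else -1) * u k) *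
      (∑ k ∈ F, (if k ∈ S then 1 else -1) * v k) = 2 ^ F.card * ∑ k ∈ F, u k * v k := by
  induction F using Finset.induction_on with
  | empty => simp
  | insert a F ha ih =>
    rw [Finset.sum_powerset_insert ha, ← Finset.sum_add_distrib]
    -- The two sign patterns that agree on `F` and differ at `a` are added; the cross terms between
    -- `a` and `F` cancel.
    have key : ∀ S ∈ F.powerset,
        (∑ k ∈ insert a F, (if k ∈ S then 1 else -1) * u k) *
          (∑ k ∈ insert a F, (if k ∈ S then 1 else -1) * v k) +
        (∑ k ∈ insert a F, (if k ∈ insert a S then 1 else -1) * u k) *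
          (∑ k ∈ insert a F, (if k ∈ insert a S then 1 else -1) * v k) =
        2 * (u a * v a) + 2 * ((∑ k ∈ F, (if k ∈ S then 1 else -1) * u k) *
      (∑ k ∈ F, (if k ∈ S then 1 else -1) * v k)) := by
      intro S hS
      have haS : a ∉ S := fun h => ha (Finset.mem_powerset.1 hS h)
      have : ∀ z : ℕ → ℂ, ∑ k ∈ F, (if k ∈ insert a S then 1 else -1) * z k =
          ∑ k ∈ F, (if k ∈ S then 1 else -1) * z k := fun z =>
        Finset.sum_congr rfl fun k hk => by
          have : k ≠ a := fun h => ha (h ▸ hk)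
          simp [this]
      simp only [Finset.sum_insert ha, this, haS, Finset.mem_insert_self, if_true, if_false]
      ring
    rw [Finset.sum_congr rfl key, Finset.sum_add_distrib, Finset.sum_const, ← Finset.mul_sum,
      ih, Finset.sum_insert ha, Finset.card_insert_of_notMem ha, Finset.card_powerset,
      nsmul_eq_mul]
    push_cast
    ring

/-! ### Spaces with an unconditional system of unit vectors -/

/-- `c` gives the coordinates with respect to a `1`-unconditional normalized system `e`. -/
structure IsUncond (c : E →ₗ[ℂ] ℕ → ℂ) (e : ℕ → E) : Prop where
  coord : ∀ j, c (e j) = Pi.single j 1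
  norm_eq : ∀ j, ‖e j‖ = 1
  contract : ∀ (F : Finset ℕ) (t : ℕ → ℂ), (∀ k, ‖t k‖ ≤ 1) → ∀ x,
    ‖∑ k ∈ F, (t k * c x k) • e k‖ ≤ ‖x‖

/-- The sequences that define functionals of norm at most one (on finite sections). -/
def dualBall (c : E → ℕ → ℂ) : Set (ℕ → ℂ) :=
  {g | ∀ (F : Finset ℕ) (x : E), ‖∑ k ∈ F, g k * c x k‖ ≤ ‖x‖}

/-- The polar of `{|g|ⁿ : g ∈ B}`. -/
def powPolar (n : ℕ) (B : Set (ℕ → ℂ)) : Set (ℕ → ℂ) :=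
  {x | ∀ g ∈ B, ∀ F : Finset ℕ, ∑ k ∈ F, ‖x k‖ * ‖g k‖ ^ n ≤ 1}

/-- The extended norm dual to the set `U` of sequences. -/
def polarENorm (U : Set (ℕ → ℂ)) (α : ℕ → ℂ) : ℝ≥0∞ :=
  ⨆ x ∈ U, ∑' k, ‖α k * x k‖ₑ

/-- A unimodular number (or `0`) that rotates `z` to `‖z‖`. -/
def phase (z : ℂ) : ℂ := (starRingEnd ℂ z) / ‖z‖

theorem norm_phase_le (z : ℂ) : ‖phase z‖ ≤ 1 := by
  rw [phase, norm_div, RCLike.norm_conj, Complex.norm_real, norm_norm]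
  exact div_self_le_one _

theorem phase_mul (z : ℂ) : phase z * z = ‖z‖ := by
  rw [phase, div_mul_eq_mul_div, mul_comm, Complex.mul_conj, Complex.normSq_eq_norm_sq]
  by_cases h : (‖z‖ : ℂ) = 0
  · rw [h, div_zero]
  · push_cast; field_simp

variable {c : E →ₗ[ℂ] ℕ → ℂ} {e : ℕ → E}

theorem IsUncond.norm_coord_le (h : IsUncond c e) (x : E) (k : ℕ) : ‖c x k‖ ≤ ‖x‖ := by
  simpa [norm_smul, h.norm_eq] using h.contract {k} 1 (by simp) x

theorem IsUncond.coord_sum (h : IsUncond c e) (F : Finset ℕ) (a : ℕ → ℂ) (k : ℕ) :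
    c (∑ j ∈ F, a j • e j) k = if k ∈ F then a k else 0 := by
  simp only [map_sum, map_smul, h.coord, Finset.sum_apply, Pi.smul_apply, smul_eq_mul]
  simp [Pi.single_apply]

/-- The multiplier can be moved from `g` to `x`, where unconditionality makes it a contraction. -/
theorem IsUncond.mul_mem_dualBall (h : IsUncond c e) {g t : ℕ → ℂ} (hg : g ∈ dualBall c)
    (ht : ∀ k, ‖t k‖ ≤ 1) : (fun k => t k * g k) ∈ dualBall c := by
  intro F x
  refine le_trans (le_of_eq ?_) ((hg F (∑ k ∈ F, (t k * c x k) • e k)).trans (h.contract F t ht x))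
  congr 1
  refine Finset.sum_congr rfl fun k hk => ?_
  rw [h.coord_sum, if_pos hk]
  ring

theorem IsUncond.single_mem_dualBall (h : IsUncond c e) (j : ℕ) :
    (Pi.single j 1 : ℕ → ℂ) ∈ dualBall c := by
  intro F x
  simp only [Pi.single_apply, ite_mul, one_mul, zero_mul, Finset.sum_ite_eq']
  split_ifs
  · exact h.norm_coord_le x j
  · simp

theorem IsUncond.apply_mem_dualBall (h : IsUncond c e) {φ : StrongDual ℂ E} (hφ : ‖φ‖ ≤ 1) :
    (fun k => φ (e k)) ∈ dualBall c := by
  intro F x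
  have h1 := φ.le_of_opNorm_le hφ (∑ k ∈ F, ((1 : ℕ → ℂ) k * c x k) • e k)
  rw [one_mul] at h1
  refine le_trans (le_of_eq ?_) (h1.trans (h.contract F 1 (by simp) x))
  congr 1
  simp only [map_sum, map_smul, smul_eq_mul, Pi.one_apply, one_mul]
  exact Finset.sum_congr rfl fun k _ => mul_comm _ _

/-- Only finite sections of `g` are controlled by `dualBall`, and only they are turned into
functionals; convergence of the whole series is never an issue. -/
theorem exists_functional {g : ℕ → ℂ} (hg : g ∈ dualBall c) (F : Finset ℕ) :
    ∃ φ : StrongDual ℂ E, ‖φ‖ ≤ 1 ∧ ∀ x, φ x = ∑ k ∈ F, g k * c x k := by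
  let f : E →ₗ[ℂ] ℂ :=
    { toFun := fun x => ∑ k ∈ F, g k * c x k
      map_add' := fun x y => by simp [mul_add, Finset.sum_add_distrib]
      map_smul' := fun a x => by
        simp only [map_smul, Pi.smul_apply, smul_eq_mul, RingHom.id_apply, Finset.mul_sum]
        exact Finset.sum_congr rfl fun k _ => by ring }
  exact ⟨f.mkContinuous 1 fun x => by rw [one_mul]; exact hg F x,
    f.mkContinuous_norm_le zero_le_one _, fun x => rfl⟩

/-- By orthogonality of signs, ∑ u v is the average over ε of (∑ ε u)(∑ ε v). With u the first
factor, the first bracket is a functional of `x 0`; in the second the signs are put on one of the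
remaining factors and induction applies. Signs preserve `dualBall`, so the constant stays `1`. -/
theorem IsUncond.hasConvRep_prod (h : IsUncond c e) (m : ℕ) (F : Finset ℕ)
    (g : Fin (m + 1) → ℕ → ℂ) (hg : ∀ i, g i ∈ dualBall c) :
    HasConvRep (fun x : Fin (m + 1) → E => ∑ k ∈ F, ∏ i, (g i k * c (x i) k)) 1 := by
  induction m with
  | zero =>
    obtain ⟨φ, hφ, hφ'⟩ := exists_functional (hg 0) F
    have := LorentzForms.hasConvRep_prod (n := 1) le_rfl 1 (γ := fun _ => φ) fun _ => hφ
    simpa [hφ'] using this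
  | succ m ih =>
    have hs : ∀ (S : Finset ℕ) (k : ℕ), ‖(if k ∈ S then 1 else -1 : ℂ)‖ ≤ 1 := by
      intro S k; split_ifs <;> simp
    have key : ∀ S ∈ F.powerset, HasConvRep (fun x : Fin (m + 2) → E =>
        (((2 : ℝ) ^ F.card)⁻¹ : ℝ) * ((∑ k ∈ F, (if k ∈ S then 1 else -1) * (g 0 k * c (x 0) k)) *
        (∑ k ∈ F, (if k ∈ S then 1 else -1) * ∏ i : Fin (m + 1), (g i.succ k * c (x i.succ) k))))
        (((2 : ℝ) ^ F.card)⁻¹ * 1) := by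
      intro S _
      refine HasConvRep.real_mul ?_ (by positivity)
      obtain ⟨φ, hφ, hφ'⟩ := exists_functional (h.mul_mem_dualBall (hg 0) (hs S)) F
      have h1 := (ih (Fin.cons (fun k => (if k ∈ S then 1 else -1) * g 1 k)
        (fun i => g i.succ.succ)) (fun i => by
          refine Fin.cases ?_ (fun j => ?_) i
          · exact h.mul_mem_dualBall (hg 1) (hs S)
          · exact hg _)).cons hφ
      convert h1 using 2 with x
      congr 1
      · rw [hφ']
        exact Finset.sum_congr rfl fun k _ => by ring
      · refine Finset.sum_congr rfl fun k _ => ?_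
        rw [Fin.prod_univ_succ, Fin.prod_univ_succ]
        simp only [Fin.cons_zero, Fin.cons_succ, Fin.succ_zero_eq_one]
        ring
    have := HasConvRep.sum _ key
    have h2 : (2 : ℝ) ^ F.card ≠ 0 := by positivity
    rw [Finset.sum_const, Finset.card_powerset, nsmul_eq_mul, mul_one, Nat.cast_pow,
      Nat.cast_ofNat, mul_inv_cancel₀ h2] at this
    convert this using 2 with x
    rw [← Finset.mul_sum, sum_powerset_sign_mul, ← mul_assoc]
    push_cast
    rw [inv_mul_cancel₀ (by exact_mod_cast h2), one_mul]
    exact Finset.sum_congr rfl fun k _ => by rw [Fin.prod_univ_succ]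

/-- Finite diagonal forms are, up to `ε`, averages of products of functionals (bipolar theorem). -/
theorem IsUncond.hasConvRep_of_pos (h : IsUncond c e) (hn : 1 ≤ n) (F : Finset ℕ) (α : ℕ → ℂ)
    {C ε : ℝ} (hC : 0 < C) (hα : polarENorm (powPolar n (dualBall c)) α ≤ ENNReal.ofReal C)
    (hε : 0 < ε) :
    HasConvRep (fun x : Fin n → E => ∑ k ∈ F, α k * ∏ i, c (x i) k) (C + ε) := by
  classical
  obtain ⟨m, rfl⟩ : ∃ m, n = m + 1 := ⟨n - 1, by omega⟩
  -- The coefficient vectors on `F` with a representation of mass `C`. The goal is that `α` lies in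
  -- the closure of this convex set.
  let Q : Set (F → ℂ) := {a | HasConvRep (fun x : Fin (m + 1) → E =>
    ∑ k : F, a k * ∏ i, c (x i) k) C}
  have hQ : Convex ℝ Q := by
    intro a ha b hb s t hs ht hst
    have := (HasConvRep.real_mul ha hs).add (HasConvRep.real_mul hb ht)
    rw [← add_mul, hst, one_mul] at this
    change HasConvRep _ _
    convert this using 2 with x
    rw [Finset.mul_sum, Finset.mul_sum, ← Finset.sum_add_distrib]
    refine Finset.sum_congr rfl fun k _ => ?_
    simp only [Pi.add_apply, Pi.smul_apply, Complex.real_smul]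
    ring
  have hmem : (fun k : F => α k) ∈ closure Q := by
    by_contra hnot
    -- Separation: Re f < u on the closure of `Q`, while Re f exceeds u at `α`. The coefficients `X`
    -- of `f`, rescaled by `C / u`, turn out to lie in the polar, which contradicts the bound on
    -- `α`.
    obtain ⟨f, u, hf, hu⟩ := RCLike.geometric_hahn_banach_closed_point (𝕜 := ℂ) hQ.closure
      isClosed_closure hnot
    have hfsum : ∀ a : F → ℂ, f a = ∑ k : F, a k * f (Pi.single k 1) := by
      intro a
      conv_lhs => rw [← Finset.univ_sum_single a]
      rw [map_sum]
      refine Finset.sum_congr rfl fun k _ => ?_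
      have : Pi.single k (a k) = a k • (Pi.single k 1 : F → ℂ) := by
        rw [← Pi.single_smul, smul_eq_mul, mul_one]
      rw [this, map_smul, smul_eq_mul]
    let X : ℕ → ℂ := fun k => if hk : k ∈ F then f (Pi.single ⟨k, hk⟩ 1) else 0
    have hX : ∀ k : F, X k = f (Pi.single k 1) := fun k => by simp [X]
    have hX0 : ∀ k, k ∉ F → X k = 0 := fun k hk => by simp [X, hk]
    have hb : ∀ g ∈ dualBall c, C * ∑ k ∈ F, ‖X k‖ * ‖g k‖ ^ (m + 1) ≤ u := by
      intro g hg
      -- These phases make the value of `f` at the chosen point of `Q` equal to `C` times the sum of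
      -- moduli, so Re f < u bounds that sum.
      let τ : ℕ → ℂ := fun k => phase (X k * g k ^ (m + 1))
      have hτ : ∀ k, ‖τ k‖ ≤ 1 := fun k => norm_phase_le _
      have h1 := (h.hasConvRep_prod m F (Fin.cons (fun k => τ k * g k) fun _ => g) (fun i => by
          refine Fin.cases ?_ (fun j => ?_) i
          · exact h.mul_mem_dualBall hg hτ
          · exact hg)).real_mul hC.le
      rw [mul_one] at h1
      have h2 : (fun k : F => C * (τ k * g k ^ (m + 1))) ∈ Q := by
        change HasConvRep _ _
        convert h1 using 2 with x
        rw [Finset.mul_sum, ← Finset.sum_coe_sort F]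
        refine Finset.sum_congr rfl fun k _ => ?_
        rw [Finset.prod_mul_distrib]
        conv_rhs => rw [Fin.prod_univ_succ]
        simp only [Fin.cons_zero, Fin.cons_succ, Finset.prod_const, Finset.card_univ,
          Fintype.card_fin]
        ring
      have h3 := hf _ (subset_closure h2)
      rw [hfsum] at h3
      refine le_trans (le_of_eq ?_) h3.le
      have : ∑ k : F, (C * (τ k * g k ^ (m + 1))) * f (Pi.single k 1) =
          ((C * ∑ k ∈ F, ‖X k‖ * ‖g k‖ ^ (m + 1) : ℝ) : ℂ) := by
        rw [← Finset.sum_coe_sort F, Finset.mul_sum]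
        push_cast
        refine Finset.sum_congr rfl fun k _ => ?_
        have h4 := phase_mul (X k * g k ^ (m + 1))
        rw [norm_mul, norm_pow] at h4
        push_cast at h4
        rw [← h4, ← hX]
        ring
      rw [this]
      exact (Complex.ofReal_re _).symm
    have hu0 : 0 ≤ u := by
      have := hb 0 (fun F x => by simp)
      simpa using this
    have hupos : 0 < u := by
      have h0 : (0 : F → ℂ) ∈ Q := by
        change HasConvRep _ _
        simpa using hasConvRep_zero.mono hC.le
      simpa using hf 0 (subset_closure h0)
    have hXU : (fun k => ((C / u : ℝ) : ℂ) * X k) ∈ powPolar (m + 1) (dualBall c) := by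
      intro g hg F'
      have h1 : ∑ k ∈ F', ‖X k‖ * ‖g k‖ ^ (m + 1) ≤ ∑ k ∈ F, ‖X k‖ * ‖g k‖ ^ (m + 1) := by
        rw [← Finset.sum_inter_add_sum_sdiff F' F]
        rw [Finset.sum_eq_zero (s := F' \ F), add_zero]
        · exact Finset.sum_le_sum_of_subset_of_nonneg Finset.inter_subset_right
            fun _ _ _ => by positivity
        · intro k hk
          simp [hX0 k (Finset.mem_sdiff.1 hk).2]
      have h2 : ∑ k ∈ F', ‖((C / u : ℝ) : ℂ) * X k‖ * ‖g k‖ ^ (m + 1) =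
          (C / u) * ∑ k ∈ F', ‖X k‖ * ‖g k‖ ^ (m + 1) := by
        rw [Finset.mul_sum]
        refine Finset.sum_congr rfl fun k _ => ?_
        rw [norm_mul, Complex.norm_of_nonneg (by positivity), mul_assoc]
      rw [h2, div_mul_eq_mul_div, div_le_one hupos]
      exact (mul_le_mul_of_nonneg_left h1 hC.le).trans (hb g hg)
    have h5 : ∑ k ∈ F, ‖α k * (((C / u : ℝ) : ℂ) * X k)‖ ≤ C := by
      have h6 := (ENNReal.sum_le_tsum F).trans ((le_iSup₂ (f := fun (x : ℕ → ℂ)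
        (_ : x ∈ powPolar (m + 1) (dualBall c)) => ∑' k, ‖α k * x k‖ₑ) _ hXU).trans hα)
      simp only [← ofReal_norm] at h6
      rw [← ENNReal.ofReal_sum_of_nonneg fun _ _ => norm_nonneg _] at h6
      exact (ENNReal.ofReal_le_ofReal_iff hC.le).1 h6
    have h7 : ∑ k ∈ F, ‖α k * (((C / u : ℝ) : ℂ) * X k)‖ = (C / u) * ∑ k ∈ F, ‖α k * X k‖ := by
      rw [Finset.mul_sum]
      refine Finset.sum_congr rfl fun k _ => ?_
      rw [mul_left_comm, norm_mul, Complex.norm_of_nonneg (by positivity)]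
    have h8 : ∑ k ∈ F, ‖α k * X k‖ ≤ u := by
      rw [h7, div_mul_eq_mul_div, div_le_iff₀ hupos] at h5
      exact le_of_mul_le_mul_left h5 hC
    refine absurd (hu.trans_le ((Complex.re_le_norm _).trans ?_)) (lt_irrefl u)
    rw [hfsum]
    refine (norm_sum_le _ _).trans (le_trans (le_of_eq ?_) h8)
    rw [← Finset.sum_coe_sort F]
    exact Finset.sum_congr rfl fun k _ => by rw [hX]
  obtain ⟨a, ha, hdist⟩ := Metric.mem_closure_iff.1 hmem (ε / (F.card + 1)) (by positivity)
  -- The error `α - a` is represented coordinate by coordinate, each at the cost of its modulus,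
  -- which is below `ε / (F.card + 1)`.
  have h1 : HasConvRep (fun x : Fin (m + 1) → E =>
      ∑ k : F, (α k - a k) * ∏ i, c (x i) k) (∑ k : F, ‖α k - a k‖) := by
    refine HasConvRep.sum _ fun k _ => ?_
    obtain ⟨φ, hφ, hφ'⟩ := exists_functional (h.single_mem_dualBall k) {(k : ℕ)}
    simpa [hφ'] using LorentzForms.hasConvRep_prod hn (α k - a k) (γ := fun _ => φ) fun _ => hφ
  have h2 : ∑ k : F, ‖α k - a k‖ ≤ ε := by
    have h3 : ∀ k ∈ (Finset.univ : Finset F), ‖α k - a k‖ ≤ ε / (F.card + 1) := fun k _ => by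
      rw [← dist_eq_norm]
      exact (dist_le_pi_dist (fun k : F => α k) a k).trans hdist.le
    refine (Finset.sum_le_card_nsmul _ _ _ h3).trans ?_
    rw [nsmul_eq_mul, Finset.card_univ, Fintype.card_coe, mul_div_assoc', div_le_iff₀ (by positivity)]
    nlinarith
  have h3 := (HasConvRep.add ha h1).mono (add_le_add_right h2 C)
  convert h3 using 2 with x
  rw [← Finset.sum_add_distrib, ← Finset.sum_coe_sort F]
  exact Finset.sum_congr rfl fun k _ => by ring

/-- The separation argument needs `C > 0`; half of `ε` pays for enlarging `C`. -/
theorem IsUncond.hasConvRep_of_le (h : IsUncond c e) (hn : 1 ≤ n) (F : Finset ℕ) (α : ℕ → ℂ)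
    {C ε : ℝ} (hC : 0 ≤ C) (hα : polarENorm (powPolar n (dualBall c)) α ≤ ENNReal.ofReal C)
    (hε : 0 < ε) :
    HasConvRep (fun x : Fin n → E => ∑ k ∈ F, α k * ∏ i, c (x i) k) (C + ε) := by
  have := h.hasConvRep_of_pos hn F α (C := C + ε / 2) (ε := ε / 2) (by positivity)
    (hα.trans (ENNReal.ofReal_le_ofReal (by linarith))) (by positivity)
  exact this.mono (by linarith)

end ConvRep

variable {E : Type} [NormedAddCommGroup E] [NormedSpace ℂ E] {n : ℕ}

/-! ### Representing measures -/

instance : T2Space (DualBallPow E n) :=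
  inferInstanceAs (T2Space (Fin n → {φ : WeakDual ℂ E // ‖WeakDual.toStrongDual φ‖ ≤ 1}))

instance : CompactSpace (DualBallPow E n) := by
  have h := WeakDual.isCompact_closedBall (𝕜 := ℂ) (E := E) 0 1
  have h2 : IsCompact {φ : WeakDual ℂ E | ‖WeakDual.toStrongDual φ‖ ≤ 1} := by
    convert h using 1
    ext φ
    simp
  have : CompactSpace {φ : WeakDual ℂ E // ‖WeakDual.toStrongDual φ‖ ≤ 1} :=
    isCompact_iff_compactSpace.1 h2
  exact inferInstanceAs
    (CompactSpace (Fin n → {φ : WeakDual ℂ E // ‖WeakDual.toStrongDual φ‖ ≤ 1}))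

theorem continuous_evalProd (x : Fin n → E) :
    Continuous fun γ : DualBallPow E n => ∏ i, (γ i).1 (x i) :=
  continuous_finsetProd _ fun i _ =>
    (WeakDual.eval_continuous (x i)).comp (continuous_subtype_val.comp (continuous_apply i))

theorem integrable_evalProd {μ : Measure (DualBallPow E n)} [IsFiniteMeasure μ]
    (x : Fin n → E) : Integrable (fun γ : DualBallPow E n => ∏ i, (γ i).1 (x i)) μ := by
  obtain ⟨C, hC⟩ := isCompact_univ.exists_bound_of_continuousOn
    (continuous_evalProd (n := n) x).continuousOn
  have hm : Measurable fun γ : DualBallPow E n => ∏ i, (γ i).1 (x i) :=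
    (continuous_evalProd x).measurable
  exact Integrable.of_bound hm.aestronglyMeasurable C
    (Eventually.of_forall fun γ => hC γ (Set.mem_univ γ))

/-- A limit of positive functionals of the form `h ↦ ∑ₖ l k * h (γ k)`. -/
theorem exists_measure_of_atomic {X : Type*} [TopologicalSpace X] [T2Space X] [CompactSpace X]
    [MeasurableSpace X] [BorelSpace X] (l : ℕ → ℕ → ℝ) (γ : ℕ → ℕ → X) (hl : ∀ N k, 0 ≤ l N k)
    (hs : ∀ N, Summable (l N)) {C : ℝ} {D : ℕ → ℝ} (hD : ∀ N, ∑' k, l N k ≤ D N)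
    (hDC : Tendsto D atTop (𝓝 C)) :
    ∃ μ : Measure X, IsFiniteMeasure μ ∧ μ.Regular ∧ μ.real Set.univ ≤ C ∧
      ∀ h : C(X, ℝ), ∀ L : ℝ, Tendsto (fun N => ∑' k, l N k * h (γ N k)) atTop (𝓝 L) →
        ∫ y, h y ∂μ = L := by
  -- Along a nonprincipal ultrafilter the bounded values converge for every test function at once,
  -- linearly in it, and with the ordinary limit when there is one. This replaces weak-star
  -- compactness of bounded sets of measures.
  let U : Ultrafilter ℕ := hyperfilter ℕ
  have hU : (U : Filter ℕ) ≤ atTop := Nat.hyperfilter_le_atTop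
  have hb : ∀ (h : C(X, ℝ)) (N k : ℕ), ‖l N k * h (γ N k)‖ ≤ l N k * ‖h‖ := fun h N k => by
    rw [norm_mul, Real.norm_of_nonneg (hl N k)]
    exact mul_le_mul_of_nonneg_left (h.norm_coe_le_norm _) (hl N k)
  have hsum : ∀ (h : C(X, ℝ)) N, Summable fun k => l N k * h (γ N k) := fun h N =>
    Summable.of_norm_bounded ((hs N).mul_right ‖h‖) (hb h N)
  obtain ⟨K, hK⟩ := hDC.bddAbove_range
  have hlim : ∀ h : C(X, ℝ), ∃ L, Tendsto (fun N => ∑' k, l N k * h (γ N k)) U (𝓝 L) := by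
    intro h
    have hbd : ∀ N, ∑' k, l N k * h (γ N k) ∈ Metric.closedBall (0 : ℝ) (K * ‖h‖) := fun N => by
      rw [mem_closedBall_zero_iff]
      refine (tsum_of_norm_bounded ((hs N).mul_right _).hasSum (hb h N)).trans ?_
      rw [tsum_mul_right]
      exact mul_le_mul_of_nonneg_right ((hD N).trans (hK ⟨N, rfl⟩)) (norm_nonneg _)
    obtain ⟨L, -, hL⟩ := (isCompact_closedBall (0 : ℝ) (K * ‖h‖)).ultrafilter_le_nhds
      (U.map fun N => ∑' k, l N k * h (γ N k)) (by
        rw [le_principal_iff]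
        exact mem_map.2 (univ_mem' hbd))
    exact ⟨L, hL⟩
  choose Λ hΛ using hlim
  let toC : CompactlySupportedContinuousMap X ℝ → C(X, ℝ) := fun f => ⟨f, f.continuous⟩
  let Λ₀ : CompactlySupportedContinuousMap X ℝ →ₗ[ℝ] ℝ :=
    { toFun := fun f => Λ (toC f)
      map_add' := fun f g => by
        refine tendsto_nhds_unique (hΛ _) (((hΛ (toC f)).add (hΛ (toC g))).congr fun N => ?_)
        rw [← (hsum _ N).tsum_add (hsum _ N)]
        exact tsum_congr fun k => (mul_add _ _ _).symm
      map_smul' := fun a f => by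
        refine tendsto_nhds_unique (hΛ _) (((hΛ (toC f)).const_mul a).congr fun N => ?_)
        rw [← tsum_mul_left]
        exact tsum_congr fun k => mul_left_comm _ _ _ }
  let Λp : CompactlySupportedContinuousMap X ℝ →ₚ[ℝ] ℝ := PositiveLinearMap.mk₀ Λ₀ fun f hf =>
    ge_of_tendsto (hΛ (toC f)) (Eventually.of_forall fun N =>
      tsum_nonneg fun k => mul_nonneg (hl N k) (hf (γ N k)))
  have hint : ∀ h : C(X, ℝ), ∫ y, h y ∂(RealRMK.rieszMeasure Λp) = Λ h := fun h =>
    RealRMK.integral_rieszMeasure Λp (CompactlySupportedContinuousMap.continuousMapEquiv h)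
  have hreg : (RealRMK.rieszMeasure Λp).Regular := inferInstance
  have hfin : IsFiniteMeasure (RealRMK.rieszMeasure Λp) := inferInstance
  refine ⟨RealRMK.rieszMeasure Λp, hfin, hreg, ?_, fun h L hL => ?_⟩
  · have h1 := hint 1
    simp only [ContinuousMap.one_apply, integral_const, smul_eq_mul, mul_one] at h1
    rw [h1]
    refine le_of_tendsto_of_tendsto' (hΛ 1) (hDC.mono_left hU) fun N => ?_
    simpa using hD N
  · rw [hint]
    exact tendsto_nhds_unique (hΛ h) (hL.mono_left hU)

/-- The terms of the approximating series become point masses in the compact space of `n`-tuples of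
functionals. Real and imaginary parts of the evaluation product are treated apart, since the limit
measure comes from a real functional. -/
theorem exists_represents (T : Form E n) {f : ℕ → (Fin n → E) → ℂ} {C : ℝ} {D : ℕ → ℝ}
    (hf : ∀ N, HasConvRep (f N) (D N)) (hDC : Tendsto D atTop (𝓝 C))
    (hT : ∀ x, Tendsto (fun N => f N x) atTop (𝓝 (T x))) :
    ∃ μ, Represents T μ ∧ μ.real Set.univ ≤ C := by
  choose l γ h1 h2 h3 h4 h5 using hf
  let pt : ℕ → ℕ → DualBallPow E n := fun N k i => ⟨StrongDual.toWeakDual (γ N k i), h2 N k i⟩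
  obtain ⟨μ, hfin, hreg, hC, hμ⟩ := exists_measure_of_atomic l pt h1 h3 h4 hDC
  refine ⟨μ, ⟨hfin, hreg, fun x => ?_⟩, hC⟩
  have hint := integrable_evalProd (μ := μ) x
  have hsum : ∀ N, HasSum (fun k => (l N k : ℂ) * ∏ i, (pt N k i).1 (x i)) (f N x) :=
    fun N => h5 N x
  have hre := hμ ⟨fun y => (∏ i, (y i).1 (x i)).re,
    Complex.continuous_re.comp (continuous_evalProd x)⟩ (T x).re
    (((Complex.continuous_re.tendsto _).comp (hT x)).congr fun N => by
      rw [Function.comp_apply, ← (Complex.hasSum_re (hsum N)).tsum_eq]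
      exact tsum_congr fun k => by simp)
  have him := hμ ⟨fun y => (∏ i, (y i).1 (x i)).im,
    Complex.continuous_im.comp (continuous_evalProd x)⟩ (T x).im
    (((Complex.continuous_im.tendsto _).comp (hT x)).congr fun N => by
      rw [Function.comp_apply, ← (Complex.hasSum_im (hsum N)).tsum_eq]
      exact tsum_congr fun k => by simp)
  apply Complex.ext
  · rw [← hre]
    exact (integral_re hint)
  · rw [← him]
    exact (integral_im hint)

/-! ### Testing diagonal forms -/

variable {c : E →ₗ[ℂ] ℕ → ℂ} {e : ℕ → E}

/-- At (e_k, …, e_k) only the `k`-th term survives, provided that `n ≠ 0`: an empty product would be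
`1` in every term. -/
theorem IsDiagonal.apply_unit (h : IsUncond c e) (hn : 1 ≤ n) {α : ℕ → ℂ} {T : Form E n}
    (hT : IsDiagonal c α T) (k : ℕ) : T (fun _ => e k) = α k := by
  refine (hT fun _ => e k).unique ?_
  have := hasSum_single (f := fun j => α j * ∏ _i : Fin n, c (e k) j) k fun j hj => by
    rw [h.coord]
    simp [Pi.single_eq_of_ne hj, show n ≠ 0 by omega]
  simpa [h.coord] using this

theorem IsDiagonal.unique {α : ℕ → ℂ} {T T' : Form E n} (hT : IsDiagonal c α T)
    (hT' : IsDiagonal c α T') : T = T' :=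
  ContinuousMultilinearMap.ext fun x => (hT x).unique (hT' x)

/-- This is what lets the polar of `n`-th powers of single functionals control products of `n`
different ones. -/
theorem prod_le_mean_pow (hn : 1 ≤ n) (a : Fin n → ℝ) (ha : ∀ i, 0 ≤ a i) :
    ∏ i, a i ≤ ∑ i, (1 / n : ℝ) * a i ^ n := by
  have hn' : (n : ℝ) ≠ 0 := by positivity
  have := Real.geom_mean_le_arith_mean_weighted Finset.univ (fun _ : Fin n => (1 / n : ℝ))
    (fun i => a i ^ n) (fun _ _ => by positivity) (by simp [hn']) (fun i _ => pow_nonneg (ha i) n)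
  refine le_trans (le_of_eq (Finset.prod_congr rfl fun i _ => ?_)) this
  rw [one_div, Real.pow_rpow_inv_natCast (ha i) (by omega)]

theorem IsUncond.sum_prod_le_one (h : IsUncond c e) (hn : 1 ≤ n) {x : ℕ → ℂ}
    (hx : x ∈ powPolar n (dualBall c)) (F : Finset ℕ) {γ : Fin n → StrongDual ℂ E}
    (hγ : ∀ i, ‖γ i‖ ≤ 1) : ∑ k ∈ F, ‖x k‖ * ∏ i, ‖γ i (e k)‖ ≤ 1 := by
  have hn' : (n : ℝ) ≠ 0 := by positivity
  calc ∑ k ∈ F, ‖x k‖ * ∏ i, ‖γ i (e k)‖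
      ≤ ∑ k ∈ F, ‖x k‖ * ∑ i, (1 / n : ℝ) * ‖γ i (e k)‖ ^ n := by
        gcongr with k _
        exact prod_le_mean_pow hn _ fun i => norm_nonneg _
    _ = ∑ i : Fin n, (1 / n : ℝ) * ∑ k ∈ F, ‖x k‖ * ‖γ i (e k)‖ ^ n := by
        simp only [Finset.mul_sum]
        rw [Finset.sum_comm]
        exact Finset.sum_congr rfl fun i _ => Finset.sum_congr rfl fun k _ => by ring
    _ ≤ ∑ _i : Fin n, (1 / n : ℝ) * 1 := by
        gcongr with i _
        exact hx _ (h.apply_mem_dualBall (hγ i)) F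
    _ = 1 := by simp [hn']

/-- Homogeneity, needed because the nuclear norm carries the norms of the functionals. A zero
functional is harmless: the inverse of its norm is `0` and both sides vanish. -/
theorem IsUncond.sum_prod_le (h : IsUncond c e) (hn : 1 ≤ n) {x : ℕ → ℂ}
    (hx : x ∈ powPolar n (dualBall c)) (F : Finset ℕ) (γ : Fin n → StrongDual ℂ E) :
    ∑ k ∈ F, ‖x k‖ * ∏ i, ‖γ i (e k)‖ ≤ ∏ i, ‖γ i‖ := by
  have h1 := h.sum_prod_le_one hn hx F (γ := fun i => ((‖γ i‖⁻¹ : ℝ) : ℂ) • γ i) fun i => by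
    rw [norm_smul, Complex.norm_real, norm_inv, norm_norm]
    exact inv_mul_le_one
  have h2 : ∀ k, ∏ i, ‖γ i (e k)‖ =
      (∏ i, ‖γ i‖) * ∏ i, ‖(((‖γ i‖⁻¹ : ℝ) : ℂ) • γ i) (e k)‖ := by
    intro k
    rw [← Finset.prod_mul_distrib]
    refine Finset.prod_congr rfl fun i _ => ?_
    rw [smul_apply, norm_smul, Complex.norm_real, norm_inv, norm_norm]
    by_cases h0 : ‖γ i‖ = 0
    · rw [norm_eq_zero] at h0
      simp [h0]
    · rw [mul_inv_cancel_left₀ h0]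
  calc ∑ k ∈ F, ‖x k‖ * ∏ i, ‖γ i (e k)‖
      = (∏ i, ‖γ i‖) * ∑ k ∈ F, ‖x k‖ * ∏ i, ‖(((‖γ i‖⁻¹ : ℝ) : ℂ) • γ i) (e k)‖ := by
        rw [Finset.mul_sum]
        exact Finset.sum_congr rfl fun k _ => by rw [h2]; ring
    _ ≤ (∏ i, ‖γ i‖) * 1 :=
        mul_le_mul_of_nonneg_left h1 (Finset.prod_nonneg fun i _ => norm_nonneg _)
    _ = _ := mul_one _

theorem polarENorm_le_ofReal {U : Set (ℕ → ℂ)} {α : ℕ → ℂ} {C : ℝ}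
    (h : ∀ x ∈ U, ∀ F : Finset ℕ, ∑ k ∈ F, ‖α k * x k‖ ≤ C) :
    polarENorm U α ≤ ENNReal.ofReal C := by
  refine iSup₂_le fun x hx => ?_
  rw [ENNReal.tsum_eq_iSup_sum]
  refine iSup_le fun F => ?_
  simp only [← ofReal_norm]
  rw [← ENNReal.ofReal_sum_of_nonneg fun _ _ => norm_nonneg _]
  exact ENNReal.ofReal_le_ofReal (h x hx F)

theorem sum_le_of_polarENorm_le {U : Set (ℕ → ℂ)} {α : ℕ → ℂ} {C : ℝ} (hC : 0 ≤ C)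
    (h : polarENorm U α ≤ ENNReal.ofReal C) {x : ℕ → ℂ} (hx : x ∈ U) (F : Finset ℕ) :
    ∑ k ∈ F, ‖α k * x k‖ ≤ C := by
  have h6 := (ENNReal.sum_le_tsum F).trans ((le_iSup₂ (f := fun (x : ℕ → ℂ)
    (_ : x ∈ U) => ∑' k, ‖α k * x k‖ₑ) x hx).trans h)
  simp only [← ofReal_norm] at h6
  rw [← ENNReal.ofReal_sum_of_nonneg fun _ _ => norm_nonneg _] at h6
  exact (ENNReal.ofReal_le_ofReal_iff hC).1 h6

theorem polarENorm_mono {U : Set (ℕ → ℂ)} {α β : ℕ → ℂ} (h : ∀ k, ‖α k‖ ≤ ‖β k‖) :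
    polarENorm U α ≤ polarENorm U β := by
  refine iSup₂_mono fun x _ => ENNReal.tsum_le_tsum fun k => ?_
  rw [enorm_mul, enorm_mul]
  gcongr
  exact enorm_le_iff_norm_le.2 (h k)

/-- The coefficients are recovered as α(k) = T(e_k, …, e_k) = ∫ ∏ γ_i(e_k) dμ. After multiplication
by x(k) and a phase, the sum of moduli is the integral of a function bounded by `1`. -/
theorem Represents.polarENorm_le (h : IsUncond c e) (hn : 1 ≤ n) {α : ℕ → ℂ} {T : Form E n}
    (hT : IsDiagonal c α T) {μ : Measure (DualBallPow E n)} (hμ : Represents T μ) :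
    polarENorm (powPolar n (dualBall c)) α ≤ ENNReal.ofReal (μ.real Set.univ) := by
  obtain ⟨hfin, -, hrep⟩ := hμ
  refine polarENorm_le_ofReal fun x hx F => ?_
  have h1 : ((∑ k ∈ F, ‖α k * x k‖ : ℝ) : ℂ) =
      ∫ γ : DualBallPow E n, ∑ k ∈ F, (phase (α k * x k) * x k) * ∏ i, (γ i).1 (e k) ∂μ := by
    rw [integral_finsetSum _ fun k _ => (integrable_evalProd _).const_mul _]
    push_cast
    refine Finset.sum_congr rfl fun k _ => ?_
    rw [integral_const_mul, ← hrep fun _ => e k, hT.apply_unit h hn, ← phase_mul]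
    ring
  have h2 : ‖((∑ k ∈ F, ‖α k * x k‖ : ℝ) : ℂ)‖ ≤ 1 * μ.real Set.univ := by
    rw [h1]
    refine norm_integral_le_of_norm_le_const (Eventually.of_forall fun γ => ?_)
    refine (norm_sum_le _ _).trans (le_trans (Finset.sum_le_sum fun k _ => ?_)
      (h.sum_prod_le_one hn hx F (γ := fun i => WeakDual.toStrongDual (γ i).1) fun i => (γ i).2))
    rw [norm_mul, norm_mul, norm_prod]
    refine mul_le_mul_of_nonneg_right ?_ (Finset.prod_nonneg fun i _ => norm_nonneg _)
    exact mul_le_of_le_one_left (norm_nonneg _) (norm_phase_le _)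
  rw [Complex.norm_of_nonneg (Finset.sum_nonneg fun _ _ => norm_nonneg _), one_mul] at h2
  exact h2

/-- The same duality test, with the nuclear series in place of the integral. -/
theorem NuclearRep.polarENorm_le (h : IsUncond c e) (hn : 1 ≤ n) {α : ℕ → ℂ} {T : Form E n}
    (hT : IsDiagonal c α T) {l : ℕ → ℂ} {γ : Fin n → ℕ → StrongDual ℂ E}
    (hl : NuclearRep T l γ) :
    polarENorm (powPolar n (dualBall c)) α ≤ ENNReal.ofReal (∑' j, ‖l j‖ * ∏ i, ‖γ i j‖) := by
  obtain ⟨hs, hγ, hrep⟩ := hl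
  have hs' : Summable fun j => ‖l j‖ * ∏ i, ‖γ i j‖ :=
    Summable.of_nonneg_of_le (fun j => by positivity) (fun j => mul_le_of_le_one_right
      (norm_nonneg _) (Finset.prod_le_one (fun i _ => norm_nonneg _) fun i _ => hγ i j)) hs
  refine polarENorm_le_ofReal fun x hx F => ?_
  have h1 : HasSum (fun j => ∑ k ∈ F, (phase (α k * x k) * x k) * (l j * ∏ i, γ i j (e k)))
      ((∑ k ∈ F, ‖α k * x k‖ : ℝ) : ℂ) := by
    push_cast
    refine hasSum_sum fun k _ => ?_
    have := (hrep fun _ => e k).mul_left (phase (α k * x k) * x k)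
    rw [hT.apply_unit h hn, mul_assoc, mul_comm (x k), phase_mul] at this
    exact this
  have h2 : ‖((∑ k ∈ F, ‖α k * x k‖ : ℝ) : ℂ)‖ ≤ ∑' j, ‖l j‖ * ∏ i, ‖γ i j‖ := by
    rw [← h1.tsum_eq]
    refine tsum_of_norm_bounded hs'.hasSum fun j => ?_
    refine (norm_sum_le _ _).trans (le_trans (Finset.sum_le_sum fun k _ => ?_)
      (le_trans (le_of_eq (Finset.mul_sum _ _ _).symm)
      (mul_le_mul_of_nonneg_left (h.sum_prod_le hn hx F fun i => γ i j) (norm_nonneg (l j)))))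
    rw [norm_mul, norm_mul, norm_mul, norm_prod]
    have h3 : ‖phase (α k * x k)‖ * ‖x k‖ ≤ ‖x k‖ :=
      mul_le_of_le_one_left (norm_nonneg _) (norm_phase_le _)
    calc _ ≤ ‖x k‖ * (‖l j‖ * ∏ i, ‖γ i j (e k)‖) := by gcongr
      _ = _ := by ring
  rw [Complex.norm_of_nonneg (Finset.sum_nonneg fun _ _ => norm_nonneg _)] at h2
  exact h2

/-! ### Existence of diagonal forms -/

/-- The polar norm sees only moduli, so the finite representation also applies to `α` multiplied by
the phases of the terms. Its value at `x` is then the sum of moduli, and `ε → 0` gives absolute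
convergence with constant `C`. -/
theorem IsUncond.summable_diag (h : IsUncond c e) (hn : 1 ≤ n) {α : ℕ → ℂ} {C : ℝ} (hC : 0 ≤ C)
    (hα : polarENorm (powPolar n (dualBall c)) α ≤ ENNReal.ofReal C) (x : Fin n → E) :
    (Summable fun k => ‖α k * ∏ i, c (x i) k‖) ∧
      ∑' k, ‖α k * ∏ i, c (x i) k‖ ≤ C * ∏ i, ‖x i‖ := by
  have key : ∀ F : Finset ℕ, ∑ k ∈ F, ‖α k * ∏ i, c (x i) k‖ ≤ C * ∏ i, ‖x i‖ := by
    intro F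
    have hlim : Tendsto (fun ε : ℝ => (C + ε) * ∏ i, ‖x i‖) (𝓝[>] 0) (𝓝 (C * ∏ i, ‖x i‖)) := by
      have : Continuous fun ε : ℝ => (C + ε) * ∏ i, ‖x i‖ := by fun_prop
      simpa using (this.tendsto 0).mono_left nhdsWithin_le_nhds
    refine ge_of_tendsto hlim (eventually_mem_nhdsWithin.mono fun ε hε => ?_)
    have h1 := (h.hasConvRep_of_le hn F (fun k => phase (α k * ∏ i, c (x i) k) * α k) hC
      ((polarENorm_mono fun k => ?_).trans hα) hε).norm_le x
    · refine le_trans (le_of_eq ?_) h1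
      rw [← Complex.norm_of_nonneg (Finset.sum_nonneg fun _ _ => norm_nonneg _ :
        0 ≤ ∑ k ∈ F, ‖α k * ∏ i, c (x i) k‖)]
      congr 1
      push_cast
      exact Finset.sum_congr rfl fun k _ => by rw [mul_assoc, phase_mul]
    · rw [norm_mul]
      exact mul_le_of_le_one_left (norm_nonneg _) (norm_phase_le _)
  exact ⟨summable_of_sum_le (fun _ => norm_nonneg _) key,
    Real.tsum_le_of_sum_le (fun _ => norm_nonneg _) key⟩

theorem IsUncond.exists_diagonal (h : IsUncond c e) (hn : 1 ≤ n) {α : ℕ → ℂ}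
    (hα : polarENorm (powPolar n (dualBall c)) α < ∞) : ∃ T : Form E n, IsDiagonal c α T := by
  have hC : polarENorm (powPolar n (dualBall c)) α ≤
      ENNReal.ofReal (polarENorm (powPolar n (dualBall c)) α).toReal :=
    (ENNReal.ofReal_toReal hα.ne).ge
  have hs := fun x : Fin n → E => h.summable_diag hn ENNReal.toReal_nonneg hC x
  let T : MultilinearMap ℂ (fun _ : Fin n => E) ℂ :=
    { toFun := fun x => ∑' k, α k * ∏ i, c (x i) k
      map_update_add' := fun m i x y => by
        rw [← (hs _).1.of_norm.tsum_add (hs _).1.of_norm]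
        refine tsum_congr fun k => ?_
        rw [← mul_add]
        congr 1
        exact ((MultilinearMap.mkPiAlgebra ℂ (Fin n) ℂ).compLinearMap
          fun _ => (LinearMap.proj k).comp c).map_update_add m i x y
      map_update_smul' := fun m i a x => by
        rw [smul_eq_mul, ← tsum_mul_left]
        refine tsum_congr fun k => ?_
        rw [mul_left_comm]
        congr 1
        exact ((MultilinearMap.mkPiAlgebra ℂ (Fin n) ℂ).compLinearMap
          fun _ => (LinearMap.proj k).comp c).map_update_smul m i a x }
  refine ⟨T.mkContinuous (polarENorm (powPolar n (dualBall c)) α).toReal fun x => ?_,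
    fun x => (hs x).1.of_norm.hasSum⟩
  exact (norm_tsum_le_tsum_norm (hs x).1).trans (hs x).2

theorem IsUncond.bounded (h : IsUncond c e) (hn : 1 ≤ n) {α : ℕ → ℂ} {T : Form E n}
    (hT : IsDiagonal c α T) : ∃ C : ℝ, ∀ k, ‖α k‖ ≤ C := by
  refine ⟨‖T‖, fun k => ?_⟩
  rw [← hT.apply_unit h hn k]
  simpa [h.norm_eq] using T.le_opNorm fun _ => e k

/-- The infimum that defines this norm runs over a single form, since the diagonal determines the
form. -/
theorem diagSpace_norm_eq {α : ℕ → ℂ} {T : Form E n} (hT : IsDiagonal c α T) (A : Form E n → Prop)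
    (ν : Form E n → ℝ) : (diagSpace c A ν).norm α = ν T := by
  have : {r | ∃ T : Form E n, IsDiagonal c α T ∧ r = ν T} = {ν T} := by
    ext r
    constructor
    · rintro ⟨T', hT', rfl⟩
      rw [hT'.unique hT]
      rfl
    · rintro rfl
      exact ⟨T, hT, rfl⟩
  change sInf {r | ∃ T : Form E n, IsDiagonal c α T ∧ r = ν T} = _
  rw [this, csInf_singleton]

/-- Integral diagonal forms. -/
theorem IsUncond.diagIntegral_isoEq (h : IsUncond c e) (hn : 1 ≤ n) :
    (diagIntegral n c).IsoEq (seqSpaceOf (polarENorm (powPolar n (dualBall c)))) := by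
  have hup : ∀ {α : ℕ → ℂ} {T : Form E n}, polarENorm (powPolar n (dualBall c)) α < ∞ → IsDiagonal c α T →
      ∃ μ, Represents T μ ∧ μ.real Set.univ ≤
        (polarENorm (powPolar n (dualBall c)) α).toReal := by
    intro α T hα hT
    have hC : polarENorm (powPolar n (dualBall c)) α ≤
      ENNReal.ofReal (polarENorm (powPolar n (dualBall c)) α).toReal :=
      (ENNReal.ofReal_toReal hα.ne).ge
    -- Sections of length `N` are represented with error `1 / (N + 1)`; the masses converge to the
    -- polar norm, so the limit measure attains it.
    refine exists_represents T (fun N => h.hasConvRep_of_le hn (Finset.range N) α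
      ENNReal.toReal_nonneg hC (ε := 1 / ((N : ℝ) + 1)) (by positivity)) ?_ fun x =>
        (hT x).tendsto_sum_nat
    simpa using tendsto_one_div_add_atTop_nhds_zero_nat.const_add
      (polarENorm (powPolar n (dualBall c)) α).toReal
  have hcar : (diagIntegral n c).carrier =
      (seqSpaceOf (polarENorm (powPolar n (dualBall c)))).carrier := by
    ext α
    constructor
    · rintro ⟨-, T, hT, μ, hμ⟩
      exact (hμ.polarENorm_le h hn hT).trans_lt ENNReal.ofReal_lt_top
    · intro hα
      obtain ⟨T, hT⟩ := h.exists_diagonal hn hα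
      obtain ⟨μ, hμ, -⟩ := hup hα hT
      exact ⟨h.bounded hn hT, T, hT, μ, hμ⟩
  refine ⟨hcar, fun α hα => ?_⟩
  obtain ⟨-, T, hT, μ₀, hμ₀⟩ := hα
  have hα : polarENorm (powPolar n (dualBall c)) α < ∞ :=
    (hμ₀.polarENorm_le h hn hT).trans_lt ENNReal.ofReal_lt_top
  rw [diagIntegral, diagSpace_norm_eq hT]
  refine le_antisymm ?_ ?_
  · obtain ⟨μ, hμ, hle⟩ := hup hα hT
    have hb : BddBelow {r | ∃ μ, Represents T μ ∧ r = μ.real Set.univ} := ⟨0, by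
      rintro r ⟨μ, -, rfl⟩
      exact measureReal_nonneg⟩
    exact (csInf_le hb ⟨μ, hμ, rfl⟩).trans hle
  · refine le_csInf ⟨_, μ₀, hμ₀, rfl⟩ ?_
    rintro r ⟨μ, hμ, rfl⟩
    exact ENNReal.toReal_le_of_le_ofReal measureReal_nonneg (hμ.polarENorm_le h hn hT)

/-! ### Nuclear diagonal forms -/

/-- The part of `α` with indices at least `m`. -/
def tail (m : ℕ) (α : ℕ → ℂ) : ℕ → ℂ := fun k => if m ≤ k then α k else 0

theorem HasConvRep.exists_nuclearRep {T : Form E n} {C : ℝ}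
    (hT : HasConvRep (fun x => T x) C) :
    ∃ l γ, NuclearRep T l γ ∧ ∑' k, ‖l k‖ * ∏ i, ‖γ i k‖ ≤ C := by
  obtain ⟨l, γ, h1, h2, h3, h4, h5⟩ := hT
  have hl : ∀ k, ‖(l k : ℂ)‖ = l k := fun k => Complex.norm_of_nonneg (h1 k)
  have hle : ∀ k, ‖(l k : ℂ)‖ * ∏ i, ‖γ k i‖ ≤ l k := fun k => by
    rw [hl]
    exact mul_le_of_le_one_right (h1 k)
      (Finset.prod_le_one (fun i _ => norm_nonneg _) fun i _ => h2 k i)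
  refine ⟨fun k => l k, fun i k => γ k i, ⟨by simpa only [hl] using h3, fun i k => h2 k i, h5⟩, ?_⟩
  exact (Summable.tsum_le_tsum hle (Summable.of_nonneg_of_le (fun k => by positivity) hle h3)
    h3).trans h4

/-- `α` is cut into consecutive blocks. The first costs nearly the full norm; the later ones are
dominated by tails of geometrically small polar norm and together cost little. Adding the block
representations gives a genuine series, with no passage to a limit measure. -/
theorem IsUncond.hasConvRep_diag (h : IsUncond c e) (hn : 1 ≤ n) {α : ℕ → ℂ}
    (hα : polarENorm (powPolar n (dualBall c)) α < ∞)
    (htail : Tendsto (fun m => polarENorm (powPolar n (dualBall c)) (tail m α)) atTop (𝓝 0))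
    {T : Form E n} (hT : IsDiagonal c α T) {ε : ℝ} (hε : 0 < ε) :
    HasConvRep (fun x => T x)
      ((polarENorm (powPolar n (dualBall c)) α).toReal + ε) := by
  set R := polarENorm (powPolar n (dualBall c)) with hR
  let δ : ℕ → ℝ := fun j => ε / 8 * (1 / 2) ^ j
  have hδ : ∀ j, 0 < δ j := fun j => by positivity
  have hex : ∀ j, ∃ M, ∀ m ≥ M, R (tail m α) ≤ ENNReal.ofReal (δ j) := fun j => by
    have := ENNReal.tendsto_atTop_zero.1 htail (ENNReal.ofReal (δ j))
      (by simpa using hδ j)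
    exact this
  choose M hM using hex
  -- Adding `M i + 1` at each step makes `m` strictly increasing and ensures `M j ≤ m (j + 1)`.
  let m : ℕ → ℕ := fun j => ∑ i ∈ Finset.range j, (M i + 1)
  have hm : ∀ j, m (j + 1) = m j + (M j + 1) := fun j => Finset.sum_range_succ _ _
  have hmono : StrictMono m := strictMono_nat_of_lt_succ fun j => by rw [hm]; omega
  let C : ℕ → ℝ := fun j => Nat.casesOn j (R α).toReal δ
  -- Block `0` is controlled by `α` itself, block `j + 1` by the tail that starts where the block
  -- starts.
  let B : ℕ → ℕ → ℂ := fun j => Nat.casesOn j α (fun i => tail (m (i + 1)) α)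
  have hB : ∀ j, R (B j) ≤ ENNReal.ofReal (C j) := by
    intro j
    cases j with
    | zero => exact (ENNReal.ofReal_toReal hα.ne).ge
    | succ j => exact hM j _ (by rw [hm]; omega)
  have hC0 : ∀ j, 0 ≤ C j := by
    intro j
    cases j with
    | zero => exact ENNReal.toReal_nonneg
    | succ j => exact (hδ j).le
  have hBα : ∀ j, ∀ k ∈ Finset.Ico (m j) (m (j + 1)), B j k = α k := by
    intro j k hk
    cases j with
    | zero => rfl
    | succ j => exact if_pos (Finset.mem_Ico.1 hk).1
  have hδs : HasSum δ (ε / 4) := by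
    have := (hasSum_geometric_of_lt_one (r := (1 / 2 : ℝ)) (by norm_num) (by norm_num)).mul_left
      (ε / 8)
    convert! this using 1
    ring
  have hCs : HasSum C (ε / 4 + (R α).toReal) := by
    have : HasSum (fun j => C (j + 1)) (ε / 4) := hδs
    have h2 := (hasSum_nat_add_iff (f := C) 1).1 this
    rw [Finset.sum_range_one] at h2
    exact h2
  have hεs : HasSum (fun j : ℕ => ε / 4 * (1 / 2) ^ j) (ε / 2) := by
    have := (hasSum_geometric_of_lt_one (r := (1 / 2 : ℝ)) (by norm_num) (by norm_num)).mul_left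
      (ε / 4)
    convert! this using 1
    ring
  let f : ℕ → (Fin n → E) → ℂ := fun j x =>
    ∑ k ∈ Finset.Ico (m j) (m (j + 1)), α k * ∏ i, c (x i) k
  have hf : ∀ j, HasConvRep (f j) (C j + ε / 4 * (1 / 2) ^ j) := by
    intro j
    have := h.hasConvRep_of_le hn (Finset.Ico (m j) (m (j + 1))) (B j) (hC0 j) (hB j)
      (ε := ε / 4 * (1 / 2) ^ j) (by positivity)
    refine Eq.mp ?_ this
    congr 1
    funext x
    exact Finset.sum_congr rfl fun k hk => by rw [hBα j k hk]
  have hsum := hCs.add hεs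
  have hpart : ∀ x J, ∑ j ∈ Finset.range J, f j x =
      ∑ k ∈ Finset.range (m J), α k * ∏ i, c (x i) k := by
    intro x J
    induction J with
    | zero => simp [m]
    | succ J ih =>
      rw [Finset.sum_range_succ, ih]
      exact Finset.sum_range_add_sum_Ico _ (hmono.monotone (Nat.le_succ J))
  have h1 := HasConvRep.hasSum hf hsum.summable (g := fun x => T x) fun x => by
    have hs : Summable fun j => f j x :=
      Summable.of_norm_bounded (hsum.summable.mul_right (∏ i, ‖x i‖)) fun j => (hf j).norm_le x
    have h2 : Tendsto (fun J => ∑ j ∈ Finset.range J, f j x) atTop (𝓝 (T x)) := by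
      simp only [hpart]
      exact (hT x).tendsto_sum_nat.comp hmono.tendsto_atTop
    rw [← tendsto_nhds_unique hs.hasSum.tendsto_sum_nat h2]
    exact hs.hasSum
  rw [hsum.tsum_eq] at h1
  exact h1.mono (by linarith)

/-- Nuclear diagonal forms. -/
theorem IsUncond.diagNuclear_isoEq (h : IsUncond c e) (hn : 1 ≤ n)
    (htail : ∀ α, polarENorm (powPolar n (dualBall c)) α < ∞ →
      Tendsto (fun m => polarENorm (powPolar n (dualBall c)) (tail m α)) atTop (𝓝 0)) :
    (diagNuclear n c).IsoEq (seqSpaceOf (polarENorm (powPolar n (dualBall c)))) := by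
  have hcar : (diagNuclear n c).carrier =
      (seqSpaceOf (polarENorm (powPolar n (dualBall c)))).carrier := by
    ext α
    constructor
    · rintro ⟨-, T, hT, l, γ, hl⟩
      exact (hl.polarENorm_le h hn hT).trans_lt ENNReal.ofReal_lt_top
    · intro hα
      obtain ⟨T, hT⟩ := h.exists_diagonal hn hα
      obtain ⟨l, γ, hl, -⟩ :=
        (h.hasConvRep_diag hn hα (htail α hα) hT one_pos).exists_nuclearRep
      exact ⟨h.bounded hn hT, T, hT, l, γ, hl⟩
  refine ⟨hcar, fun α hα => ?_⟩
  obtain ⟨-, T, hT, l₀, γ₀, hl₀⟩ := hα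
  have hα : polarENorm (powPolar n (dualBall c)) α < ∞ :=
    (hl₀.polarENorm_le h hn hT).trans_lt ENNReal.ofReal_lt_top
  rw [diagNuclear, diagSpace_norm_eq hT]
  refine le_antisymm ?_ ?_
  · refine le_of_forall_pos_le_add fun ε hε => ?_
    obtain ⟨l, γ, hl, hle⟩ :=
      (h.hasConvRep_diag hn hα (htail α hα) hT hε).exists_nuclearRep
    have hb : BddBelow {r | ∃ l γ, NuclearRep T l γ ∧ r = ∑' k, ‖l k‖ * ∏ i, ‖γ i k‖} := ⟨0, by
      rintro r ⟨l, γ, -, rfl⟩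
      exact tsum_nonneg fun k => by positivity⟩
    exact (csInf_le hb ⟨l, γ, hl, rfl⟩).trans hle
  · refine le_csInf ⟨_, l₀, γ₀, hl₀, rfl⟩ ?_
    rintro r ⟨l, γ, hl, rfl⟩
    exact ENNReal.toReal_le_of_le_ofReal (tsum_nonneg fun k => by positivity)
      (hl.polarENorm_le h hn hT)

/-! ### Permutations and finite sets -/

/-- One point at a time: a transposition corrects the value at `a`, and injectivity of `σ` keeps the
earlier values fixed. -/
theorem exists_perm_of_injOn (σ : ℕ → ℕ) (K : Finset ℕ) (hσ : Set.InjOn σ K) :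
    ∃ π : Equiv.Perm ℕ, ∀ k ∈ K, π k = σ k := by
  induction K using Finset.induction_on with
  | empty => exact ⟨1, by simp⟩
  | insert a K ha ih =>
    rw [Finset.coe_insert] at hσ
    obtain ⟨π, hπ⟩ := ih (hσ.mono (Set.subset_insert _ _))
    refine ⟨Equiv.swap (π a) (σ a) * π, fun k hk => ?_⟩
    rw [Finset.mem_insert] at hk
    rcases hk with rfl | hk
    · simp
    · have hka : k ≠ a := fun h => ha (h ▸ hk)
      rw [Equiv.Perm.mul_apply, Equiv.swap_apply_of_ne_of_ne, hπ k hk]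
      · exact fun h => hka (π.injective h)
      · rw [hπ k hk]
        exact fun h => hka (hσ (Set.mem_insert_of_mem _ hk) (Set.mem_insert _ _) h)

/-- A finite set can be enumerated so that a given function decreases. -/
theorem exists_perm_sorted (f : ℕ → ℝ) : ∀ (M : ℕ) (F : Finset ℕ), F.card = M →
    ∃ π : Equiv.Perm ℕ, (Finset.range M).image π = F ∧
      ∀ i j, i ≤ j → j < M → f (π j) ≤ f (π i) := by
  intro M
  induction M with
  | zero =>
    intro F hF
    exact ⟨1, by simp [Finset.card_eq_zero.1 hF], fun i j _ hj => absurd hj (Nat.not_lt_zero _)⟩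
  | succ M ih =>
    intro F hF
    obtain ⟨a, ha, hmin⟩ := Finset.exists_min_image F f (Finset.card_pos.1 (by omega))
    obtain ⟨π, hπ, hs⟩ := ih (F.erase a) (by rw [Finset.card_erase_of_mem ha]; omega)
    have hmem : ∀ k < M, π k ∈ F.erase a := fun k hk => by
      rw [← hπ]
      exact Finset.mem_image_of_mem _ (Finset.mem_range.2 hk)
    have hlt : ∀ k < M, (Equiv.swap (π M) a * π) k = π k := fun k hk => by
      rw [Equiv.Perm.mul_apply, Equiv.swap_apply_of_ne_of_ne]
      · exact fun h => hk.ne (π.injective h)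
      · exact Finset.ne_of_mem_erase (hmem k hk)
    have hM : (Equiv.swap (π M) a * π) M = a := by simp
    refine ⟨Equiv.swap (π M) a * π, ?_, fun i j hij hj => ?_⟩
    · rw [Finset.range_add_one, Finset.image_insert, hM]
      have : (Finset.range M).image (Equiv.swap (π M) a * π) = (Finset.range M).image π :=
        Finset.image_congr fun k hk => hlt k (by simpa using hk)
      rw [this, hπ, Finset.insert_erase ha]
    · rcases (Nat.lt_succ_iff_lt_or_eq.1 hj) with hj' | rfl
      · rw [hlt j hj', hlt i (hij.trans_lt hj')]
        exact hs i j hij hj'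
      · rw [hM]
        rcases hij.lt_or_eq with hi | rfl
        · rw [hlt i hi]
          exact hmin _ (Finset.mem_of_mem_erase (hmem i hi))
        · rw [hM]

/-- A set of `m + 1` indices has its maximum at or beyond `m`; remove it and induct. -/
theorem sum_le_partialSum {w : ℕ → ℝ} (hw : Antitone w) : ∀ (m : ℕ) (K : Finset ℕ), K.card = m →
    ∑ k ∈ K, w k ≤ partialSum w m := by
  intro m
  induction m with
  | zero => intro K hK; simp [Finset.card_eq_zero.1 hK, partialSum]
  | succ m ih =>
    intro K hK
    have hne : K.Nonempty := Finset.card_pos.1 (by omega)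
    have hmax := Finset.max'_mem K hne
    have hle : m ≤ K.max' hne := by
      have : K ⊆ Finset.range (K.max' hne + 1) := fun k hk =>
        Finset.mem_range.2 (Nat.lt_succ_of_le (Finset.le_max' K k hk))
      have := Finset.card_le_card this
      rw [Finset.card_range] at this
      omega
    rw [← Finset.sum_erase_add K _ hmax, partialSum, Finset.sum_range_succ]
    exact add_le_add (ih _ (by rw [Finset.card_erase_of_mem hmax]; omega)) (hw hle)

theorem partialSum_mono {w : ℕ → ℝ} (hw : ∀ k, 0 ≤ w k) : Monotone (partialSum w) :=
  fun _ _ h => Finset.sum_le_sum_of_subset_of_nonneg (Finset.range_mono h) fun k _ _ => hw k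

/-! ### Norms with the Fatou property -/

/-- A solid norm with the Fatou property, normalized at the unit vectors. -/
structure SeqNorm.IsFatou (ρ : SeqNorm) : Prop where
  solid : ∀ x y : ℕ → ℂ, (∀ k, ‖x k‖ ≤ ‖y k‖) → ρ.toFun x ≤ ρ.toFun y
  lsc : ∀ (u : ℕ → ℕ → ℂ) (x : ℕ → ℂ) (C : ℝ), 0 ≤ C →
    (∀ k, Tendsto (fun j => u j k) atTop (𝓝 (x k))) →
    (∀ j, ρ.toFun (u j) ≤ ENNReal.ofReal C) → ρ.toFun x ≤ ENNReal.ofReal C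
  single : ∀ j, ρ.toFun (Pi.single j 1) = 1

/-- Turns a supremum of infinite series into inequalities between finite real sums, the form in
which Lorentz norms are mostly estimated below. -/
theorem lorentzENorm_le_iff {v : ℕ → ℝ} {q : ℝ} (hv : ∀ k, 0 ≤ v k) (hq : 0 < q) {x : ℕ → ℂ}
    {C : ℝ} (hC : 0 ≤ C) : lorentzENorm v q x ≤ ENNReal.ofReal C ↔
      ∀ (π : Equiv.Perm ℕ) (K : Finset ℕ), ∑ k ∈ K, ‖x (π k)‖ ^ q * v k ≤ C ^ q := by
  rw [lorentzENorm, iSup_le_iff]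
  refine forall_congr' fun π => ?_
  rw [one_div, ENNReal.rpow_inv_le_iff hq, ENNReal.ofReal_rpow_of_nonneg hC hq.le,
    ENNReal.tsum_eq_iSup_sum, iSup_le_iff]
  refine forall_congr' fun K => ?_
  have : ∀ k, ‖x (π k)‖ₑ ^ q * ENNReal.ofReal (v k) = ENNReal.ofReal (‖x (π k)‖ ^ q * v k) := by
    intro k
    rw [ENNReal.ofReal_mul (by positivity), ← ENNReal.ofReal_rpow_of_nonneg (norm_nonneg _) hq.le,
      ofReal_norm]
  simp only [this]
  rw [← ENNReal.ofReal_sum_of_nonneg fun k _ => mul_nonneg (by positivity) (hv k),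
    ENNReal.ofReal_le_ofReal_iff (by positivity)]

theorem lorentzENorm_le_one_iff {v : ℕ → ℝ} {q : ℝ} (hv : ∀ k, 0 ≤ v k) (hq : 0 < q) {x : ℕ → ℂ} :
    lorentzENorm v q x ≤ 1 ↔
      ∀ (π : Equiv.Perm ℕ) (K : Finset ℕ), ∑ k ∈ K, ‖x (π k)‖ ^ q * v k ≤ 1 := by
  have := lorentzENorm_le_iff hv hq (x := x) zero_le_one
  rwa [ENNReal.ofReal_one, Real.one_rpow] at this

theorem lorentz_isFatou {v : ℕ → ℝ} {q : ℝ} (hv : IsWeight v) (hq : 1 ≤ q) :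
    (lorentz v q hv hq).IsFatou where
  solid x y h := by
    refine iSup_mono fun π => ENNReal.rpow_le_rpow (ENNReal.tsum_le_tsum fun k => ?_)
      (by positivity)
    gcongr
    exact enorm_le_iff_norm_le.2 (h _)
  lsc u x C hC hu hb := by
    have hq0 : 0 < q := by linarith
    have hv0 : ∀ k, 0 ≤ v k := fun k => (hv.pos k).le
    change lorentzENorm v q x ≤ _
    rw [lorentzENorm_le_iff hv0 hq0 hC]
    intro π K
    have hlim : Tendsto (fun j => ∑ k ∈ K, ‖u j (π k)‖ ^ q * v k) atTop
        (𝓝 (∑ k ∈ K, ‖x (π k)‖ ^ q * v k)) :=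
      tendsto_finsetSum _ fun k _ =>
        (((hu (π k)).norm).rpow_const (Or.inr hq0.le)).mul_const _
    exact le_of_tendsto' hlim fun j => (lorentzENorm_le_iff hv0 hq0 hC).1 (hb j) π K
  single j := by
    have hq0 : 0 < q := by linarith
    have hv0 : ∀ k, 0 ≤ v k := fun k => (hv.pos k).le
    refine le_antisymm ((lorentzENorm_le_one_iff hv0 hq0).2 fun π K => ?_) ?_
    · have h1 : ∀ k, k ≠ π.symm j →
          ‖(Pi.single j 1 : ℕ → ℂ) (π k)‖ ^ q * v k = 0 := fun k hk => by
        have : π k ≠ j := fun h => hk (by simp [← h])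
        simp [Pi.single_eq_of_ne this, hq0.ne']
      refine (Finset.sum_le_sum_of_subset_of_nonneg (Finset.subset_insert (π.symm j) K)
        fun k _ _ => mul_nonneg (by positivity) (hv0 k)).trans ?_
      rw [Finset.sum_eq_single_of_mem (π.symm j) (Finset.mem_insert_self _ _)
        fun k _ hk => h1 k hk]
      simpa [hv.one] using hv.anti (Nat.zero_le (π.symm j))
    · refine le_trans ?_ (le_iSup _ (Equiv.swap 0 j))
      have := ENNReal.le_tsum (f := fun k => ‖(Pi.single j 1 : ℕ → ℂ) (Equiv.swap 0 j k)‖ₑ ^ q *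
        ENNReal.ofReal (v k)) 0
      rw [Equiv.swap_apply_left] at this
      simp only [Pi.single_eq_same, hv.one, enorm_one, ENNReal.one_rpow, ENNReal.ofReal_one,
        mul_one] at this
      exact ENNReal.one_le_rpow this (by positivity)

/-- The properties of `Ψ` that make `m_Ψ` a normalized Fatou space. -/
structure IsFundamental (Ψ : ℕ → ℝ) : Prop where
  one : Ψ 1 = 1
  mono : Monotone Ψ

theorem IsFundamental.one_le {Ψ : ℕ → ℝ} (h : IsFundamental Ψ) {m : ℕ} (hm : 1 ≤ m) : 1 ≤ Ψ m :=
  h.one ▸ h.mono hm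

/-- The sum of the first `N` rearranged terms is a supremum over sets with at most `N` elements, so
the rearrangement disappears; monotonicity of `Ψ` lets `N` be the cardinality. -/
theorem marcinkiewicz_le_iff {Ψ : ℕ → ℝ} (h : IsFundamental Ψ) {x : ℕ → ℂ} {C : ℝ} (hC : 0 ≤ C) :
    (marcinkiewicz Ψ).toFun x ≤ ENNReal.ofReal C ↔
      ∀ J : Finset ℕ, J.Nonempty → ∑ k ∈ J, ‖x k‖ ≤ C * Ψ J.card := by
  have key : ∀ J : Finset ℕ, ∑ k ∈ J, ‖x k‖ₑ = ENNReal.ofReal (∑ k ∈ J, ‖x k‖) := fun J => by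
    rw [ENNReal.ofReal_sum_of_nonneg fun k _ => norm_nonneg _]
    simp only [ofReal_norm]
  have hpos : ∀ N, 0 < Ψ (N + 1) := fun N => one_pos.trans_le (h.one_le (by omega))
  change (⨆ N : ℕ, rearrSum x (N + 1) / ENNReal.ofReal (Ψ (N + 1))) ≤ _ ↔ _
  rw [iSup_le_iff]
  have h1 : ∀ N, rearrSum x (N + 1) / ENNReal.ofReal (Ψ (N + 1)) ≤ ENNReal.ofReal C ↔
      ∀ J : Finset ℕ, J.card ≤ N + 1 → ∑ k ∈ J, ‖x k‖ ≤ C * Ψ (N + 1) := by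
    intro N
    rw [ENNReal.div_le_iff (by simpa using hpos N) ENNReal.ofReal_ne_top,
      ← ENNReal.ofReal_mul hC, rearrSum_eq, iSup₂_le_iff]
    refine forall₂_congr fun J _ => ?_
    rw [key, ENNReal.ofReal_le_ofReal_iff (mul_nonneg hC (hpos N).le)]
  simp only [h1]
  constructor
  · intro H J hJ
    have := Finset.card_pos.2 hJ
    have h2 := H (J.card - 1) J (by omega)
    rwa [Nat.sub_add_cancel this] at h2
  · intro H N J hJ
    rcases J.eq_empty_or_nonempty with rfl | hne
    · simpa using mul_nonneg hC (hpos N).le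
    · exact (H J hne).trans (mul_le_mul_of_nonneg_left (h.mono hJ) hC)

theorem marcinkiewicz_le_one_iff {Ψ : ℕ → ℝ} (h : IsFundamental Ψ) {x : ℕ → ℂ} :
    (marcinkiewicz Ψ).toFun x ≤ 1 ↔
      ∀ J : Finset ℕ, J.Nonempty → ∑ k ∈ J, ‖x k‖ ≤ Ψ J.card := by
  have := marcinkiewicz_le_iff h (x := x) zero_le_one
  simpa only [ENNReal.ofReal_one, one_mul] using this

theorem marcinkiewicz_isFatou {Ψ : ℕ → ℝ} (h : IsFundamental Ψ) : (marcinkiewicz Ψ).IsFatou where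
  solid x y hxy := by
    refine iSup_mono fun N => ENNReal.div_le_div_right ?_ _
    rw [rearrSum_eq, rearrSum_eq]
    exact iSup₂_mono fun J _ => Finset.sum_le_sum fun k _ => enorm_le_iff_norm_le.2 (hxy k)
  lsc u x C hC hu hb := by
    rw [marcinkiewicz_le_iff h hC]
    intro J hJ
    exact le_of_tendsto' (tendsto_finsetSum _ fun k _ => (hu k).norm)
      fun j => (marcinkiewicz_le_iff h hC).1 (hb j) J hJ
  single j := by
    refine le_antisymm ((marcinkiewicz_le_one_iff h).2 fun J hJ => ?_) ?_
    · refine le_trans ?_ (h.one_le (Finset.card_pos.2 hJ))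
      have : ∀ k ∈ J, ‖(Pi.single j 1 : ℕ → ℂ) k‖ = if k = j then 1 else 0 := fun k _ => by
        rw [Pi.single_apply]; split_ifs <;> simp
      rw [Finset.sum_congr rfl this, Finset.sum_ite_eq']
      split_ifs <;> simp
    · refine le_trans ?_ (le_iSup _ 0)
      have := sum_le_rearrSum (Pi.single j 1) 1 {j} (by simp)
      simpa [h.one] using this

/-! ### Köthe duals -/

namespace SeqNorm.IsFatou

variable {ρ : SeqNorm}

theorem enorm_apply_le (h : ρ.IsFatou) (x : ℕ → ℂ) (k : ℕ) : ‖x k‖ₑ ≤ ρ.toFun x := by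
  have h1 := ρ.smul (x k) (Pi.single k 1)
  rw [h.single, mul_one] at h1
  rw [← h1]
  refine h.solid _ _ fun j => ?_
  rw [Pi.smul_apply, Pi.single_apply]
  split_ifs with hj
  · simp [hj]
  · simp

theorem _root_.LorentzForms.SeqNorm.sum_le (ρ : SeqNorm) {ι : Type*} (s : Finset ι) (u : ι → ℕ → ℂ) (a : ι → ℝ) (ha : ∀ i, 0 ≤ a i)
    (hu : ∀ i, ρ.toFun (u i) ≤ ENNReal.ofReal (a i)) :
    ρ.toFun (∑ i ∈ s, u i) ≤ ENNReal.ofReal (∑ i ∈ s, a i) := by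
  classical
  induction s using Finset.induction_on with
  | empty =>
    have := ρ.smul 0 0
    simp at this
    simp [this]
  | insert i s hi ih =>
    rw [Finset.sum_insert hi, Finset.sum_insert hi,
      ENNReal.ofReal_add (ha i) (Finset.sum_nonneg fun i _ => ha i)]
    exact (ρ.add_le _ _).trans (add_le_add (hu i) ih)

theorem _root_.LorentzForms.SeqNorm.smul_mem_ball (ρ : SeqNorm) {x : ℕ → ℂ} {C : ℝ} (hC : 0 < C) (hx : ρ.toFun x ≤ ENNReal.ofReal C) :
    ρ.toFun (((C⁻¹ : ℝ) : ℂ) • x) ≤ 1 := by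
  rw [ρ.smul, ← ofReal_norm, Complex.norm_of_nonneg (by positivity)]
  refine (mul_le_mul_right hx _).trans ?_
  rw [← ENNReal.ofReal_mul (by positivity), inv_mul_cancel₀ hC.ne', ENNReal.ofReal_one]

theorem tsum_lt_top {z x : ℕ → ℂ} (hz : polarENorm {x | ρ.toFun x ≤ 1} z < ∞)
    (hx : ρ.toFun x < ∞) : ∑' k, ‖z k * x k‖ₑ < ∞ := by
  set C : ℝ := (ρ.toFun x).toReal + 1
  have hC : 0 < C := by positivity
  have hxC : ρ.toFun x ≤ ENNReal.ofReal C := by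
    rw [← ENNReal.ofReal_toReal hx.ne]
    exact ENNReal.ofReal_le_ofReal (by simp [C])
  have h1 := (le_iSup₂ (f := fun (y : ℕ → ℂ) (_ : y ∈ {x | ρ.toFun x ≤ 1}) =>
    ∑' k, ‖z k * y k‖ₑ) _ (ρ.smul_mem_ball hC hxC)).trans_lt hz
  have h2 : ∀ k, ‖z k * x k‖ₑ = ENNReal.ofReal C * ‖z k * (((C⁻¹ : ℝ) : ℂ) • x) k‖ₑ := fun k => by
    rw [Pi.smul_apply, smul_eq_mul, mul_left_comm, enorm_mul ((C⁻¹ : ℝ) : ℂ), ← mul_assoc,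
      ← ofReal_norm (((C⁻¹ : ℝ) : ℂ)), Complex.norm_of_nonneg (by positivity),
      ← ENNReal.ofReal_mul hC.le, mul_inv_cancel₀ hC.ne', ENNReal.ofReal_one, one_mul]
  simp only [h2, ENNReal.tsum_mul_left]
  exact ENNReal.mul_lt_top ENNReal.ofReal_lt_top h1

/-- Uniform boundedness by hand: if elements x_j of the unit ball give sums above 4^j, then ∑ 2^{-j}
|x_j| has norm at most `2` by the Fatou property, yet its sum against `z` is at least 2^j for every
j. -/
theorem polarENorm_lt_top (h : ρ.IsFatou) {z : ℕ → ℂ}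
    (hz : ∀ x, ρ.toFun x < ∞ → Summable fun k => ‖z k * x k‖) :
    polarENorm {x | ρ.toFun x ≤ 1} z < ∞ := by
  by_contra hinf
  have hex : ∀ j : ℕ, ∃ x, ρ.toFun x ≤ 1 ∧ (4 : ℝ≥0∞) ^ j < ∑' k, ‖z k * x k‖ₑ := by
    intro j
    have h1 : (4 : ℝ≥0∞) ^ j < polarENorm {x | ρ.toFun x ≤ 1} z := by
      rw [not_lt_top_iff.1 hinf]
      exact ENNReal.pow_lt_top (by norm_num)
    simp only [polarENorm, lt_iSup_iff] at h1
    obtain ⟨x, hx, h2⟩ := h1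
    exact ⟨x, hx, h2⟩
  choose x hx hlt using hex
  have hgeo : HasSum (fun j : ℕ => (1 / 2 : ℝ) ^ j) 2 := by
    have := hasSum_geometric_of_lt_one (r := (1 / 2 : ℝ)) (by norm_num) (by norm_num)
    convert this using 1
    norm_num
  have hxk : ∀ j k, ‖x j k‖ ≤ 1 := fun j k => by
    have := (h.enorm_apply_le (x j) k).trans (hx j)
    rw [← enorm_one (G := ℂ)] at this
    simpa using enorm_le_iff_norm_le.1 this
  have hs : ∀ k, Summable fun j => (1 / 2 : ℝ) ^ j * ‖x j k‖ := fun k =>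
    Summable.of_nonneg_of_le (fun j => by positivity)
      (fun j => mul_le_of_le_one_right (by positivity) (hxk j k)) hgeo.summable
  let X : ℕ → ℂ := fun k => ((∑' j, (1 / 2 : ℝ) ^ j * ‖x j k‖ : ℝ) : ℂ)
  have hX : ρ.toFun X ≤ ENNReal.ofReal 2 := by
    refine h.lsc (fun J => ∑ j ∈ Finset.range J, fun k => (((1 / 2 : ℝ) ^ j * ‖x j k‖ : ℝ) : ℂ))
      X 2 (by norm_num) (fun k => ?_) fun J => ?_
    · have := (Complex.continuous_ofReal.tendsto _).comp (hs k).hasSum.tendsto_sum_nat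
      refine this.congr fun J => ?_
      simp
    · refine (ρ.sum_le (Finset.range J) _ (fun j => (1 / 2 : ℝ) ^ j) (fun j => by positivity)
        fun j => ?_).trans (ENNReal.ofReal_le_ofReal ?_)
      · have h1 := ρ.smul (((1 / 2 : ℝ) ^ j : ℝ) : ℂ) (x j)
        rw [← ofReal_norm, Complex.norm_of_nonneg (by positivity)] at h1
        refine (h.solid _ ((((1 / 2 : ℝ) ^ j : ℝ) : ℂ) • x j) fun k => ?_).trans
          (h1.trans_le (mul_le_of_le_one_right zero_le (hx j)))
        rw [Pi.smul_apply, norm_smul, Complex.norm_of_nonneg (by positivity),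
          Complex.norm_of_nonneg (by positivity)]
      · exact sum_le_hasSum _ (fun j _ => by positivity) hgeo
  have hfin : ∑' k, ‖z k * X k‖ₑ < ∞ := by
    have := hz X (hX.trans_lt ENNReal.ofReal_lt_top)
    have h2 := this.tsum_ofReal_lt_top
    simpa only [ofReal_norm] using h2
  have hle : ∀ j : ℕ, (2 : ℝ≥0∞) ^ j ≤ ∑' k, ‖z k * X k‖ₑ := by
    intro j
    have h1 : ∀ k, ENNReal.ofReal ((1 / 2 : ℝ) ^ j) * ‖z k * x j k‖ₑ ≤ ‖z k * X k‖ₑ := by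
      intro k
      rw [← ofReal_norm, ← ofReal_norm, ← ENNReal.ofReal_mul (by positivity)]
      refine ENNReal.ofReal_le_ofReal ?_
      rw [norm_mul, norm_mul, mul_left_comm]
      refine mul_le_mul_of_nonneg_left ?_ (norm_nonneg _)
      rw [Complex.norm_of_nonneg (tsum_nonneg fun j => by positivity)]
      exact (hs k).le_tsum j fun i _ => by positivity
    have h2 := ENNReal.tsum_le_tsum h1
    rw [ENNReal.tsum_mul_left] at h2
    refine le_trans ?_ ((mul_le_mul_right (hlt j).le _).trans h2)
    have h3 : (4 : ℝ≥0∞) ^ j = ENNReal.ofReal (4 ^ j) := by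
      rw [ENNReal.ofReal_pow (by norm_num)]; norm_num
    have h4 : (2 : ℝ≥0∞) ^ j = ENNReal.ofReal (2 ^ j) := by
      rw [ENNReal.ofReal_pow (by norm_num)]; norm_num
    rw [h3, h4, ← ENNReal.ofReal_mul (by positivity), ← mul_pow]
    norm_num
  obtain ⟨N, hN⟩ := ENNReal.exists_nat_gt hfin.ne
  have h5 : (N : ℝ≥0∞) ≤ 2 ^ N := by exact_mod_cast Nat.lt_two_pow_self.le
  exact absurd (h5.trans (hle N)) (not_le.2 hN)

theorem kotheDual_isoEq (h : ρ.IsFatou) :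
    (kotheDual ρ.toFun).IsoEq (seqSpaceOf (polarENorm {x | ρ.toFun x ≤ 1})) := by
  refine ⟨?_, fun _ _ => rfl⟩
  ext z
  refine ⟨fun hz => h.polarENorm_lt_top hz, fun hz x hx => ?_⟩
  have h1 := tsum_lt_top hz hx
  have h2 := ENNReal.summable_toReal h1.ne
  simpa only [toReal_enorm] using h2

end SeqNorm.IsFatou

theorem SeqSpace.IsoEq.symm {S T : SeqSpace} (h : S.IsoEq T) : T.IsoEq S :=
  ⟨h.1.symm, fun α hα => (h.2 α (h.1 ▸ hα)).symm⟩

theorem SeqSpace.IsoEq.trans {S T V : SeqSpace} (h : S.IsoEq T) (h' : T.IsoEq V) : S.IsoEq V :=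
  ⟨h.1.trans h'.1, fun α hα => (h.2 α hα).trans (h'.2 α (h.1 ▸ hα))⟩

theorem IsBanachDual.congr {X : Type} [NormedAddCommGroup X] [NormedSpace ℂ X] {c : X → ℕ → ℂ}
    {S T : SeqSpace} (h : IsBanachDual c S) (hST : S.IsoEq T) : IsBanachDual c T := by
  refine ⟨fun φ => ?_, fun z hz => ?_⟩
  · rw [← hST.1]
    exact h.1 φ
  · rw [← hST.1] at hz
    obtain ⟨φ, h1, h2⟩ := h.2 z hz
    exact ⟨φ, h1, h2.trans (hST.2 z hz)⟩

/-! ### Normed spaces of sequences inside a Fatou space -/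

/-- `X` is a space of sequences with the norm `ρ`, which contains the unit vectors. -/
structure SeqNorm.IsModel {X : Type} [NormedAddCommGroup X] [NormedSpace ℂ X] (ρ : SeqNorm)
    (c : X →ₗ[ℂ] ℕ → ℂ) (e : ℕ → X) : Prop where
  coord : ∀ j, c (e j) = Pi.single j 1
  norm : ∀ x, ENNReal.ofReal ‖x‖ = ρ.toFun (c x)

theorem SeqNorm.isModel_sub {ρ : SeqNorm} {e : ℕ → ρ.Space}
    (he : ∀ j, ρ.coord (e j) = Pi.single j 1) : ρ.IsModel ρ.coord e where
  coord := he
  norm x := ENNReal.ofReal_toReal (ρ.coord_lt_top x).ne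

theorem SeqNorm.isModel_submodule {ρ : SeqNorm} (p : Submodule ℂ ρ.Space) {e : ℕ → p}
    (he : ∀ j, ρ.coord (e j) = Pi.single j 1) : ρ.IsModel (ρ.coord.comp p.subtype) e where
  coord := he
  norm x := ENNReal.ofReal_toReal (ρ.coord_lt_top x).ne

section Model

variable {X : Type} [NormedAddCommGroup X] [NormedSpace ℂ X] {ρ : SeqNorm}
  {c : X →ₗ[ℂ] ℕ → ℂ} {e : ℕ → X}

theorem SeqNorm.IsModel.coord_sum (hm : ρ.IsModel c e) (F : Finset ℕ) (a : ℕ → ℂ) (k : ℕ) :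
    c (∑ j ∈ F, a j • e j) k = if k ∈ F then a k else 0 := by
  simp only [map_sum, map_smul, hm.coord, Finset.sum_apply, Pi.smul_apply, smul_eq_mul]
  simp [Pi.single_apply]

theorem SeqNorm.IsModel.norm_le (hm : ρ.IsModel c e) {x : X} {C : ℝ} (hC : 0 ≤ C)
    (h : ρ.toFun (c x) ≤ ENNReal.ofReal C) : ‖x‖ ≤ C := by
  rwa [← hm.norm, ENNReal.ofReal_le_ofReal_iff hC] at h

theorem SeqNorm.IsModel.norm_sum_le (hρ : ρ.IsFatou) (hm : ρ.IsModel c e) (F : Finset ℕ)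
    (a : ℕ → ℂ) {C : ℝ} (hC : 0 ≤ C) (ha : ρ.toFun a ≤ ENNReal.ofReal C) :
    ‖∑ k ∈ F, a k • e k‖ ≤ C := by
  refine hm.norm_le hC ((hρ.solid _ _ fun k => ?_).trans ha)
  rw [hm.coord_sum]
  split_ifs <;> simp

theorem SeqNorm.IsModel.isUncond (hρ : ρ.IsFatou) (hm : ρ.IsModel c e) : IsUncond c e where
  coord := hm.coord
  norm_eq j := by
    have := hm.norm (e j)
    rw [hm.coord, hρ.single, ENNReal.ofReal_eq_one] at this
    exact this
  contract F t ht x := by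
    refine hm.norm_sum_le hρ F (fun k => t k * c x k) (norm_nonneg x) ?_
    rw [hm.norm]
    refine hρ.solid _ _ fun k => ?_
    rw [norm_mul]
    exact mul_le_of_le_one_left (norm_nonneg _) (ht k)

/-- If the sections of the elements of `X` converge, then `X* = ρ^×`. -/
theorem SeqNorm.IsModel.isBanachDual (hρ : ρ.IsFatou) (hm : ρ.IsModel c e)
    (htail : ∀ x, Tendsto (fun m => ρ.toFun (tail m (c x))) atTop (𝓝 0)) :
    IsBanachDual c (seqSpaceOf (polarENorm {x | ρ.toFun x ≤ 1})) := by
  -- For any finite set that contains `Finset.range N`, the remainder is dominated by the tail from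
  -- `N`, so the expansion converges unconditionally.
  have hconv : ∀ x, HasSum (fun k => c x k • e k) x := by
    intro x
    rw [HasSum, SummationFilter.unconditional_filter, Metric.tendsto_atTop]
    intro ε hε
    obtain ⟨N, hN⟩ := ENNReal.tendsto_atTop_zero.1 (htail x) (ENNReal.ofReal (ε / 2))
      (by simpa using hε)
    refine ⟨Finset.range N, fun F hF => ?_⟩
    rw [dist_eq_norm, norm_sub_rev]
    refine lt_of_le_of_lt (hm.norm_le (C := ε / 2) (by positivity) ?_) (by linarith)
    refine (hρ.solid _ _ fun k => ?_).trans (hN N le_rfl)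
    rw [map_sub, Pi.sub_apply, hm.coord_sum, tail]
    by_cases hk : k ∈ F
    · simp [hk]
    · have : N ≤ k := by
        by_contra hlt
        exact hk (hF (Finset.mem_range.2 (not_le.1 hlt)))
      simp [hk, this]
  have hbd : ∀ φ : StrongDual ℂ X,
      polarENorm {x | ρ.toFun x ≤ 1} (fun k => φ (e k)) ≤ ENNReal.ofReal ‖φ‖ := by
    intro φ
    refine polarENorm_le_ofReal fun x hx F => ?_
    have h1 : ((∑ k ∈ F, ‖φ (e k) * x k‖ : ℝ) : ℂ) =
        φ (∑ k ∈ F, (phase (φ (e k) * x k) * x k) • e k) := by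
      push_cast
      simp only [map_sum, map_smul, smul_eq_mul]
      refine Finset.sum_congr rfl fun k _ => ?_
      rw [← phase_mul]
      ring
    have h2 := φ.le_opNorm (∑ k ∈ F, (phase (φ (e k) * x k) * x k) • e k)
    rw [← h1, Complex.norm_of_nonneg (Finset.sum_nonneg fun _ _ => norm_nonneg _)] at h2
    refine h2.trans (mul_le_of_le_one_right (norm_nonneg _) ?_)
    refine hm.norm_sum_le hρ F (fun k => phase (φ (e k) * x k) * x k) zero_le_one ?_
    rw [ENNReal.ofReal_one]
    refine (hρ.solid _ _ fun k => ?_).trans hx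
    rw [norm_mul]
    exact mul_le_of_le_one_left (norm_nonneg _) (norm_phase_le _)
  refine ⟨fun φ => ⟨fun k => φ (e k), ⟨(hbd φ).trans_lt ENNReal.ofReal_lt_top, fun x => ?_⟩, ?_⟩,
    fun z hz => ?_⟩
  · have := φ.hasSum (hconv x)
    simpa [mul_comm] using this
  · rintro z ⟨-, hz⟩
    funext k
    have h1 : HasSum (fun j => z j * c (e k) j) (z k * c (e k) k) :=
      hasSum_single k fun j hj => by rw [hm.coord, Pi.single_eq_of_ne hj, mul_zero]
    rw [← h1.unique (hz (e k)), hm.coord, Pi.single_eq_same, mul_one]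
  · set R := (polarENorm {x | ρ.toFun x ≤ 1} z).toReal with hR
    have hRle : polarENorm {x | ρ.toFun x ≤ 1} z ≤ ENNReal.ofReal R :=
      (ENNReal.ofReal_toReal (LT.lt.ne hz)).ge
    have hR0 : 0 ≤ R := ENNReal.toReal_nonneg
    -- The vector is divided by `‖x‖ + ε`, since `‖x‖` may vanish.
    have hF : ∀ (x : X) (F : Finset ℕ), ∑ k ∈ F, ‖z k * c x k‖ ≤ R * ‖x‖ := by
      intro x F
      have hlim : Tendsto (fun ε : ℝ => R * (‖x‖ + ε)) (𝓝[>] 0) (𝓝 (R * ‖x‖)) := by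
        have : Continuous fun ε : ℝ => R * (‖x‖ + ε) := by fun_prop
        simpa using (this.tendsto 0).mono_left nhdsWithin_le_nhds
      refine ge_of_tendsto hlim (eventually_mem_nhdsWithin.mono fun ε hε => ?_)
      have hε' : 0 < ε := hε
      have hC : 0 < ‖x‖ + ε := by positivity
      have h1 := sum_le_of_polarENorm_le hR0 hRle (ρ.smul_mem_ball hC
        ((hm.norm x).symm.trans_le (ENNReal.ofReal_le_ofReal (by linarith)))) F
      have h2 : ∀ k, ‖z k * ((((‖x‖ + ε)⁻¹ : ℝ) : ℂ) • c x) k‖ = (‖x‖ + ε)⁻¹ * ‖z k * c x k‖ :=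
        fun k => by
          rw [Pi.smul_apply, smul_eq_mul, mul_left_comm, norm_mul,
            Complex.norm_of_nonneg (by positivity)]
      simp only [h2] at h1
      rwa [← Finset.mul_sum, inv_mul_le_iff₀ hC, mul_comm] at h1
    have hs : ∀ x, Summable fun k => ‖z k * c x k‖ := fun x =>
      summable_of_sum_le (fun _ => norm_nonneg _) (hF x)
    let f : X →ₗ[ℂ] ℂ :=
      { toFun := fun x => ∑' k, z k * c x k
        map_add' := fun x y => by
          rw [← (hs x).of_norm.tsum_add (hs y).of_norm]
          exact tsum_congr fun k => by rw [map_add, Pi.add_apply, mul_add]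
        map_smul' := fun a x => by
          rw [RingHom.id_apply, smul_eq_mul, ← tsum_mul_left]
          exact tsum_congr fun k => by rw [map_smul, Pi.smul_apply, smul_eq_mul, mul_left_comm] }
    have hf : ∀ x, ‖f x‖ ≤ R * ‖x‖ := fun x =>
      (norm_tsum_le_tsum_norm (hs x)).trans
        (Real.tsum_le_of_sum_le (fun _ => norm_nonneg _) (hF x))
    refine ⟨f.mkContinuous R hf, fun x => (hs x).of_norm.hasSum, le_antisymm
      (f.mkContinuous_norm_le hR0 hf) ?_⟩
    have h1 := hbd (f.mkContinuous R hf)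
    have h2 : (fun k => f.mkContinuous R hf (e k)) = z := by
      funext k
      change ∑' j, z j * c (e k) j = z k
      rw [tsum_eq_single k fun j hj => by rw [hm.coord, Pi.single_eq_of_ne hj, mul_zero], hm.coord,
        Pi.single_eq_same, mul_one]
    rw [h2] at h1
    exact ENNReal.toReal_le_of_le_ofReal (norm_nonneg _) h1

end Model

/-! ### Order continuity of Lorentz spaces -/

theorem exists_lt_partialSum {v : ℕ → ℝ} (hv : ∀ k, 0 ≤ v k) (hns : ¬ Summable v) (K : ℝ) :
    ∃ m, K < partialSum v m := by
  have := (not_summable_iff_tendsto_nat_atTop_of_nonneg hv).1 hns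
  exact (this.eventually_gt_atTop K).exists

/-- If infinitely many entries had modulus at least `δ`, a permutation could bring `m` of them to
the front, and the `q`-th power of the norm would be at least `δ ^ q` times a partial sum of a
divergent series. -/
theorem tendsto_zero_of_lorentz {v : ℕ → ℝ} {q : ℝ} (hv : IsWeight v) (hns : ¬ Summable v)
    (hq : 0 < q) {x : ℕ → ℂ} (hx : lorentzENorm v q x < ∞) : Tendsto x atTop (𝓝 0) := by
  have hv0 : ∀ k, 0 ≤ v k := fun k => (hv.pos k).le
  have hle := (lorentzENorm_le_iff hv0 hq (x := x) ENNReal.toReal_nonneg).1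
    (ENNReal.ofReal_toReal hx.ne).ge
  set K := (lorentzENorm v q x).toReal ^ q
  rw [Metric.tendsto_atTop]
  intro δ hδ
  by_contra! hcon
  have hinf : {k | δ ≤ ‖x k‖}.Infinite := Set.infinite_of_forall_exists_gt fun N => by
    obtain ⟨k, hk, h⟩ := hcon (N + 1)
    exact ⟨k, by simpa using h, by omega⟩
  obtain ⟨m, hm⟩ := exists_lt_partialSum hv0 hns (K / δ ^ q)
  obtain ⟨J, hJ, hcard⟩ := hinf.exists_subset_card_eq m
  obtain ⟨π, hπ, -⟩ := exists_perm_sorted (fun _ => 0) m J hcard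
  have h1 := hle π (Finset.range m)
  have h2 : δ ^ q * partialSum v m ≤ ∑ k ∈ Finset.range m, ‖x (π k)‖ ^ q * v k := by
    rw [partialSum, Finset.mul_sum]
    refine Finset.sum_le_sum fun k hk => mul_le_mul_of_nonneg_right ?_ (hv0 k)
    refine Real.rpow_le_rpow hδ.le (hJ ?_) hq.le
    rw [Finset.mem_coe, ← hπ]
    exact Finset.mem_image_of_mem _ hk
  rw [div_lt_iff₀ (by positivity), mul_comm] at hm
  linarith

/-- Fix a finite arrangement that nearly attains the norm. A far tail is small on the positions used
by it, because `x` tends to `0`; on the other positions the tail can be grafted onto it, and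
near-maximality forbids a large gain. -/
theorem lorentz_tail {v : ℕ → ℝ} {q : ℝ} (hv : IsWeight v) (hns : ¬ Summable v)
    (hq : 1 ≤ q) {x : ℕ → ℂ} (hx : lorentzENorm v q x < ∞) :
    Tendsto (fun m => lorentzENorm v q (tail m x)) atTop (𝓝 0) := by
  have hq0 : 0 < q := by linarith
  have hv0 : ∀ k, 0 ≤ v k := fun k => (hv.pos k).le
  have hv1 : ∀ k, v k ≤ 1 := fun k => hv.one ▸ hv.anti (Nat.zero_le k)
  have hle := (lorentzENorm_le_iff hv0 hq0 (x := x) ENNReal.toReal_nonneg).1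
    (ENNReal.ofReal_toReal hx.ne).ge
  have hx0 := tendsto_zero_of_lorentz hv hns hq0 hx
  let S : Set ℝ := {r | ∃ (π : Equiv.Perm ℕ) (K : Finset ℕ), r = ∑ k ∈ K, ‖x (π k)‖ ^ q * v k}
  have hSb : BddAbove S := ⟨_, by rintro r ⟨π, K, rfl⟩; exact hle π K⟩
  have hSne : S.Nonempty := ⟨_, 1, ∅, rfl⟩
  rw [ENNReal.tendsto_atTop_zero]
  intro ε' hε'
  obtain ⟨ε, hε, hεle⟩ : ∃ ε : ℝ, 0 < ε ∧ ENNReal.ofReal ε ≤ ε' := by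
    rcases eq_or_ne ε' ∞ with rfl | h
    · exact ⟨1, one_pos, le_top⟩
    · exact ⟨ε'.toReal, ENNReal.toReal_pos hε'.ne' h, (ENNReal.ofReal_toReal h).le⟩
  -- One half of `ε ^ q` pays for the positions in `K₀`, the other for the defect of the
  -- near-optimal arrangement.
  set η : ℝ := ε ^ q / 2
  have hη : 0 < η := by positivity
  obtain ⟨_, ⟨π₀, K₀, rfl⟩, hK₀⟩ := exists_lt_of_lt_csSup hSne (sub_lt_self (sSup S) hη)
  set c : ℝ := (η / (K₀.card + 1)) ^ (1 / q)
  have hc : 0 < c := by positivity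
  have hcq : c ^ q = η / (K₀.card + 1) := by
    rw [← Real.rpow_mul (by positivity), one_div, inv_mul_cancel₀ hq0.ne', Real.rpow_one]
  obtain ⟨N₁, hN₁⟩ := Metric.tendsto_atTop.1 hx0 c hc
  obtain ⟨N₂, hN₂⟩ : ∃ N₂, ∀ k ∈ K₀, π₀ k < N₂ :=
    ⟨K₀.sup π₀ + 1, fun k hk => Nat.lt_succ_of_le (Finset.le_sup hk)⟩
  refine ⟨max N₁ N₂, fun N hN => le_trans ?_ hεle⟩
  rw [lorentzENorm_le_iff hv0 hq0 hε.le]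
  intro π K
  have hsmall : ∀ k, ‖tail N x (π k)‖ ^ q ≤ η / (K₀.card + 1) := fun k => by
    rw [← hcq]
    refine Real.rpow_le_rpow (norm_nonneg _) ?_ hq0.le
    unfold tail
    split_ifs with h
    · have := hN₁ (π k) (by omega)
      rw [dist_zero_right] at this
      exact this.le
    · simpa using hc.le
  have h1 : ∑ k ∈ K ∩ K₀, ‖tail N x (π k)‖ ^ q * v k ≤ η := by
    have : ∀ k ∈ K ∩ K₀, ‖tail N x (π k)‖ ^ q * v k ≤ η / (K₀.card + 1) := fun k _ =>
      (mul_le_of_le_one_right (by positivity) (hv1 k)).trans (hsmall k)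
    refine (Finset.sum_le_card_nsmul _ _ _ this).trans ?_
    rw [nsmul_eq_mul, mul_div_assoc', div_le_iff₀ (by positivity)]
    have h2 : ((K ∩ K₀).card : ℝ) ≤ K₀.card := by
      exact_mod_cast Finset.card_le_card Finset.inter_subset_right
    nlinarith
  let T := (K \ K₀).filter fun k => N ≤ π k
  have h2 : ∑ k ∈ K \ K₀, ‖tail N x (π k)‖ ^ q * v k = ∑ k ∈ T, ‖x (π k)‖ ^ q * v k := by
    rw [Finset.sum_filter]
    refine Finset.sum_congr rfl fun k _ => ?_
    unfold tail
    split_ifs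
    · rfl
    · simp [hq0.ne']
  have h3 : ∑ k ∈ T, ‖x (π k)‖ ^ q * v k ≤ η := by
    -- The grafted arrangement. It is injective on `K₀ ∪ T` because the values of `π₀` on `K₀` lie
    -- below `N` and those of `π` on `T` do not.
    let σ : ℕ → ℕ := fun k => if k ∈ K₀ then π₀ k else π k
    have hT : ∀ k ∈ T, k ∉ K₀ ∧ N ≤ π k := fun k hk =>
      ⟨(Finset.mem_sdiff.1 (Finset.mem_filter.1 hk).1).2, (Finset.mem_filter.1 hk).2⟩
    have hσ : Set.InjOn σ (K₀ ∪ T : Finset ℕ) := by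
      intro i hi j hj hij
      simp only [Finset.coe_union, Set.mem_union, Finset.mem_coe] at hi hj
      by_cases hi0 : i ∈ K₀ <;> by_cases hj0 : j ∈ K₀
      · simpa [σ, hi0, hj0] using hij
      · have h4 := hT j (hj.resolve_left hj0)
        have h5 := hN₂ i hi0
        simp only [σ, hi0, hj0, if_true, if_false] at hij
        omega
      · have h4 := hT i (hi.resolve_left hi0)
        have h5 := hN₂ j hj0
        simp only [σ, hi0, hj0, if_true, if_false] at hij
        omega
      · simpa [σ, hi0, hj0] using hij
    obtain ⟨τ, hτ⟩ := exists_perm_of_injOn σ _ hσ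
    have h4 : ∑ k ∈ K₀ ∪ T, ‖x (τ k)‖ ^ q * v k ≤ sSup S := le_csSup hSb ⟨τ, _, rfl⟩
    rw [Finset.sum_union (Finset.disjoint_left.2 fun k hk hk' => (hT k hk').1 hk)] at h4
    have h5 : ∑ k ∈ K₀, ‖x (τ k)‖ ^ q * v k = ∑ k ∈ K₀, ‖x (π₀ k)‖ ^ q * v k :=
      Finset.sum_congr rfl fun k hk => by
        rw [hτ k (Finset.mem_union_left _ hk)]
        simp [σ, hk]
    have h6 : ∑ k ∈ T, ‖x (τ k)‖ ^ q * v k = ∑ k ∈ T, ‖x (π k)‖ ^ q * v k :=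
      Finset.sum_congr rfl fun k hk => by
        rw [hτ k (Finset.mem_union_right _ hk)]
        simp [σ, (hT k hk).1]
    linarith
  rw [← Finset.sum_inter_add_sum_sdiff K K₀, h2]
  have : η + η = ε ^ q := by simp only [η]; ring
  linarith

/-! ### Gliding humps -/

/-- The gliding hump criterion: the tails can fail to vanish only if, for some `δ`, finite pairings
above `δ` with members of `U` occur beyond every index. -/
theorem tendsto_polarENorm_tail {U : Set (ℕ → ℂ)} {α : ℕ → ℂ}
    (H : ∀ δ > 0, ¬ ∀ m : ℕ, ∃ x ∈ U, ∃ F : Finset ℕ, (∀ k ∈ F, m ≤ k) ∧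
      δ < ∑ k ∈ F, ‖α k * x k‖) :
    Tendsto (fun m => polarENorm U (tail m α)) atTop (𝓝 0) := by
  rw [ENNReal.tendsto_atTop_zero]
  intro ε' hε'
  obtain ⟨ε, hε, hεle⟩ : ∃ ε : ℝ, 0 < ε ∧ ENNReal.ofReal ε ≤ ε' := by
    rcases eq_or_ne ε' ∞ with rfl | h
    · exact ⟨1, one_pos, le_top⟩
    · exact ⟨ε'.toReal, ENNReal.toReal_pos hε'.ne' h, (ENNReal.ofReal_toReal h).le⟩
  have h1 := H ε hε
  push Not at h1
  obtain ⟨m, hm⟩ := h1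
  refine ⟨m, fun N hN => le_trans (polarENorm_le_ofReal fun x hx F => ?_) hεle⟩
  refine le_trans (le_of_eq ?_) (hm x hx (F.filter fun k => N ≤ k)
    fun k hk => hN.trans (Finset.mem_filter.1 hk).2)
  rw [Finset.sum_filter]
  refine Finset.sum_congr rfl fun k _ => ?_
  unfold tail
  split_ifs <;> simp

/-- Humps found beyond every index are chosen one after another on consecutive intervals. The
predicate `P` may depend on the left end point, so that later humps can be required to be flatter.
-/
theorem exists_blocks {α : ℕ → ℂ} {δ : ℝ} (P : ℕ → (ℕ → ℂ) → Prop)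
    (h : ∀ m : ℕ, ∃ x, P m x ∧ ∃ F : Finset ℕ, (∀ k ∈ F, m ≤ k) ∧ δ < ∑ k ∈ F, ‖α k * x k‖) :
    ∃ (m : ℕ → ℕ) (x : ℕ → ℕ → ℂ), StrictMono m ∧ m 0 = 0 ∧ (∀ j, P (m j) (x j)) ∧
      ∀ j, δ < ∑ k ∈ Finset.Ico (m j) (m (j + 1)), ‖α k * x j k‖ := by
  have h' : ∀ m : ℕ, ∃ (x : ℕ → ℂ) (m' : ℕ), m < m' ∧ P m x ∧
      δ < ∑ k ∈ Finset.Ico m m', ‖α k * x k‖ := by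
    intro m
    obtain ⟨x, hP, F, hF, hlt⟩ := h m
    refine ⟨x, max (m + 1) (F.sup id + 1), by omega, hP, hlt.trans_le ?_⟩
    refine Finset.sum_le_sum_of_subset_of_nonneg (fun k hk => ?_) fun _ _ _ => norm_nonneg _
    have h1 : k ≤ F.sup id := Finset.le_sup (f := id) hk
    have h2 := hF k hk
    rw [Finset.mem_Ico]
    omega
  choose x m' h1 h2 h3 using h'
  let m : ℕ → ℕ := fun j => Nat.rec 0 (fun _ i => m' i) j
  exact ⟨m, fun j => x (m j), strictMono_nat_of_lt_succ fun j => h1 (m j), rfl,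
    fun j => h2 (m j), fun j => h3 (m j)⟩

/-- The intervals partition ℕ; the block number `J k` serves to glue one hump per block into a
single sequence. -/
theorem exists_block_index {m : ℕ → ℕ} (hm : StrictMono m) (h0 : m 0 = 0) :
    ∃ J : ℕ → ℕ, ∀ k j, k ∈ Finset.Ico (m j) (m (j + 1)) ↔ J k = j := by
  refine ⟨fun k => Nat.findGreatest (fun j => m j ≤ k) k, fun k j => ?_⟩
  have hle : m (Nat.findGreatest (fun j => m j ≤ k) k) ≤ k :=
    Nat.findGreatest_spec (P := fun j => m j ≤ k) (Nat.zero_le k) (by simp [h0])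
  have hmax : ∀ j, m j ≤ k → j ≤ Nat.findGreatest (fun j => m j ≤ k) k := fun j hj =>
    Nat.le_findGreatest ((hm.id_le j).trans hj) hj
  rw [Finset.mem_Ico]
  constructor
  · rintro ⟨h1, h2⟩
    exact le_antisymm (Nat.lt_succ_iff.1 (hm.lt_iff_lt.1 (hle.trans_lt h2))) (hmax j h1)
  · rintro rfl
    refine ⟨hle, ?_⟩
    by_contra hcon
    exact absurd (hmax _ (not_lt.1 hcon)) (Nat.not_succ_le_self _)

theorem sum_range_blocks {m : ℕ → ℕ} (hm : Monotone m) (h0 : m 0 = 0) (f : ℕ → ℝ) (N : ℕ) :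
    ∑ k ∈ Finset.range (m N), f k =
      ∑ j ∈ Finset.range N, ∑ k ∈ Finset.Ico (m j) (m (j + 1)), f k := by
  induction N with
  | zero => simp [h0]
  | succ N ih =>
    rw [Finset.sum_range_succ, ← ih]
    exact (Finset.sum_range_add_sum_Ico _ (hm (Nat.le_succ N))).symm

/-- The dual of a Lorentz space with exponent `q > 1` is order continuous. -/
theorem lorentz_polar_tail {v : ℕ → ℝ} {q : ℝ} (hv : IsWeight v) (hq : 1 < q) {α : ℕ → ℂ}
    (hα : polarENorm {x | lorentzENorm v q x ≤ 1} α < ∞) :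
    Tendsto (fun m => polarENorm {x | lorentzENorm v q x ≤ 1} (tail m α)) atTop (𝓝 0) := by
  have hq0 : 0 < q := by linarith
  have hv0 : ∀ k, 0 ≤ v k := fun k => (hv.pos k).le
  refine tendsto_polarENorm_tail fun δ hδ hcon => ?_
  obtain ⟨m, x, hm, h0, hx, hlt⟩ := exists_blocks (fun _ x => lorentzENorm v q x ≤ 1) hcon
  obtain ⟨J, hJ⟩ := exists_block_index hm h0
  -- The humps get the weights `1 / (j + 1)`: their `q`-th powers are summable as `q > 1`, but they
  -- are not.
  have hZs : Summable fun j : ℕ => ((1 : ℝ) / (j + 1)) ^ q := by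
    have := (summable_nat_add_iff 1).2 (Real.summable_one_div_nat_rpow.2 hq)
    refine this.congr fun j => ?_
    rw [Real.div_rpow zero_le_one (by positivity), Real.one_rpow]
    push_cast
    rfl
  set Z := ∑' j : ℕ, ((1 : ℝ) / (j + 1)) ^ q
  have hZ : 1 ≤ Z := le_trans (by simp) (hZs.le_tsum 0 fun j _ => by positivity)
  let X : ℕ → ℂ := fun k => ((1 / (J k + 1) : ℝ) : ℂ) * x (J k) k
  have hXn : ∀ k, ‖X k‖ = 1 / (J k + 1) * ‖x (J k) k‖ := fun k => by
    rw [norm_mul, Complex.norm_of_nonneg (by positivity)]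
  set C := Z ^ (1 / q)
  have hC : 0 < C := by positivity
  have hCq : C ^ q = Z := by
    rw [← Real.rpow_mul (by positivity), one_div, inv_mul_cancel₀ hq0.ne', Real.rpow_one]
  have hX : lorentzENorm v q X ≤ ENNReal.ofReal C := by
    rw [lorentzENorm_le_iff hv0 hq0 hC.le]
    intro π K
    -- Humps with disjoint supports satisfy an upper `q`-estimate: for a fixed permutation each
    -- block contributes at most the `q`-th power of its weight.
    rw [hCq, ← Finset.sum_fiberwise_of_maps_to (g := fun k => J (π k))
      (t := K.image fun k => J (π k)) fun k hk => Finset.mem_image_of_mem _ hk]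
    refine le_trans (Finset.sum_le_sum fun j _ => ?_) (hZs.sum_le_tsum
      (K.image fun k => J (π k)) fun j _ => by positivity)
    have h1 : ∑ k ∈ K with J (π k) = j, ‖X (π k)‖ ^ q * v k =
        ((1 : ℝ) / (j + 1)) ^ q * ∑ k ∈ K with J (π k) = j, ‖x j (π k)‖ ^ q * v k := by
      rw [Finset.mul_sum]
      refine Finset.sum_congr rfl fun k hk => ?_
      rw [hXn, (Finset.mem_filter.1 hk).2, Real.mul_rpow (by positivity) (norm_nonneg _), mul_assoc]
    rw [h1]
    exact mul_le_of_le_one_right (by positivity)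
      ((lorentzENorm_le_one_iff hv0 hq0).1 (hx j) π _)
  have hmem := (lorentz v q hv hq.le).smul_mem_ball hC hX
  have hsum := fun F => sum_le_of_polarENorm_le ENNReal.toReal_nonneg
    (ENNReal.ofReal_toReal hα.ne).ge hmem F
  set R := (polarENorm {x | lorentzENorm v q x ≤ 1} α).toReal
  have hlow : ∀ N, δ * ∑ j ∈ Finset.range N, (1 : ℝ) / (j + 1) ≤ C * R := by
    intro N
    have h1 := hsum (Finset.range (m N))
    have h2 : ∀ k, ‖α k * (((C⁻¹ : ℝ) : ℂ) • X) k‖ = C⁻¹ * ‖α k * X k‖ := fun k => by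
      rw [Pi.smul_apply, smul_eq_mul, mul_left_comm, norm_mul,
        Complex.norm_of_nonneg (by positivity)]
    simp only [h2] at h1
    rw [← Finset.mul_sum, inv_mul_le_iff₀ hC, sum_range_blocks hm.monotone h0] at h1
    refine le_trans ?_ h1
    rw [Finset.mul_sum]
    refine Finset.sum_le_sum fun j _ => ?_
    have h3 : ∑ k ∈ Finset.Ico (m j) (m (j + 1)), ‖α k * X k‖ =
        (1 : ℝ) / (j + 1) * ∑ k ∈ Finset.Ico (m j) (m (j + 1)), ‖α k * x j k‖ := by
      rw [Finset.mul_sum]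
      refine Finset.sum_congr rfl fun k hk => ?_
      rw [norm_mul, hXn, (hJ k j).1 hk, norm_mul]
      ring
    rw [h3, mul_comm δ]
    exact mul_le_mul_of_nonneg_left (hlt j).le (by positivity)
  have hdiv := Real.tendsto_sum_range_one_div_nat_succ_atTop
  obtain ⟨N, hN⟩ := (hdiv.eventually_gt_atTop (C * R / δ)).exists
  rw [div_lt_iff₀ hδ, mul_comm _ δ] at hN
  exact absurd (hlow N) (not_le.2 hN)

theorem polarENorm_supBall (α : ℕ → ℂ) :
    polarENorm {x | ∀ k, ‖x k‖ ≤ 1} α = ∑' k, ‖α k‖ₑ := by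
  refine le_antisymm (iSup₂_le fun x hx => ENNReal.tsum_le_tsum fun k => ?_) ?_
  · rw [enorm_mul]
    refine mul_le_of_le_one_right zero_le ?_
    rw [← enorm_one (G := ℂ)]
    exact enorm_le_iff_norm_le.2 (by simpa using hx k)
  · refine le_trans (le_of_eq ?_) (le_iSup₂ (f := fun (x : ℕ → ℂ)
      (_ : x ∈ {x : ℕ → ℂ | ∀ k, ‖x k‖ ≤ 1}) => ∑' k, ‖α k * x k‖ₑ) 1 (by simp))
    simp

theorem supBall_polar_tail {α : ℕ → ℂ} (hα : polarENorm {x | ∀ k, ‖x k‖ ≤ 1} α < ∞) :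
    Tendsto (fun m => polarENorm {x | ∀ k, ‖x k‖ ≤ 1} (tail m α)) atTop (𝓝 0) := by
  simp only [polarENorm_supBall] at hα ⊢
  have h1 := ENNReal.tendsto_sum_nat_add (fun k => ‖α k‖ₑ) hα.ne
  refine h1.congr fun m => ?_
  have h2 : ∑ k ∈ Finset.range m, ‖tail m α k‖ₑ = 0 := Finset.sum_eq_zero fun k hk => by
    rw [tail, if_neg (not_le.2 (Finset.mem_range.1 hk)), enorm_zero]
  have h3 := ENNReal.summable.sum_add_tsum_nat_add' (f := fun k => ‖tail m α k‖ₑ) (k := m)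
  rw [h2, zero_add] at h3
  rw [← h3]
  exact tsum_congr fun k => by rw [tail, if_pos (Nat.le_add_left m k)]

/-- The Köthe dual of a Marcinkiewicz space with `Ψ → ∞` is order continuous. -/
theorem marcinkiewicz_polar_tail {Ψ : ℕ → ℝ} (hΨ : IsFundamental Ψ)
    (hinf : Tendsto Ψ atTop atTop) {α : ℕ → ℂ}
    (hα : polarENorm {x | (marcinkiewicz Ψ).toFun x ≤ 1} α < ∞) :
    Tendsto (fun m => polarENorm {x | (marcinkiewicz Ψ).toFun x ≤ 1} (tail m α)) atTop (𝓝 0) := by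
  set U : Set (ℕ → ℂ) := {x | (marcinkiewicz Ψ).toFun x ≤ 1} with hU
  have hmemU : ∀ x, x ∈ U ↔ ∀ J : Finset ℕ, J.Nonempty → ∑ k ∈ J, ‖x k‖ ≤ Ψ J.card := fun x =>
    marcinkiewicz_le_one_iff hΨ
  have hx1 : ∀ x ∈ U, ∀ k, ‖x k‖ ≤ 1 := fun x hx k => by
    simpa [hΨ.one] using (hmemU x).1 hx {k} (Finset.singleton_nonempty k)
  have hsum := fun x (hx : x ∈ U) F => sum_le_of_polarENorm_le ENNReal.toReal_nonneg
    (ENNReal.ofReal_toReal hα.ne).ge hx F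
  set R := (polarENorm U α).toReal
  have hscale : ∀ (x : ℕ → ℂ) (C : ℝ), 0 < C →
      (∀ J : Finset ℕ, J.Nonempty → ∑ k ∈ J, ‖x k‖ ≤ C * Ψ J.card) →
      ∀ F : Finset ℕ, ∑ k ∈ F, ‖α k * x k‖ ≤ C * R := by
    intro x C hC hx F
    have h1 := hsum _ ((marcinkiewicz Ψ).smul_mem_ball hC
      ((marcinkiewicz_le_iff hΨ hC.le).2 hx)) F
    have h2 : ∀ k, ‖α k * (((C⁻¹ : ℝ) : ℂ) • x) k‖ = C⁻¹ * ‖α k * x k‖ := fun k => by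
      rw [Pi.smul_apply, smul_eq_mul, mul_left_comm, norm_mul,
        Complex.norm_of_nonneg (by positivity)]
    simp only [h2] at h1
    rwa [← Finset.mul_sum, inv_mul_le_iff₀ hC] at h1
  -- If `Ψ` grows linearly, all bounded sequences have finite norm and `α` is summable. Otherwise
  -- Ψ(N)/N takes arbitrarily small values and humps can be flattened.
  by_cases hcase : ∃ c > 0, ∀ N : ℕ, 1 ≤ N → c * N ≤ Ψ N
  · obtain ⟨c, hc, hcN⟩ := hcase
    have hα1 : polarENorm {x | ∀ k, ‖x k‖ ≤ 1} α < ∞ := by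
      refine lt_of_le_of_lt (polarENorm_le_ofReal fun x hx F => ?_)
        (ENNReal.ofReal_lt_top (r := c⁻¹ * R))
      refine hscale x c⁻¹ (by positivity) (fun J hJ => ?_) F
      rw [inv_mul_eq_div, le_div_iff₀ hc, mul_comm]
      refine le_trans (mul_le_mul_of_nonneg_left ?_ hc.le) (hcN _ (Finset.card_pos.2 hJ))
      simpa using Finset.sum_le_card_nsmul J (fun k => ‖x k‖) 1 fun k _ => hx k
    refine tendsto_of_tendsto_of_tendsto_of_le_of_le tendsto_const_nhds
      (supBall_polar_tail hα1) (fun _ => zero_le) fun m => ?_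
    exact biSup_mono fun x hx => hx1 x hx
  · push Not at hcase
    -- Humps of arbitrarily small sup norm cannot persist: chosen flat enough, one per block, they
    -- glue to a sequence of norm at most `3`, while each adds more than `δ` to the pairing with
    -- `α`.
    have hflat : ∀ δ > 0, ¬ ∀ (m : ℕ) (η : ℝ), 0 < η → ∃ x, (x ∈ U ∧ ∀ k, ‖x k‖ ≤ η) ∧
        ∃ F : Finset ℕ, (∀ k ∈ F, m ≤ k) ∧ δ < ∑ k ∈ F, ‖α k * x k‖ := by
      intro δ hδ hcon
      have hex : ∀ m : ℕ, ∃ M : ℕ, 0 < M ∧ (m : ℝ) ≤ Ψ M := fun m =>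
        ((eventually_gt_atTop 0).and (hinf.eventually_ge_atTop (m : ℝ))).exists
      choose M hM0 hM using hex
      obtain ⟨m, x, hm, h0, hx, hlt⟩ := exists_blocks
        (fun m x => x ∈ U ∧ ∀ k, ‖x k‖ ≤ 1 / (M m : ℝ))
        fun m => hcon m _ (by have := hM0 m; positivity)
      obtain ⟨J, hJ⟩ := exists_block_index hm h0
      have hJ' : ∀ k, m (J k) ≤ k ∧ k < m (J k + 1) := fun k =>
        Finset.mem_Ico.1 ((hJ k (J k)).2 rfl)
      let X : ℕ → ℂ := fun k => x (J k) k
      have hX : ∀ A : Finset ℕ, A.Nonempty → ∑ k ∈ A, ‖X k‖ ≤ 3 * Ψ A.card := by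
        intro A hA
        have hA1 : 1 ≤ A.card := Finset.card_pos.2 hA
        have hΨA := hΨ.one_le hA1
        -- Let `j` be the block in which Ψ(|A|) falls. The earlier blocks have at most Ψ(|A|)
        -- entries, all bounded by `1`; block `j` is part of one member of `U`; later humps are
        -- bounded by 1/|A|. Each part contributes at most Ψ(|A|).
        obtain ⟨j, hj, hj'⟩ : ∃ j, (m j : ℝ) ≤ Ψ A.card ∧ Ψ A.card < m (j + 1) := by
          have hP : ∃ i, Ψ A.card < m i := by
            obtain ⟨i, hi⟩ := exists_nat_gt (Ψ A.card)
            exact ⟨i, hi.trans_le (by exact_mod_cast hm.id_le i)⟩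
          have hpos : Nat.find hP ≠ 0 := by
            intro h
            have := Nat.find_spec hP
            rw [h, h0] at this
            push_cast at this
            linarith
          refine ⟨Nat.find hP - 1, not_lt.1 (Nat.find_min hP (by omega)), ?_⟩
          rw [Nat.sub_add_cancel (by omega)]
          exact Nat.find_spec hP
        have hsplit : ∑ k ∈ A, ‖X k‖ = ∑ k ∈ A with J k < j, ‖X k‖ +
            ∑ k ∈ A with J k = j, ‖X k‖ + ∑ k ∈ A with j < J k, ‖X k‖ := by
          simp only [Finset.sum_filter]
          rw [← Finset.sum_add_distrib, ← Finset.sum_add_distrib]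
          refine Finset.sum_congr rfl fun k _ => ?_
          rcases lt_trichotomy (J k) j with h | h | h
          · simp [h, h.ne, h.le]
          · simp [h]
          · simp [h, h.ne', h.le]
        have h1 : ∑ k ∈ A with J k < j, ‖X k‖ ≤ Ψ A.card := by
          have hsub : (A.filter fun k => J k < j) ⊆ Finset.range (m j) := fun k hk => by
            have h2 := (hJ' k).2
            have h3 : m (J k + 1) ≤ m j := hm.monotone (Finset.mem_filter.1 hk).2
            rw [Finset.mem_range]
            omega
          refine le_trans ?_ hj
          refine (Finset.sum_le_card_nsmul _ _ 1 fun k _ => hx1 _ (hx _).1 k).trans ?_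
          rw [nsmul_eq_mul, mul_one]
          have := Finset.card_le_card hsub
          rw [Finset.card_range] at this
          exact_mod_cast this
        have h2 : ∑ k ∈ A with J k = j, ‖X k‖ ≤ Ψ A.card := by
          have : ∑ k ∈ A with J k = j, ‖X k‖ = ∑ k ∈ A with J k = j, ‖x j k‖ :=
            Finset.sum_congr rfl fun k hk => by
              simp only [X, (Finset.mem_filter.1 hk).2]
          rw [this]
          exact (Finset.sum_le_sum_of_subset_of_nonneg (Finset.filter_subset _ _)
            fun _ _ _ => norm_nonneg _).trans ((hmemU _).1 (hx j).1 A hA)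
        have h3 : ∑ k ∈ A with j < J k, ‖X k‖ ≤ Ψ A.card := by
          have hb : ∀ k ∈ A.filter fun k => j < J k, ‖X k‖ ≤ 1 / (A.card : ℝ) := by
            intro k hk
            refine ((hx (J k)).2 k).trans (one_div_le_one_div_of_le (by positivity) ?_)
            have h4 : Ψ A.card < Ψ (M (m (J k))) := by
              refine hj'.trans_le (le_trans ?_ (hM _))
              exact_mod_cast hm.monotone (Finset.mem_filter.1 hk).2
            have h5 : A.card < M (m (J k)) := by
              by_contra hcon
              exact absurd (hΨ.mono (not_lt.1 hcon)) (not_le.2 h4)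
            exact_mod_cast h5.le
          refine (Finset.sum_le_card_nsmul _ _ _ hb).trans (le_trans ?_ hΨA)
          rw [nsmul_eq_mul, mul_one_div, div_le_one (by positivity)]
          exact_mod_cast Finset.card_le_card (Finset.filter_subset _ _)
        linarith
      have hlow : ∀ N : ℕ, δ * N ≤ 3 * R := by
        intro N
        refine le_trans ?_ (hscale X 3 (by norm_num) hX (Finset.range (m N)))
        rw [sum_range_blocks hm.monotone h0]
        have h3 : ∀ j, δ ≤ ∑ k ∈ Finset.Ico (m j) (m (j + 1)), ‖α k * X k‖ := fun j => by
          refine (hlt j).le.trans (le_of_eq (Finset.sum_congr rfl fun k hk => ?_))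
          simp only [X, (hJ k j).1 hk]
        refine le_trans (le_of_eq ?_) (Finset.sum_le_sum fun j _ => h3 j)
        simp [mul_comm]
      obtain ⟨N, hN⟩ := exists_nat_gt (3 * R / δ)
      rw [div_lt_iff₀ hδ, mul_comm _ δ] at hN
      exact absurd (hlow N) (not_le.2 hN)
    -- If `‖α k‖ ≥ δ` infinitely often, the constant `1 / r` on `r` such indices is a flat hump.
    have hα0 : ∀ δ > 0, ∃ N, ∀ k ≥ N, ‖α k‖ ≤ δ := by
      intro δ hδ
      by_contra! hcon
      refine hflat (δ / 2) (by positivity) fun m η hη => ?_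
      have hinfset : {k | m ≤ k ∧ δ ≤ ‖α k‖}.Infinite :=
        Set.infinite_of_forall_exists_gt fun N => by
          obtain ⟨k, hk, h⟩ := hcon (max m (N + 1))
          exact ⟨k, ⟨by omega, h.le⟩, by omega⟩
      obtain ⟨r, hr⟩ := exists_nat_gt (1 / η)
      have hr0 : (0 : ℝ) < r := lt_trans (by positivity) hr
      obtain ⟨A, hA, hcard⟩ := hinfset.exists_subset_card_eq r
      let x : ℕ → ℂ := fun k => if k ∈ A then ((1 / r : ℝ) : ℂ) else 0
      have hxn : ∀ k, ‖x k‖ = if k ∈ A then (1 / r : ℝ) else 0 := fun k => by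
        simp only [x]
        split_ifs
        · rw [Complex.norm_of_nonneg (by positivity)]
        · simp
      refine ⟨x, ⟨(hmemU x).2 fun J hJ => ?_, fun k => ?_⟩, A, fun k hk => (hA hk).1, ?_⟩
      · refine le_trans ?_ (hΨ.one_le (Finset.card_pos.2 hJ))
        simp only [hxn]
        rw [← Finset.sum_filter, Finset.sum_const, nsmul_eq_mul, mul_one_div, div_le_one hr0]
        rw [← hcard]
        exact_mod_cast Finset.card_le_card fun k hk => (Finset.mem_filter.1 hk).2
      · rw [hxn]
        split_ifs
        · rw [div_le_iff₀ hr0]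
          rw [div_lt_iff₀ hη] at hr
          linarith
        · exact hη.le
      · have : ∀ k ∈ A, δ * (1 / r) ≤ ‖α k * x k‖ := fun k hk => by
          rw [norm_mul, hxn, if_pos hk]
          exact mul_le_mul_of_nonneg_right (hA hk).2 (by positivity)
        refine lt_of_lt_of_le ?_ (Finset.card_nsmul_le_sum A _ _ this)
        rw [hcard, nsmul_eq_mul]
        field_simp
        norm_num
    -- A general hump is flattened by deleting its entries above `η`. Since `Ψ M < η * M` there are
    -- fewer than `M` of them, and far out `α` is so small that they carry at most `δ / 2`.
    refine tendsto_polarENorm_tail fun δ hδ hcon => ?_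
    refine hflat (δ / 2) (by positivity) fun m η hη => ?_
    obtain ⟨M, hM1, hM⟩ := hcase η hη
    have hM0 : (0 : ℝ) < M := by exact_mod_cast hM1
    obtain ⟨N, hN⟩ := hα0 (δ / (2 * M)) (by positivity)
    obtain ⟨x, hx, F, hF, hlt⟩ := hcon (max m N)
    refine ⟨fun k => if ‖x k‖ ≤ η then x k else 0, ⟨(hmemU _).2 fun J hJ => ?_, fun k => ?_⟩, F,
      fun k hk => le_trans (le_max_left _ _) (hF k hk), ?_⟩
    · refine le_trans (Finset.sum_le_sum fun k _ => ?_) ((hmemU x).1 hx J hJ)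
      split_ifs <;> simp
    · dsimp only
      split_ifs with h
      · exact h
      · simpa using hη.le
    · have hsplit : ∑ k ∈ F, ‖α k * x k‖ =
          ∑ k ∈ F, ‖α k * (if ‖x k‖ ≤ η then x k else 0)‖ +
          ∑ k ∈ F with ¬ ‖x k‖ ≤ η, ‖α k * x k‖ := by
        rw [Finset.sum_filter, ← Finset.sum_add_distrib]
        refine Finset.sum_congr rfl fun k _ => ?_
        split_ifs <;> simp
      have hcard : (F.filter fun k => ¬ ‖x k‖ ≤ η).card < M := by
        by_contra hcon2
        obtain ⟨A, hA, hAM⟩ := Finset.exists_subset_card_eq (not_lt.1 hcon2)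
        have h1 := (hmemU x).1 hx A (Finset.card_pos.1 (by omega))
        have h2 : ∀ k ∈ A, η ≤ ‖x k‖ := fun k hk =>
          (not_le.1 (Finset.mem_filter.1 (hA hk)).2).le
        have h3 := Finset.card_nsmul_le_sum A _ _ h2
        rw [hAM] at h1 h3
        rw [nsmul_eq_mul, mul_comm] at h3
        linarith
      have h4 : ∑ k ∈ F with ¬ ‖x k‖ ≤ η, ‖α k * x k‖ ≤ δ / 2 := by
        have h5 : ∀ k ∈ F.filter fun k => ¬ ‖x k‖ ≤ η, ‖α k * x k‖ ≤ δ / (2 * M) := by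
          intro k hk
          rw [norm_mul]
          exact (mul_le_of_le_one_right (norm_nonneg _) (hx1 x hx k)).trans
            (hN k (le_trans (le_max_right _ _) (hF k (Finset.mem_filter.1 hk).1)))
        refine (Finset.sum_le_card_nsmul _ _ _ h5).trans ?_
        have h6 : ((F.filter fun k => ¬ ‖x k‖ ≤ η).card : ℝ) ≤ M := by exact_mod_cast hcard.le
        rw [nsmul_eq_mul]
        calc _ ≤ (M : ℝ) * (δ / (2 * M)) := mul_le_mul_of_nonneg_right h6 (by positivity)
          _ = δ / 2 := by field_simp
      linarith

/-! ### Inequalities for finite sums -/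

/-- Hölder's inequality for the exponent `θ = p (n - 1) / n`. -/
theorem sum_rpow_le_holder {ι : Type*} (s : Finset ι) {n : ℕ} (hn : 1 ≤ n) {p D : ℝ} (hp : 1 ≤ p)
    (hD : D = n - p * (n - 1)) (hD0 : 0 < D) (a b w : ι → ℝ) (ha : ∀ i, 0 ≤ a i)
    (hb : ∀ i, 0 ≤ b i) (hw : ∀ i, 0 ≤ w i) (hS : ∑ i ∈ s, a i ^ (p / D) * w i ^ (n / D) ≤ 1) :
    ∑ i ∈ s, (a i * b i ^ (n - 1)) ^ p * w i ≤ (∑ i ∈ s, a i * b i ^ n) ^ (p * (n - 1) / n) := by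
  have hn0 : (0 : ℝ) < n := by positivity
  -- For `n = 1` one has θ = 0 and `D = 1`, and the claim is the hypothesis. Otherwise 0 < θ < 1,
  -- and Hölder applies with exponents 1/θ and 1/(1-θ), where 1 - θ = D/n.
  rcases hn.lt_or_eq with hn2 | rfl
  · have hn1 : (1 : ℝ) < n := by exact_mod_cast hn2
    set θ := p * (n - 1) / n with hθ
    have hθ0 : 0 < θ := by
      have : 0 < (n : ℝ) - 1 := by linarith
      positivity
    have hθ1 : 1 - θ = D / n := by rw [hθ, hD]; field_simp
    have hθ2 : 0 < 1 - θ := by rw [hθ1]; positivity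
    have hconj : (1 / θ).HolderConjugate (1 / (1 - θ)) := by
      rw [Real.holderConjugate_iff]
      refine ⟨?_, by rw [one_div, one_div, inv_inv, inv_inv]; ring⟩
      rw [lt_div_iff₀ hθ0]
      linarith
    have hab : ∀ i, 0 ≤ a i * b i ^ n := fun i => mul_nonneg (ha i) (pow_nonneg (hb i) n)
    have haw : ∀ i, 0 ≤ a i ^ (p / D) * w i ^ (n / D) := fun i =>
      mul_nonneg (Real.rpow_nonneg (ha i) _) (Real.rpow_nonneg (hw i) _)
    have h1 := Real.inner_le_Lp_mul_Lq_of_nonneg s hconj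
      (f := fun i => (a i * b i ^ n) ^ θ) (g := fun i => (a i ^ (p / D) * w i ^ (n / D)) ^ (1 - θ))
      (fun i _ => Real.rpow_nonneg (hab i) _) (fun i _ => Real.rpow_nonneg (haw i) _)
    have h2 : ∀ i, ((a i * b i ^ n) ^ θ) ^ (1 / θ) = a i * b i ^ n := fun i => by
      rw [← Real.rpow_mul (hab i), mul_one_div_cancel hθ0.ne', Real.rpow_one]
    have h3 : ∀ i, ((a i ^ (p / D) * w i ^ (n / D)) ^ (1 - θ)) ^ (1 / (1 - θ)) =
        a i ^ (p / D) * w i ^ (n / D) := fun i => by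
      rw [← Real.rpow_mul (haw i), mul_one_div_cancel hθ2.ne', Real.rpow_one]
    simp only [h2, h3] at h1
    rw [one_div_one_div, one_div_one_div] at h1
    refine le_trans (Finset.sum_le_sum fun i _ => le_of_eq ?_) (h1.trans
      (mul_le_of_le_one_right (Real.rpow_nonneg (Finset.sum_nonneg fun i _ => hab i) _)
        (Real.rpow_le_one (Finset.sum_nonneg fun i _ => haw i) hS hθ2.le)))
    have e1 : (a i * b i ^ n) ^ θ = a i ^ θ * (b i ^ (n - 1)) ^ p := by
      rw [Real.mul_rpow (ha i) (pow_nonneg (hb i) n), ← Real.rpow_natCast (b i) n,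
        ← Real.rpow_natCast (b i) (n - 1), ← Real.rpow_mul (hb i), ← Real.rpow_mul (hb i),
        Nat.cast_sub hn, Nat.cast_one]
      congr 2
      rw [hθ]; field_simp
    have e2 : (a i ^ (p / D) * w i ^ (n / D)) ^ (1 - θ) = a i ^ (p - θ) * w i := by
      rw [Real.mul_rpow (Real.rpow_nonneg (ha i) _) (Real.rpow_nonneg (hw i) _),
        ← Real.rpow_mul (ha i), ← Real.rpow_mul (hw i), hθ1]
      have e3 : p / D * (D / n) = p - θ := by rw [hθ]; field_simp; ring
      have e4 : (n : ℝ) / D * (D / n) = 1 := by field_simp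
      rw [e3, e4, Real.rpow_one]
    have hpθ : 0 < p - θ := by linarith
    rw [e1, e2, Real.mul_rpow (ha i) (pow_nonneg (hb i) _),
      show a i ^ p = a i ^ θ * a i ^ (p - θ) by
        rw [← Real.rpow_add_of_nonneg (ha i) hθ0.le hpθ.le]; congr 1; ring]
    ring
  · have hD1 : D = 1 := by rw [hD]; push_cast; ring
    simpa [hD1] using hS

/-- The extremal case of Hölder's inequality. -/
theorem exists_extremal {ι : Type*} (s : Finset ι) {n : ℕ} {p D : ℝ} (hp : 1 ≤ p)
    (hD : D = n - p * (n - 1)) (hD0 : 0 < D) (a w : ι → ℝ) (ha : ∀ i, 0 ≤ a i)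
    (hw : ∀ i, 0 < w i) (hS : 0 < ∑ i ∈ s, a i ^ (p / D) * w i ^ (n / D)) :
    ∃ b : ι → ℝ, (∀ i, 0 ≤ b i) ∧
      (∀ z : ι → ℝ, (∀ i, 0 ≤ z i) → ∑ i ∈ s, b i * z i ≤ (∑ i ∈ s, z i ^ p * w i) ^ (1 / p)) ∧
      ∑ i ∈ s, a i * b i ^ n = (∑ i ∈ s, a i ^ (p / D) * w i ^ (n / D)) ^ (D / p) := by
  have hp0 : 0 < p := by linarith
  set A := ∑ i ∈ s, a i ^ (p / D) * w i ^ (n / D) with hA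
  -- A probability density on `s`. The extremal b = u^{1-1/p} w^{1/p} has dual norm at most one by
  -- weighted Hölder with respect to `u`, and ∑ a bⁿ becomes a power of `A`.
  let u : ι → ℝ := fun i => a i ^ (p / D) * w i ^ (n / D) / A
  have hu : ∀ i, 0 ≤ u i := fun i => by
    have := ha i
    have := (hw i).le
    positivity
  have hu1 : ∑ i ∈ s, u i = 1 := by
    rw [← Finset.sum_div, ← hA, div_self hS.ne']
  have hupos : ∀ i, a i ≠ 0 → 0 < u i := fun i hi => by
    have := (ha i).lt_of_ne' hi
    have := hw i
    positivity
  -- Where `a` vanishes so does `u`, and `w / u` is meaningless; `b` is set to `0` there.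
  refine ⟨fun i => if a i = 0 then 0 else u i ^ (1 - 1 / p) * w i ^ (1 / p), fun i => ?_,
    fun z hz => ?_, ?_⟩
  · dsimp only
    split_ifs
    · exact le_rfl
    · exact mul_nonneg (Real.rpow_nonneg (hu i) _) (Real.rpow_nonneg (hw i).le _)
  · have h1 := Real.inner_le_weight_mul_Lp_of_nonneg s hp u (fun i => z i * (w i / u i) ^ (1 / p))
      hu (fun i => mul_nonneg (hz i) (Real.rpow_nonneg (div_nonneg (hw i).le (hu i)) _))
    rw [hu1, Real.one_rpow, one_mul] at h1
    refine le_trans (Finset.sum_le_sum fun i _ => ?_) (h1.trans ?_)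
    · dsimp only
      split_ifs with hi
      · rw [zero_mul]
        exact mul_nonneg (hu i) (mul_nonneg (hz i)
          (Real.rpow_nonneg (div_nonneg (hw i).le (hu i)) _))
      · have hui := hupos i hi
        rw [Real.div_rpow (hw i).le hui.le, Real.rpow_sub hui, Real.rpow_one]
        apply le_of_eq
        ring
    · rw [one_div]
      refine Real.rpow_le_rpow (Finset.sum_nonneg fun i _ => mul_nonneg (hu i)
        (Real.rpow_nonneg (mul_nonneg (hz i)
          (Real.rpow_nonneg (div_nonneg (hw i).le (hu i)) _)) _))
        (Finset.sum_le_sum fun i _ => ?_) (by positivity)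
      rw [Real.mul_rpow (hz i) (Real.rpow_nonneg (div_nonneg (hw i).le (hu i)) _),
        ← Real.rpow_mul (div_nonneg (hw i).le (hu i)), inv_mul_cancel₀ hp0.ne',
        Real.rpow_one, mul_left_comm]
      refine mul_le_mul_of_nonneg_left ?_ (Real.rpow_nonneg (hz i) _)
      by_cases h0 : u i = 0
      · rw [h0, zero_mul]; exact (hw i).le
      · rw [mul_div_cancel₀ _ h0]
  · have hDp : D / p = 1 - n * (1 - 1 / p) := by rw [hD]; field_simp; ring
    have key : ∀ i, a i * (if a i = 0 then 0 else u i ^ (1 - 1 / p) * w i ^ (1 / p)) ^ n =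
        a i ^ (p / D) * w i ^ (n / D) * A ^ (D / p - 1) := by
      intro i
      by_cases hi : a i = 0
      · rw [if_pos hi, hi, Real.zero_rpow (by positivity), zero_mul, zero_mul, zero_mul]
      · have hai := (ha i).lt_of_ne' hi
        have hwi := hw i
        rw [if_neg hi, ← Real.rpow_natCast, Real.mul_rpow (by positivity) (by positivity),
          ← Real.rpow_mul (hu i), ← Real.rpow_mul hwi.le]
        change a i * ((a i ^ (p / D) * w i ^ (n / D) / A) ^ ((1 - 1 / p) * n) *
          w i ^ (1 / p * n)) = _
        rw [Real.div_rpow (by positivity) hS.le, Real.mul_rpow (by positivity) (by positivity),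
          ← Real.rpow_mul hai.le, ← Real.rpow_mul hwi.le]
        have e1 : p / D = 1 + p / D * ((1 - 1 / p) * n) := by
          have : p = D + n * (p - 1) := by rw [hD]; ring
          field_simp
          linarith
        have e2 : (n : ℝ) / D = n / D * ((1 - 1 / p) * n) + 1 / p * n := by
          have : p = D + n * (p - 1) := by rw [hD]; ring
          field_simp
          linear_combination (n : ℝ) * this
        have e3 : D / p - 1 = -((1 - 1 / p) * n) := by rw [hDp]; ring
        rw [e3, Real.rpow_neg hS.le]
        conv_rhs => rw [e1, e2, Real.rpow_add hai, Real.rpow_add hwi, Real.rpow_one]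
        field_simp
    simp only [key]
    rw [← Finset.sum_mul, ← hA]
    nth_rewrite 1 [← Real.rpow_one A]
    rw [← Real.rpow_add hS]
    congr 1
    ring

/-- Abel summation: the difference of the sides combines the nonnegative differences of partial
sums, with the decrements and the last value of `z` as coefficients. -/
theorem sum_mul_le_of_partialSum_le (M : ℕ) (a d z : ℕ → ℝ) (hz0 : ∀ k, 0 ≤ z k)
    (hz : Antitone z) (h : ∀ m ≤ M, partialSum a m ≤ partialSum d m) :
    ∑ k ∈ Finset.range M, a k * z k ≤ ∑ k ∈ Finset.range M, d k * z k := by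
  have key : ∀ m, m + 1 ≤ M → z m * (partialSum d (m + 1) - partialSum a (m + 1)) ≤
      ∑ k ∈ Finset.range (m + 1), (d k * z k - a k * z k) := by
    intro m
    induction m with
    | zero => intro _; simp [partialSum]; linarith
    | succ m ih =>
      intro hm
      have h1 := ih (by omega)
      have h2 := sub_nonneg.2 (h (m + 1) (by omega))
      have h3 := mul_le_mul_of_nonneg_right (hz (Nat.le_succ m)) h2
      have h4 : ∀ f : ℕ → ℝ, partialSum f (m + 1 + 1) = partialSum f (m + 1) + f (m + 1) :=
        fun f => Finset.sum_range_succ _ _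
      rw [Finset.sum_range_succ, h4, h4]
      linarith
  rcases M with _ | M
  · simp
  · have h1 := key M le_rfl
    rw [Finset.sum_sub_distrib] at h1
    have h2 := mul_nonneg (hz0 M) (sub_nonneg.2 (h (M + 1) le_rfl))
    linarith

/-- Increments of a convex function increase: `x + h` and `y` are mirror convex combinations of `x`
and `y + h`, and the two convexity inequalities are added. -/
theorem rpow_add_sub_rpow_le {t x y h : ℝ} (ht : 1 ≤ t) (hx : 0 ≤ x) (hxy : x ≤ y) (hh : 0 ≤ h) :
    (x + h) ^ t - x ^ t ≤ (y + h) ^ t - y ^ t := by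
  rcases (add_nonneg hh (sub_nonneg.2 hxy)).eq_or_lt with h0 | hpos
  · have : y = x := by linarith
    rw [this]
  · have hc := convexOn_rpow ht
    set l := h / (h + (y - x))
    have hl0 : 0 ≤ l := by positivity
    have hl1 : l ≤ 1 := by rw [div_le_one hpos]; linarith
    have hyh : 0 ≤ y + h := by linarith
    have e : l * (h + (y - x)) = h := div_mul_cancel₀ _ hpos.ne'
    have h1 := hc.2 (Set.mem_Ici.2 hx) (Set.mem_Ici.2 hyh) (sub_nonneg.2 hl1) hl0 (sub_add_cancel 1 l)
    have h2 := hc.2 (Set.mem_Ici.2 hx) (Set.mem_Ici.2 hyh) hl0 (sub_nonneg.2 hl1) (add_sub_cancel l 1)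
    simp only [smul_eq_mul] at h1 h2
    have e1 : (1 - l) * x + l * (y + h) = x + h := by linarith
    have e2 : l * x + (1 - l) * (y + h) = y := by linarith
    rw [e1] at h1
    rw [e2] at h2
    linarith

/-- The embedding of a Lorentz quasi-norm of exponent `p / n ≤ 1`. -/
theorem sum_pow_mul_le {w : ℕ → ℝ} (hw : ∀ k, 0 ≤ w k) {n : ℕ} {p : ℝ} (hp : 0 < p)
    (hpn : p ≤ n) (b : ℕ → ℝ) (hb0 : ∀ k, 0 ≤ b k) (hb : Antitone b) (M : ℕ) :
    ∑ k ∈ Finset.range M,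
      (partialSum w (k + 1) ^ (n / p) - partialSum w k ^ (n / p)) * b k ^ n ≤
      (∑ k ∈ Finset.range M, b k ^ p * w k) ^ (n / p) := by
  have ht : 1 ≤ (n : ℝ) / p := by rwa [one_le_div hp]
  have hbp : ∀ k, 0 ≤ b k ^ p := fun k => Real.rpow_nonneg (hb0 k) p
  have hW : ∀ k, 0 ≤ partialSum w k := fun k => Finset.sum_nonneg fun i _ => hw i
  induction M with
  | zero => simp [Real.zero_rpow (by positivity : (n : ℝ) / p ≠ 0)]
  | succ M ih =>
    rw [Finset.sum_range_succ, Finset.sum_range_succ]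
    set S := ∑ k ∈ Finset.range M, b k ^ p * w k
    -- As `b` decreases, the sum so far dominates its analogue for the constant value `b M`. By
    -- convexity the new term raises the power at least as much at `S` as in the constant case,
    -- where the increment is explicit.
    have hS : b M ^ p * partialSum w M ≤ S := by
      rw [partialSum, Finset.mul_sum]
      exact Finset.sum_le_sum fun k hk => mul_le_mul_of_nonneg_right
        (Real.rpow_le_rpow (hb0 M) (hb (Finset.mem_range.1 hk).le) hp.le) (hw k)
    have h1 := rpow_add_sub_rpow_le ht (mul_nonneg (hbp M) (hW M)) hS
      (mul_nonneg (hbp M) (hw M))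
    have h2 : (b M ^ p) ^ ((n : ℝ) / p) = b M ^ n := by
      rw [← Real.rpow_mul (hb0 M), mul_div_cancel₀ _ hp.ne', Real.rpow_natCast]
    rw [← mul_add, Real.mul_rpow (hbp M) (add_nonneg (hW M) (hw M)),
      Real.mul_rpow (hbp M) (hW M), h2] at h1
    have h3 : partialSum w (M + 1) = partialSum w M + w M := Finset.sum_range_succ _ _
    rw [h3]
    linarith

/-! ### The unit balls that belong to Lorentz spaces and their duals -/

section Identify

variable {w : ℕ → ℝ} {p : ℝ} {n : ℕ}

theorem lorentz_isModel (hw : IsWeight w) (hp : 1 ≤ p) :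
    (lorentz w p hw hp).IsModel (lorentz w p hw hp).coord (unitVec w p hw hp) :=
  SeqNorm.isModel_sub fun _ => rfl

/-- Testing an element of the dual ball on nonnegative finite sequences. -/
theorem sum_mul_le_of_mem_dualBall (hw : IsWeight w) (hp : 1 ≤ p) {g : ℕ → ℂ}
    (hg : g ∈ dualBall (lorentz w p hw hp).coord) (F : Finset ℕ) (y : ℕ → ℝ) (hy : ∀ k, 0 ≤ y k)
    {C : ℝ} (hC : 0 ≤ C) (h : ∀ (π : Equiv.Perm ℕ) (K : Finset ℕ),
      ∑ k ∈ K with π k ∈ F, y (π k) ^ p * w k ≤ C ^ p) :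
    ∑ k ∈ F, ‖g k‖ * y k ≤ C := by
  have hp0 : 0 < p := by linarith
  have hm := lorentz_isModel hw hp
  let a : ℕ → ℂ := fun k => if k ∈ F then phase (g k) * y k else 0
  have ha : lorentzENorm w p a ≤ ENNReal.ofReal C := by
    rw [lorentzENorm_le_iff (fun k => (hw.pos k).le) hp0 hC]
    intro π K
    refine le_trans ?_ (h π K)
    rw [Finset.sum_filter]
    refine Finset.sum_le_sum fun k _ => ?_
    simp only [a]
    split_ifs
    · refine mul_le_mul_of_nonneg_right (Real.rpow_le_rpow (norm_nonneg _) ?_ hp0.le) (hw.pos k).le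
      rw [norm_mul, Complex.norm_of_nonneg (hy _)]
      exact mul_le_of_le_one_left (hy _) (norm_phase_le _)
    · simp [hp0.ne']
  have h1 := (hg F (∑ k ∈ F, a k • unitVec w p hw hp k)).trans
    (hm.norm_sum_le (lorentz_isFatou hw hp) F a hC ha)
  have h2 : ∑ k ∈ F, g k * (lorentz w p hw hp).coord (∑ k ∈ F, a k • unitVec w p hw hp k) k =
      ((∑ k ∈ F, ‖g k‖ * y k : ℝ) : ℂ) := by
    push_cast
    refine Finset.sum_congr rfl fun k hk => ?_
    rw [hm.coord_sum, if_pos hk, ← phase_mul]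
    simp only [a, if_pos hk]
    ring
  rw [h2, Complex.norm_of_nonneg
    (Finset.sum_nonneg fun k _ => mul_nonneg (norm_nonneg _) (hy k))] at h1
  exact h1

/-- Elements of the dual ball supported on an initial part of an enumeration. -/
theorem mem_dualBall_of_bound (hw : IsWeight w) (hp : 1 ≤ p) (π : Equiv.Perm ℕ) (K : Finset ℕ)
    (b : ℕ → ℝ) (hb0 : ∀ k, 0 ≤ b k)
    (hb : ∀ z : ℕ → ℝ, (∀ i, 0 ≤ z i) →
      ∑ i ∈ K, b i * z i ≤ (∑ i ∈ K, z i ^ p * w i) ^ (1 / p)) :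
    (fun k => if π.symm k ∈ K then (b (π.symm k) : ℂ) else 0) ∈
      dualBall (lorentz w p hw hp).coord := by
  have hp0 : 0 < p := by linarith
  intro F x
  have hx := (lorentzENorm_le_iff (fun k => (hw.pos k).le) hp0 (norm_nonneg x)).1
    ((lorentz_isModel hw hp).norm x).ge π K
  set X := (lorentz w p hw hp).coord x
  have h1 := hb (fun k => ‖X (π k)‖) fun k => norm_nonneg _
  have h2 : (∑ i ∈ K, ‖X (π i)‖ ^ p * w i) ^ (1 / p) ≤ ‖x‖ := by
    rw [one_div]
    exact (Real.rpow_inv_le_iff_of_pos (Finset.sum_nonneg fun k _ =>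
      mul_nonneg (Real.rpow_nonneg (norm_nonneg _) _) (hw.pos k).le) (norm_nonneg _) hp0).2 hx
  refine (norm_sum_le _ _).trans (le_trans ?_ (h1.trans h2))
  have h3 : ∑ k ∈ K, b k * ‖X (π k)‖ = ∑ k ∈ K.map π.toEmbedding, b (π.symm k) * ‖X k‖ := by
    rw [Finset.sum_map]
    exact Finset.sum_congr rfl fun k _ => by simp
  rw [h3]
  have h4 : ∀ k, ‖(if π.symm k ∈ K then (b (π.symm k) : ℂ) else 0) * X k‖ =
      if k ∈ K.map π.toEmbedding then b (π.symm k) * ‖X k‖ else 0 := by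
    intro k
    have : k ∈ K.map π.toEmbedding ↔ π.symm k ∈ K := by
      rw [Finset.mem_map_equiv]
    simp only [this]
    split_ifs
    · rw [norm_mul, Complex.norm_of_nonneg (hb0 _)]
    · simp
  simp only [h4]
  rw [← Finset.sum_filter]
  exact Finset.sum_le_sum_of_subset_of_nonneg (fun k hk => (Finset.mem_filter.1 hk).2)
    fun k _ _ => mul_nonneg (hb0 _) (norm_nonneg _)

/-- Closes the bootstrapping estimates below, where a sum is bounded by a smaller power of itself.
-/
theorem le_one_of_le_rpow {S t : ℝ} (ht : t < 1) (h : S ≤ S ^ t) : S ≤ 1 := by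
  by_contra! hS
  have := Real.rpow_lt_rpow_of_exponent_lt hS ht
  rw [Real.rpow_one] at this
  linarith

/-- For `x` in the Lorentz ball and S = ∑ |x||g|ⁿ, test `g` on |x||g|^{n-1}: by Hölder its norm in
d(w,p) is at most S^{(n-1)/n}, so S ≤ S^{(n-1)/n} and S ≤ 1. Conversely, the extremal sequence of
Hölder's inequality is a member of the dual ball that detects a Lorentz sum above `1`. -/
theorem powPolar_dualBall_lorentz (hw : IsWeight w) (hp : 1 ≤ p) (hn : 1 ≤ n) {D : ℝ}
    (hD : D = n - p * (n - 1)) (hD0 : 0 < D) :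
    powPolar n (dualBall (lorentz w p hw hp).coord) =
      {x | lorentzENorm (fun k => w k ^ (n / D)) (p / D) x ≤ 1} := by
  have hp0 : 0 < p := by linarith
  have hn0 : (0 : ℝ) < n := by positivity
  have hw0 : ∀ k, 0 ≤ w k := fun k => (hw.pos k).le
  have hv0 : ∀ k, 0 ≤ w k ^ (n / D) := fun k => Real.rpow_nonneg (hw0 k) _
  have hq0 : 0 < p / D := by positivity
  ext x
  rw [Set.mem_ofPred_eq, lorentzENorm_le_one_iff hv0 hq0]
  constructor
  · intro hx π K
    rcases (Finset.sum_nonneg fun k _ => mul_nonneg (Real.rpow_nonneg (norm_nonneg (x (π k))) _)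
      (hv0 k) : 0 ≤ ∑ k ∈ K, ‖x (π k)‖ ^ (p / D) * w k ^ (n / D)).eq_or_lt with h0 | hpos
    · rw [← h0]; exact zero_le_one
    · obtain ⟨b, hb0, hb, hbA⟩ := exists_extremal K hp hD hD0 (fun k => ‖x (π k)‖) w
        (fun k => norm_nonneg _) hw.pos hpos
      have h1 := hx _ (mem_dualBall_of_bound hw hp π K b hb0 hb) (K.map π.toEmbedding)
      rw [Finset.sum_map] at h1
      have h2 : ∑ k ∈ K, ‖x (π k)‖ * b k ^ n ≤ 1 := by
        refine le_trans (le_of_eq (Finset.sum_congr rfl fun k hk => ?_)) h1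
        simp [hk, abs_of_nonneg (hb0 k)]
      rw [hbA] at h2
      by_contra! hcon
      exact absurd (Real.one_lt_rpow hcon (by positivity : 0 < D / p)) (not_lt.2 h2)
  · intro hx g hg F
    set S := ∑ k ∈ F, ‖x k‖ * ‖g k‖ ^ n with hSdef
    have hS0 : 0 ≤ S := Finset.sum_nonneg fun k _ => by positivity
    have hθ0 : 0 ≤ p * ((n : ℝ) - 1) / n := by
      have : (1 : ℝ) ≤ n := by exact_mod_cast hn
      have : 0 ≤ (n : ℝ) - 1 := by linarith
      positivity
    have h1 := sum_mul_le_of_mem_dualBall hw hp hg F (fun k => ‖x k‖ * ‖g k‖ ^ (n - 1))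
      (fun k => by positivity) (C := S ^ (((n : ℝ) - 1) / n)) (by positivity) fun π K => by
        have h2 := sum_rpow_le_holder (K.filter fun k => π k ∈ F) hn hp hD hD0
          (fun k => ‖x (π k)‖) (fun k => ‖g (π k)‖) w (fun _ => norm_nonneg _)
          (fun _ => norm_nonneg _) hw0 (hx π _)
        refine h2.trans ?_
        rw [← Real.rpow_mul hS0, div_mul_eq_mul_div, mul_comm ((n : ℝ) - 1) p]
        refine Real.rpow_le_rpow (Finset.sum_nonneg fun k _ => by positivity) ?_ hθ0
        have h3 : ∑ k ∈ K with π k ∈ F, ‖x (π k)‖ * ‖g (π k)‖ ^ n =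
            ∑ k ∈ (K.filter fun k => π k ∈ F).map π.toEmbedding, ‖x k‖ * ‖g k‖ ^ n := by
          rw [Finset.sum_map]; rfl
        rw [h3]
        refine Finset.sum_le_sum_of_subset_of_nonneg (fun k hk => ?_) fun k _ _ => by positivity
        obtain ⟨j, hj, rfl⟩ := Finset.mem_map.1 hk
        exact (Finset.mem_filter.1 hj).2
    have h4 : ∑ k ∈ F, ‖g k‖ * (‖x k‖ * ‖g k‖ ^ (n - 1)) = S := by
      refine Finset.sum_congr rfl fun k _ => ?_
      rw [mul_left_comm, ← pow_succ', Nat.sub_add_cancel hn]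
    rw [h4] at h1
    refine le_one_of_le_rpow ?_ h1
    rw [div_lt_one hn0]
    linarith

/-- Here |g| ≤ 1 and n ≤ p(n-1) give |g|^{(n-1)p} ≤ |g|ⁿ. Testing `g` on |g|^{n-1} yields S ≤
S^{1/p} for S = ∑ |g|ⁿ, so the dual ball lies in the ball of ℓ_n. Unit vectors show that the polar
is no larger. -/
theorem powPolar_dualBall_lorentz_of_nonpos (hw : IsWeight w) (hp : 1 < p) (hn : 1 ≤ n)
    (hD : (n : ℝ) ≤ p * (n - 1)) :
    powPolar n (dualBall (lorentz w p hw hp.le).coord) = {x | ∀ k, ‖x k‖ ≤ 1} := by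
  have hp0 : 0 < p := by linarith
  have hw0 : ∀ k, 0 ≤ w k := fun k => (hw.pos k).le
  have hunc := (lorentz_isModel hw hp.le).isUncond (lorentz_isFatou hw hp.le)
  ext x
  constructor
  · intro hx k
    simpa using hx _ (hunc.single_mem_dualBall k) {k}
  · intro hx g hg F
    set S := ∑ k ∈ F, ‖g k‖ ^ n with hSdef
    have hS0 : 0 ≤ S := Finset.sum_nonneg fun k _ => by positivity
    have hg1 : ∀ k, ‖g k‖ ≤ 1 := fun k => by
      have := hg {k} (unitVec w p hw hp.le k)
      rwa [hunc.norm_eq, Finset.sum_singleton, hunc.coord, Pi.single_eq_same, mul_one] at this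
    have hxS : ∑ k ∈ F, ‖x k‖ * ‖g k‖ ^ n ≤ S :=
      Finset.sum_le_sum fun k _ => mul_le_of_le_one_left (by positivity) (hx k)
    refine hxS.trans ?_
    have h1 := sum_mul_le_of_mem_dualBall hw hp.le hg F (fun k => ‖g k‖ ^ (n - 1))
      (fun k => by positivity) (C := S ^ (1 / p)) (by positivity) fun π K => by
        rw [← Real.rpow_mul hS0, one_div, inv_mul_cancel₀ hp0.ne', Real.rpow_one]
        have h2 : ∀ k, (‖g (π k)‖ ^ (n - 1)) ^ p * w k ≤ ‖g (π k)‖ ^ n := by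
          intro k
          have hw1 : w k ≤ 1 := hw.one ▸ hw.anti (Nat.zero_le k)
          refine (mul_le_of_le_one_right (by positivity) hw1).trans ?_
          rw [← Real.rpow_natCast, ← Real.rpow_natCast, ← Real.rpow_mul (norm_nonneg _),
            Nat.cast_sub hn, Nat.cast_one]
          have hn0 : (0 : ℝ) < n := by positivity
          refine Real.rpow_le_rpow_of_exponent_ge' (norm_nonneg _) (hg1 _) hn0.le ?_
          linarith
        refine (Finset.sum_le_sum fun k _ => h2 k).trans ?_
        have h3 : ∑ k ∈ K with π k ∈ F, ‖g (π k)‖ ^ n =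
            ∑ k ∈ (K.filter fun k => π k ∈ F).map π.toEmbedding, ‖g k‖ ^ n := by
          rw [Finset.sum_map]; rfl
        rw [h3]
        refine Finset.sum_le_sum_of_subset_of_nonneg (fun k hk => ?_) fun k _ _ => by positivity
        obtain ⟨j, hj, rfl⟩ := Finset.mem_map.1 hk
        exact (Finset.mem_filter.1 hj).2
    have h4 : ∑ k ∈ F, ‖g k‖ * ‖g k‖ ^ (n - 1) = S := by
      refine Finset.sum_congr rfl fun k _ => ?_
      rw [← pow_succ', Nat.sub_add_cancel hn]
    rw [h4] at h1
    refine le_one_of_le_rpow ?_ h1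
    rw [div_lt_one hp0]
    exact hp

/-- After |g| is sorted, Abel summation replaces the values of |x| by the increments of CΨ, the
extremal sequence for the Marcinkiewicz bound; `sum_pow_mul_le` then bounds the result by the
Lorentz norm of `g`. -/
theorem sum_single_pow_le (hw : IsWeight w) (hp : 0 < p) (hn : p ≤ n) {x g : ℕ → ℂ}
    (hg : lorentzENorm w p g ≤ 1) {C : ℝ} (hC : 0 ≤ C)
    (hx : ∀ J : Finset ℕ, J.Nonempty → ∑ k ∈ J, ‖x k‖ ≤ C * partialSum w J.card ^ (n / p))
    (F : Finset ℕ) : ∑ k ∈ F, ‖x k‖ * ‖g k‖ ^ n ≤ C := by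
  have hw0 : ∀ k, 0 ≤ w k := fun k => (hw.pos k).le
  have hW : ∀ k, 0 ≤ partialSum w k := fun k => Finset.sum_nonneg fun i _ => hw0 i
  have hn0 : n ≠ 0 := by
    rintro rfl
    push_cast at hn
    linarith
  have ht : (n : ℝ) / p ≠ 0 := by positivity
  obtain ⟨π, hπ, hs⟩ := exists_perm_sorted (fun k => ‖g k‖) F.card F rfl
  let b : ℕ → ℝ := fun k => if k < F.card then ‖g (π k)‖ else 0
  have hb0 : ∀ k, 0 ≤ b k := fun k => by simp only [b]; split_ifs <;> simp
  have hb : Antitone b := fun i j hij => by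
    simp only [b]
    by_cases hj : j < F.card
    · rw [if_pos hj, if_pos (hij.trans_lt hj)]
      exact hs i j hij hj
    · rw [if_neg hj]
      exact hb0 i
  have h1 : ∑ k ∈ F, ‖x k‖ * ‖g k‖ ^ n = ∑ k ∈ Finset.range F.card, ‖x (π k)‖ * b k ^ n := by
    conv_lhs => rw [← hπ, Finset.sum_image fun i _ j _ h => π.injective h]
    refine Finset.sum_congr rfl fun k hk => ?_
    simp only [b, if_pos (Finset.mem_range.1 hk)]
  have h2 : ∀ m, partialSum (fun k => ‖x (π k)‖) m ≤
      partialSum (fun k => C * (partialSum w (k + 1) ^ (n / p) - partialSum w k ^ (n / p))) m := by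
    intro m
    have e1 : partialSum (fun k => C * (partialSum w (k + 1) ^ (n / p) -
        partialSum w k ^ (n / p))) m = C * partialSum w m ^ (n / p) := by
      rw [partialSum, ← Finset.mul_sum, Finset.sum_range_sub (fun k => partialSum w k ^ (n / p))]
      simp [partialSum, Real.zero_rpow ht]
    rw [e1]
    rcases Nat.eq_zero_or_pos m with rfl | hm
    · simp [partialSum, Real.zero_rpow ht]
    · have h3 := hx ((Finset.range m).map π.toEmbedding) (by
        simpa using hm.ne')
      rw [Finset.sum_map, Finset.card_map, Finset.card_range] at h3
      exact h3
  have h3 := sum_mul_le_of_partialSum_le F.card _ _ (fun k => b k ^ n)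
    (fun k => pow_nonneg (hb0 k) n) (fun i j hij => pow_le_pow_left₀ (hb0 j) (hb hij) n)
    fun m _ => h2 m
  rw [h1]
  refine h3.trans ?_
  simp only [mul_assoc]
  rw [← Finset.mul_sum]
  refine mul_le_of_le_one_right hC ((sum_pow_mul_le hw0 hp hn b hb0 hb F.card).trans ?_)
  refine Real.rpow_le_one (Finset.sum_nonneg fun k _ =>
    mul_nonneg (Real.rpow_nonneg (hb0 k) _) (hw0 k)) ?_ (by positivity)
  refine le_trans (le_of_eq (Finset.sum_congr rfl fun k hk => ?_))
    ((lorentzENorm_le_one_iff hw0 hp).1 hg π (Finset.range F.card))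
  simp only [b, if_pos (Finset.mem_range.1 hk)]

theorem isFundamental_partialSum (hw : IsWeight w) {t : ℝ} (ht : 0 < t) :
    IsFundamental fun N => partialSum w N ^ t where
  one := by simp [partialSum, hw.one]
  mono := fun i j hij => Real.rpow_le_rpow (Finset.sum_nonneg fun k _ => (hw.pos k).le)
    (partialSum_mono (fun k => (hw.pos k).le) hij) ht.le

/-- Normalized indicators of finite sets are enough as tests: they give exactly the inequalities
that define the Marcinkiewicz ball. -/
theorem powPolar_lorentz_ball (hw : IsWeight w) (hp : 0 < p) (hn : p ≤ n) :
    powPolar n {g | lorentzENorm w p g ≤ 1} =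
      {x | (marcinkiewicz fun N => partialSum w N ^ (n / p)).toFun x ≤ 1} := by
  have hw0 : ∀ k, 0 ≤ w k := fun k => (hw.pos k).le
  have hn0 : (0 : ℝ) < n := by linarith
  have hΨ := isFundamental_partialSum hw (t := n / p) (by positivity)
  ext x
  rw [Set.mem_ofPred_eq, marcinkiewicz_le_one_iff hΨ]
  constructor
  · intro hx J hJ
    have hW : 0 < partialSum w J.card :=
      Finset.sum_pos (fun k _ => hw.pos k) (by simpa using hJ.ne_empty)
    -- Normalizes the indicator of `J`: its Lorentz norm is reached when `J` fills the first
    -- `J.card` positions.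
    set c : ℝ := (partialSum w J.card)⁻¹ ^ (1 / p)
    have hc : 0 ≤ c := by positivity
    have hg : lorentzENorm w p (fun k => if k ∈ J then (c : ℂ) else 0) ≤ 1 := by
      rw [lorentzENorm_le_one_iff hw0 hp]
      intro π K
      have h1 : ∑ k ∈ K, ‖if π k ∈ J then (c : ℂ) else 0‖ ^ p * w k =
          (partialSum w J.card)⁻¹ * ∑ k ∈ K with π k ∈ J, w k := by
        rw [Finset.sum_filter, Finset.mul_sum]
        refine Finset.sum_congr rfl fun k _ => ?_
        split_ifs
        · rw [Complex.norm_of_nonneg hc, ← Real.rpow_mul (by positivity), one_div,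
            inv_mul_cancel₀ hp.ne', Real.rpow_one]
        · simp [hp.ne']
      rw [h1, inv_mul_le_one₀ hW]
      refine (sum_le_partialSum hw.anti _ _ rfl).trans (partialSum_mono hw0 ?_)
      rw [← Finset.card_map π.toEmbedding]
      refine Finset.card_le_card fun k hk => ?_
      obtain ⟨j, hj, rfl⟩ := Finset.mem_map.1 hk
      exact (Finset.mem_filter.1 hj).2
    have h2 := hx _ hg J
    have h3 : ∑ k ∈ J, ‖x k‖ * ‖if k ∈ J then (c : ℂ) else 0‖ ^ n = (∑ k ∈ J, ‖x k‖) * c ^ n := by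
      rw [Finset.sum_mul]
      refine Finset.sum_congr rfl fun k hk => ?_
      rw [if_pos hk, Complex.norm_of_nonneg hc]
    have h4 : c ^ n = (partialSum w J.card ^ (n / p))⁻¹ := by
      rw [← Real.rpow_natCast, ← Real.rpow_mul (by positivity), one_div, inv_mul_eq_div,
        Real.inv_rpow hW.le]
    rw [h3, h4, ← div_eq_mul_inv, div_le_one (by positivity)] at h2
    exact h2
  · intro hx g hg F
    exact sum_single_pow_le hw hp hn hg zero_le_one (fun J hJ => by simpa using hx J hJ) F

/-- The second Köthe dual of a Lorentz space. -/
theorem polarENorm_powPolar_lorentz_ball (hw : IsWeight w) (hn : 1 ≤ n) (hnp : (n : ℝ) ≤ p)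
    (α : ℕ → ℂ) :
    polarENorm (powPolar n {g | lorentzENorm w p g ≤ 1}) α = lorentzENorm w (p / n) α := by
  have hn0 : (0 : ℝ) < n := by positivity
  have hp0 : 0 < p := by linarith
  have hw0 : ∀ k, 0 ≤ w k := fun k => (hw.pos k).le
  have hr1 : 1 ≤ p / n := by rwa [one_le_div hn0]
  have hr0 : 0 < p / n := by positivity
  have hpow : ∀ a : ℝ, 0 ≤ a → (a ^ n) ^ (p / n) = a ^ p := fun a ha => by
    rw [← Real.rpow_natCast, ← Real.rpow_mul ha, mul_div_cancel₀ _ hn0.ne']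
  -- The case `n = 1`, `D = 1` of `exists_extremal`: ordinary duality in a weighted ℓ_r space with r
  -- = p/n.
  have hext : ∀ (s : Finset ℕ) (a v : ℕ → ℝ), (∀ i, 0 ≤ a i) → (∀ i, 0 < v i) →
      0 < ∑ i ∈ s, a i ^ (p / n) * v i → ∃ b : ℕ → ℝ, (∀ i, 0 ≤ b i) ∧
      (∀ z : ℕ → ℝ, (∀ i, 0 ≤ z i) →
        ∑ i ∈ s, b i * z i ≤ (∑ i ∈ s, z i ^ (p / n) * v i) ^ (1 / (p / n))) ∧
      ∑ i ∈ s, a i * b i = (∑ i ∈ s, a i ^ (p / n) * v i) ^ (1 / (p / n)) := by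
    intro s a v ha hv hpos
    have := exists_extremal (n := 1) (D := 1) s hr1 (by push_cast; ring) one_pos a v ha hv
      (by simpa using hpos)
    simpa using this
  refine le_antisymm ?_ ?_
  · by_cases htop : lorentzENorm w (p / n) α = ∞
    · rw [htop]; exact le_top
    set C := (lorentzENorm w (p / n) α).toReal with hCdef
    have hC0 : 0 ≤ C := ENNReal.toReal_nonneg
    have hCeq : lorentzENorm w (p / n) α = ENNReal.ofReal C := (ENNReal.ofReal_toReal htop).symm
    rw [hCeq]
    refine polarENorm_le_ofReal fun x hx F => ?_
    have hα := (lorentzENorm_le_iff hw0 hr0 hC0).1 hCeq.le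
    -- `‖α k‖ / t` is the `n`-th power of a member `g` of the Lorentz ball of exponent `p`; taking
    -- `t > C` avoids division by `0`.
    have hmem : ∀ t > C, ∑ k ∈ F, ‖α k * x k‖ ≤ t := by
      intro t ht
      have ht0 : 0 < t := by linarith
      let g : ℕ → ℂ := fun k => (((‖α k‖ / t) ^ ((1 : ℝ) / n) : ℝ) : ℂ)
      have hgn : ∀ k, ‖g k‖ = (‖α k‖ / t) ^ ((1 : ℝ) / n) := fun k =>
        Complex.norm_of_nonneg (by positivity)
      have hg : lorentzENorm w p g ≤ 1 := by
        rw [lorentzENorm_le_one_iff hw0 hp0]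
        intro π K
        have h1 : ∀ k, ‖g (π k)‖ ^ p * w k = (t ^ (p / n))⁻¹ * (‖α (π k)‖ ^ (p / n) * w k) := by
          intro k
          rw [hgn, ← Real.rpow_mul (by positivity), one_div_mul_eq_div,
            Real.div_rpow (norm_nonneg _) ht0.le]
          ring
        simp only [h1]
        rw [← Finset.mul_sum, inv_mul_le_one₀ (by positivity)]
        exact (hα π K).trans (Real.rpow_le_rpow hC0 ht.le hr0.le)
      have h2 := hx g hg F
      have h3 : ∀ k, ‖x k‖ * ‖g k‖ ^ n = t⁻¹ * ‖α k * x k‖ := fun k => by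
        rw [hgn, one_div, Real.rpow_inv_natCast_pow (by positivity) (by omega), norm_mul]
        ring
      simp only [h3] at h2
      rwa [← Finset.mul_sum, inv_mul_le_one₀ ht0] at h2
    exact le_of_forall_gt_imp_ge_of_dense hmem
  · by_cases htop : polarENorm (powPolar n {g | lorentzENorm w p g ≤ 1}) α = ∞
    · rw [htop]; exact le_top
    set C := (polarENorm (powPolar n {g | lorentzENorm w p g ≤ 1}) α).toReal with hCdef
    have hC0 : 0 ≤ C := ENNReal.toReal_nonneg
    have hCeq : polarENorm (powPolar n {g | lorentzENorm w p g ≤ 1}) α = ENNReal.ofReal C :=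
      (ENNReal.ofReal_toReal htop).symm
    rw [hCeq, lorentzENorm_le_iff hw0 hr0 hC0]
    intro π K
    rcases (Finset.sum_nonneg fun k _ => mul_nonneg (Real.rpow_nonneg (norm_nonneg (α (π k))) _)
      (hw0 k) : 0 ≤ ∑ k ∈ K, ‖α (π k)‖ ^ (p / n) * w k).eq_or_lt with h0 | hpos
    · rw [← h0]; positivity
    · obtain ⟨b, hb0, hb, hbA⟩ := hext K (fun k => ‖α (π k)‖) w (fun k => norm_nonneg _)
        hw.pos hpos
      -- The extremal vector, placed along `π`, lies in the polar and norms the chosen finite part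
      -- of `α`.
      let x : ℕ → ℂ := fun k => if π.symm k ∈ K then (b (π.symm k) : ℂ) else 0
      have hxn : ∀ k ∈ K, ‖x (π k)‖ = b k := fun k hk => by
        simp only [x, Equiv.symm_apply_apply, if_pos hk]
        exact Complex.norm_of_nonneg (hb0 k)
      have hx : x ∈ powPolar n {g | lorentzENorm w p g ≤ 1} := by
        intro g hg F
        have h1 := hb (fun k => ‖g (π k)‖ ^ n) fun k => by positivity
        simp only [hpow _ (norm_nonneg _)] at h1
        have h2 := (lorentzENorm_le_one_iff hw0 hp0).1 hg π K
        have h3 : ∑ k ∈ K, b k * ‖g (π k)‖ ^ n ≤ 1 := h1.trans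
          (Real.rpow_le_one (Finset.sum_nonneg fun k _ =>
            mul_nonneg (Real.rpow_nonneg (norm_nonneg _) _) (hw0 k)) h2 (by positivity))
        have h4 : ∑ k ∈ K, b k * ‖g (π k)‖ ^ n =
            ∑ k ∈ K.map π.toEmbedding, ‖x k‖ * ‖g k‖ ^ n := by
          rw [Finset.sum_map]
          exact Finset.sum_congr rfl fun k hk => by rw [Equiv.coe_toEmbedding, hxn k hk]
        rw [h4] at h3
        have hx0 : ∀ k, k ∉ K.map π.toEmbedding → x k = 0 := fun k hk => by
          rw [Finset.mem_map_equiv] at hk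
          simp [x, hk]
        rw [← Finset.sum_inter_add_sum_sdiff F (K.map π.toEmbedding),
          Finset.sum_eq_zero (s := F \ _) fun k hk => by simp [hx0 k (Finset.mem_sdiff.1 hk).2],
          add_zero]
        exact (Finset.sum_le_sum_of_subset_of_nonneg Finset.inter_subset_right
          fun _ _ _ => by positivity).trans h3
      have h5 := sum_le_of_polarENorm_le hC0 hCeq.le hx (K.map π.toEmbedding)
      rw [Finset.sum_map] at h5
      have h6 : ∑ k ∈ K, ‖α (π k)‖ * b k ≤ C := by
        refine le_trans (le_of_eq (Finset.sum_congr rfl fun k hk => ?_)) h5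
        rw [Equiv.coe_toEmbedding, norm_mul, hxn k hk]
      rw [hbA, one_div] at h6
      exact (Real.rpow_inv_le_iff_of_pos hpos.le hC0 hr0).1 h6

end Identify

/-! ### Dual spaces and preduals -/

section Dual

variable {E : Type} [NormedAddCommGroup E] [NormedSpace ℂ E] {c : E →ₗ[ℂ] ℕ → ℂ} {e : ℕ → E}

/-- The coordinates of functionals. -/
def dualCoordMap (e : ℕ → E) : StrongDual ℂ E →ₗ[ℂ] ℕ → ℂ where
  toFun φ k := φ (e k)
  map_add' _ _ := rfl
  map_smul' _ _ := rfl

/-- The coordinate functionals form the dual system, and contractions transpose. Hence the general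
formula applies to the dual space, with no density of the system required. -/
theorem IsUncond.exists_dual (h : IsUncond c e) :
    ∃ e' : ℕ → StrongDual ℂ E, IsUncond (dualCoordMap e) e' := by
  choose e' he1 he' using fun j : ℕ => exists_functional (h.single_mem_dualBall j) {j}
  simp only [Finset.sum_singleton, Pi.single_eq_same, one_mul] at he'
  have hcoord : ∀ j, dualCoordMap e (e' j) = Pi.single j 1 := fun j => by
    funext k
    change e' j (e k) = _
    rw [he', h.coord, Pi.single_comm]
  refine ⟨e', hcoord, fun j => le_antisymm (he1 j) ?_, fun F t ht φ => ?_⟩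
  · have h1 := (e' j).le_opNorm (e j)
    rw [he', h.coord, Pi.single_eq_same, norm_one, h.norm_eq, mul_one] at h1
    exact h1
  · refine ContinuousLinearMap.opNorm_le_bound _ (norm_nonneg _) fun x => ?_
    have h1 : (∑ k ∈ F, (t k * dualCoordMap e φ k) • e' k) x =
        φ (∑ k ∈ F, (t k * c x k) • e k) := by
      rw [map_sum, sum_apply]
      refine Finset.sum_congr rfl fun k _ => ?_
      rw [smul_apply, he', map_smul, smul_eq_mul, smul_eq_mul]
      change t k * φ (e k) * c x k = _
      ring
    rw [h1]
    exact (φ.le_opNorm _).trans (mul_le_mul_of_nonneg_left (h.contract F t ht x) (norm_nonneg _))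

/-- If `g` is bounded against all functionals, its sections have norm at most one by Hahn-Banach,
and the Fatou property passes to `g`. Reflexivity plays no role. -/
theorem SeqNorm.IsModel.dualBall_dualCoordMap {ρ : SeqNorm} (hρ : ρ.IsFatou)
    (hm : ρ.IsModel c e) : dualBall (dualCoordMap e) = {g | ρ.toFun g ≤ 1} := by
  have key : ∀ (g : ℕ → ℂ) (F : Finset ℕ) (φ : StrongDual ℂ E),
      ∑ k ∈ F, g k * dualCoordMap e φ k = φ (∑ k ∈ F, g k • e k) := fun g F φ => by
    simp only [map_sum, map_smul, smul_eq_mul]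
    rfl
  ext g
  constructor
  · intro hg
    change ρ.toFun g ≤ 1
    rw [← ENNReal.ofReal_one]
    refine hρ.lsc (fun m => c (∑ k ∈ Finset.range m, g k • e k)) g 1 zero_le_one (fun k => ?_)
      fun m => ?_
    · refine tendsto_const_nhds.congr' ((eventually_gt_atTop k).mono fun m hmk => ?_)
      dsimp only
      rw [hm.coord_sum, if_pos (Finset.mem_range.2 hmk)]
    · rw [← hm.norm]
      refine ENNReal.ofReal_le_ofReal (NormedSpace.norm_le_dual_bound ℂ _ zero_le_one fun φ => ?_)
      rw [← key, one_mul]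
      exact hg _ φ
  · intro hg F φ
    rw [key]
    refine (φ.le_opNorm _).trans (mul_le_of_le_one_right (norm_nonneg _) ?_)
    exact hm.norm_sum_le hρ F g zero_le_one (by rw [ENNReal.ofReal_one]; exact hg)

end Dual

theorem SeqNorm.IsFatou.single_mem_orderContinuous {ρ : SeqNorm} (hρ : ρ.IsFatou) (x : ρ.Space)
    {j : ℕ} (hx : ρ.coord x = Pi.single j 1) : x ∈ ρ.orderContinuous := by
  intro y hy h0 hanti hlim
  have h1 : ∀ i, (fun k => (y i k : ℂ)) = (y i j : ℂ) • (Pi.single j 1 : ℕ → ℂ) := by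
    intro i
    funext k
    rw [Pi.smul_apply, Pi.single_apply]
    split_ifs with hk
    · simp [hk]
    · have h2 := (hanti (Nat.zero_le i) k).trans (h0 k)
      rw [hx, Pi.single_eq_of_ne hk, norm_zero] at h2
      simp [le_antisymm h2 (hy i k)]
  simp only [h1, ρ.smul, hρ.single, mul_one]
  have h2 := (Complex.continuous_ofReal.tendsto 0).comp (hlim j)
  have h3 := h2.enorm
  simpa using h3

/-- The tails of |x| are themselves a sequence that decreases to `0` below |x|. -/
theorem SeqNorm.IsFatou.tail_orderContinuous {ρ : SeqNorm} (hρ : ρ.IsFatou)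
    (x : ρ.orderContinuous) :
    Tendsto (fun m => ρ.toFun (tail m (ρ.coord x))) atTop (𝓝 0) := by
  have h1 := x.2 (fun m k => if m ≤ k then ‖ρ.coord x k‖ else 0)
    (fun m k => by split_ifs <;> simp) (fun k => by simp)
    (fun i j hij k => by
      dsimp only
      split_ifs with h1 h2
      · exact le_rfl
      · omega
      · exact norm_nonneg _
      · exact le_rfl)
    (fun k => tendsto_const_nhds.congr' ((eventually_gt_atTop k).mono fun m hm => by
      dsimp only
      rw [if_neg (not_le.2 hm)]))
  refine tendsto_of_tendsto_of_tendsto_of_le_of_le tendsto_const_nhds h1 (fun _ => zero_le)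
    fun m => hρ.solid _ _ fun k => ?_
  unfold tail
  split_ifs <;> simp

theorem SeqNorm.IsFatou.exists_isModel_orderContinuous {ρ : SeqNorm} (hρ : ρ.IsFatou) :
    ∃ e, ρ.IsModel (ρ.coord.comp ρ.orderContinuous.subtype) e := by
  have h : ∀ j, ∃ x : ρ.orderContinuous, ρ.coord (x : ρ.Space) = Pi.single j 1 := fun j => by
    obtain ⟨x, hx⟩ : ∃ x : ρ.Space, ρ.coord x = Pi.single j 1 :=
      ⟨⟨Pi.single j 1, (hρ.single j).trans_lt ENNReal.one_lt_top⟩, rfl⟩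
    exact ⟨⟨x, hρ.single_mem_orderContinuous x hx⟩, hx⟩
  choose e he using h
  exact ⟨e, SeqNorm.isModel_submodule _ he⟩

theorem orderContinuous_isBanachDual {ρ : SeqNorm} (hρ : ρ.IsFatou) :
    IsBanachDual (ρ.coord.comp ρ.orderContinuous.subtype)
      (seqSpaceOf (polarENorm {x | ρ.toFun x ≤ 1})) := by
  obtain ⟨e, hm⟩ := hρ.exists_isModel_orderContinuous
  have h := hm.isBanachDual hρ
  apply h
  intro x
  exact hρ.tail_orderContinuous x

/-! ### The predual of d(w,1), and the identifications for Lorentz spaces -/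

section Lorentz

variable {w : ℕ → ℝ}

theorem isFundamental_partialSum_one (hw : IsWeight w) : IsFundamental (partialSum w) where
  one := by simp [partialSum, hw.one]
  mono := partialSum_mono fun k => (hw.pos k).le

theorem IsLorentzWeight.tendsto_partialSum (hw : IsLorentzWeight w) :
    Tendsto (partialSum w) atTop atTop :=
  (not_summable_iff_tendsto_nat_atTop_of_nonneg fun k => (hw.pos k).le).1 hw.not_summable

theorem single_mem_lorentzPredual (hw : IsLorentzWeight w)
    (x : (marcinkiewicz (partialSum w)).Space) {j : ℕ}
    (hx : (marcinkiewicz (partialSum w)).coord x = Pi.single j 1) : x ∈ lorentzPredual w := by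
  refine ⟨?_, ?_⟩
  · rw [hx]
    exact tendsto_const_nhds.congr' ((eventually_gt_atTop j).mono fun k hk =>
      (Pi.single_eq_of_ne (M := fun _ => ℂ) hk.ne' 1).symm)
  · rw [hx]
    have h1 : Tendsto (fun N => (ENNReal.ofReal (partialSum w N))⁻¹) atTop (𝓝 0) := by
      rw [← ENNReal.inv_top, tendsto_inv_iff]
      exact ENNReal.tendsto_ofReal_atTop.comp hw.tendsto_partialSum
    refine tendsto_of_tendsto_of_tendsto_of_le_of_le tendsto_const_nhds h1 (fun _ => zero_le)
      fun N => ?_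
    dsimp only
    rw [div_eq_mul_inv]
    refine mul_le_of_le_one_left zero_le ?_
    rw [rearrSum_eq]
    refine iSup₂_le fun J _ => ?_
    have : ∀ k ∈ J, ‖(Pi.single j 1 : ℕ → ℂ) k‖ₑ = if k = j then 1 else 0 := fun k _ => by
      rw [Pi.single_apply]; split_ifs <;> simp
    rw [Finset.sum_congr rfl this, Finset.sum_ite_eq']
    split_ifs <;> simp

theorem exists_isModel_lorentzPredual (hw : IsLorentzWeight w) :
    ∃ e, (marcinkiewicz (partialSum w)).IsModel
      ((marcinkiewicz (partialSum w)).coord.comp (lorentzPredual w).subtype) e := by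
  have hρ := marcinkiewicz_isFatou (isFundamental_partialSum_one hw.toIsWeight)
  let e₀ : ℕ → (marcinkiewicz (partialSum w)).Space := fun j =>
    ⟨Pi.single j 1, (hρ.single j).trans_lt ENNReal.one_lt_top⟩
  exact ⟨fun j => ⟨e₀ j, single_mem_lorentzPredual hw (e₀ j) rfl⟩,
    SeqNorm.isModel_submodule _ fun _ => rfl⟩

/-- A finite vector that carries the weights along a permutation, with suitable phases, lies in the
Marcinkiewicz ball, and `g` takes on it the value of a Lorentz sum. The converse is
`sum_single_pow_le` with `n = 1` and `p = 1`. -/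
theorem dualBall_lorentzPredual (hw : IsLorentzWeight w) :
    dualBall ((marcinkiewicz (partialSum w)).coord.comp (lorentzPredual w).subtype) =
      {g | lorentzENorm w 1 g ≤ 1} := by
  have hΨ := isFundamental_partialSum_one hw.toIsWeight
  have hρ := marcinkiewicz_isFatou hΨ
  have hw0 : ∀ k, 0 ≤ w k := fun k => (hw.pos k).le
  obtain ⟨e, hm⟩ := exists_isModel_lorentzPredual hw
  set c := (marcinkiewicz (partialSum w)).coord.comp (lorentzPredual w).subtype
  ext g
  constructor
  · intro hg
    change lorentzENorm w 1 g ≤ 1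
    rw [lorentzENorm_le_one_iff hw0 one_pos]
    intro π K
    let a : ℕ → ℂ := fun k => if π.symm k ∈ K then phase (g k) * w (π.symm k) else 0
    have ha : (marcinkiewicz (partialSum w)).toFun a ≤ 1 := by
      rw [marcinkiewicz_le_one_iff hΨ]
      intro J _
      have h1 : ∑ k ∈ J, ‖a k‖ ≤ ∑ k ∈ J with π.symm k ∈ K, w (π.symm k) := by
        rw [Finset.sum_filter]
        refine Finset.sum_le_sum fun k _ => ?_
        simp only [a]
        split_ifs
        · rw [norm_mul, Complex.norm_of_nonneg (hw0 _)]
          exact mul_le_of_le_one_left (hw0 _) (norm_phase_le _)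
        · simp
      have h2 : ∑ k ∈ J with π.symm k ∈ K, w (π.symm k) =
          ∑ k ∈ (J.filter fun k => π.symm k ∈ K).map π.symm.toEmbedding, w k := by
        rw [Finset.sum_map]; rfl
      refine h1.trans (h2.trans_le ((sum_le_partialSum hw.anti _ _ rfl).trans
        (partialSum_mono hw0 ?_)))
      rw [Finset.card_map]
      exact Finset.card_le_card (Finset.filter_subset _ _)
    have h3 := (hg (K.map π.toEmbedding) (∑ k ∈ K.map π.toEmbedding, a k • e k)).trans
      (hm.norm_sum_le hρ _ a zero_le_one (by rwa [ENNReal.ofReal_one]))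
    have h4 : ∑ k ∈ K.map π.toEmbedding, g k * c (∑ k ∈ K.map π.toEmbedding, a k • e k) k =
        ((∑ k ∈ K, ‖g (π k)‖ ^ (1 : ℝ) * w k : ℝ) : ℂ) := by
      rw [Finset.sum_congr rfl fun k hk => by rw [hm.coord_sum, if_pos hk], Finset.sum_map]
      push_cast
      refine Finset.sum_congr rfl fun k hk => ?_
      simp only [a, Equiv.coe_toEmbedding, Equiv.symm_apply_apply, if_pos hk, Real.rpow_one]
      rw [← phase_mul]
      ring
    rw [h4, Complex.norm_of_nonneg (Finset.sum_nonneg fun k _ =>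
      mul_nonneg (Real.rpow_nonneg (norm_nonneg _) _) (hw0 k))] at h3
    exact h3
  · intro hg F x
    have hx := (marcinkiewicz_le_iff hΨ (norm_nonneg x)).1 (hm.norm x).ge
    have h1 := sum_single_pow_le (n := 1) hw.toIsWeight one_pos (by simp) hg (norm_nonneg x)
      (fun J hJ => by simpa using hx J hJ) F
    refine (norm_sum_le _ _).trans (le_trans (le_of_eq ?_) h1)
    exact Finset.sum_congr rfl fun k _ => by rw [norm_mul, pow_one, mul_comm]

/-- Divergence of ∑ v makes the sections of every element converge, so functionals are determined by
their coordinates. -/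
theorem lorentz_isBanachDual {v : ℕ → ℝ} {q : ℝ} (hv : IsWeight v) (hq : 1 ≤ q)
    (hns : ¬ Summable v) {S : SeqSpace} (hS : S.IsoEq (kotheDual (lorentzENorm v q))) :
    IsBanachDual (lorentz v q hv hq).coord S :=
  ((lorentz_isModel hv hq).isBanachDual (lorentz_isFatou hv hq) fun x =>
    lorentz_tail hv hns hq ((lorentz v q hv hq).coord_lt_top x)).congr
      (hS.trans (lorentz_isFatou hv hq).kotheDual_isoEq).symm

theorem diagIntegral_lorentz_isoEq {p : ℝ} (hw : IsWeight w) (hp : 1 ≤ p) {n : ℕ} (hn : 1 ≤ n)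
    {v : ℕ → ℝ} {q : ℝ} (hv : IsWeight v) (hq : 1 ≤ q) {D : ℝ} (hD : D = n - p * (n - 1))
    (hD0 : 0 < D) (hvD : ∀ k, v k = w k ^ (n / D)) (hqD : q = p / D) :
    (diagIntegral n (lorentz w p hw hp).coord).IsoEq (kotheDual (lorentzENorm v q)) := by
  have h1 := ((lorentz_isModel hw hp).isUncond (lorentz_isFatou hw hp)).diagIntegral_isoEq hn
  rw [powPolar_dualBall_lorentz hw hp hn hD hD0, ← hqD, ← funext hvD] at h1
  exact h1.trans (lorentz_isFatou hv hq).kotheDual_isoEq.symm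

theorem supBall_isoEq_ellOne :
    (seqSpaceOf (polarENorm {x | ∀ k, ‖x k‖ ≤ 1})).IsoEq ellOne := by
  have h0 : ∀ α : ℕ → ℂ, ∑' k, ‖α k‖ₑ < ∞ ↔ Summable fun k => ‖α k‖ := by
    intro α
    constructor
    · intro h
      simpa only [toReal_enorm] using ENNReal.summable_toReal h.ne
    · intro h
      simpa only [ofReal_norm] using h.tsum_ofReal_lt_top
  refine ⟨?_, fun α _ => ?_⟩
  · ext α
    change polarENorm _ α < ∞ ↔ _
    rw [polarENorm_supBall]
    exact h0 α
  · change (polarENorm _ α).toReal = ∑' k, ‖α k‖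
    rw [polarENorm_supBall, ENNReal.tsum_toReal_eq fun _ => enorm_ne_top]
    simp only [toReal_enorm]

/-- For `n ≤ p` the polar norm is a Lorentz norm with a divergent weight; for `p < n` it is the dual
norm of m_Ψ with Ψ → ∞. -/
theorem lorentz_ball_polar_tail {p : ℝ} (hw : IsLorentzWeight w) (hp : 0 < p) {n : ℕ}
    (hn : 1 ≤ n) {α : ℕ → ℂ}
    (hα : polarENorm (powPolar n {g | lorentzENorm w p g ≤ 1}) α < ∞) :
    Tendsto (fun m => polarENorm (powPolar n {g | lorentzENorm w p g ≤ 1}) (tail m α)) atTop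
      (𝓝 0) := by
  rcases le_or_gt (n : ℝ) p with hnp | hnp
  · simp only [polarENorm_powPolar_lorentz_ball hw.toIsWeight hn hnp] at hα ⊢
    have hn0 : (0 : ℝ) < n := by positivity
    exact lorentz_tail hw.toIsWeight hw.not_summable (by rwa [one_le_div hn0]) hα
  · rw [powPolar_lorentz_ball hw.toIsWeight hp hnp.le] at hα ⊢
    have hn0 : (0 : ℝ) < n := by positivity
    have ht : 0 < (n : ℝ) / p := by positivity
    exact marcinkiewicz_polar_tail (isFundamental_partialSum hw.toIsWeight ht)
      ((tendsto_rpow_atTop ht).comp hw.tendsto_partialSum) hα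

theorem exists_isUncond_dualCoord {p : ℝ} (hw : IsWeight w) (hp : 1 ≤ p) :
    ∃ e, IsUncond (dualCoordMap (unitVec w p hw hp)) e :=
  ((lorentz_isModel hw hp).isUncond (lorentz_isFatou hw hp)).exists_dual

theorem diagIntegral_dualCoord_isoEq {p : ℝ} (hw : IsWeight w) (hp : 1 ≤ p) {n : ℕ} (hn : 1 ≤ n) :
    (diagIntegral n (dualCoord w p hw hp)).IsoEq
      (seqSpaceOf (polarENorm (powPolar n {g | lorentzENorm w p g ≤ 1}))) := by
  obtain ⟨e, he⟩ := exists_isUncond_dualCoord hw hp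
  have h1 := he.diagIntegral_isoEq hn
  rw [(lorentz_isModel hw hp).dualBall_dualCoordMap (lorentz_isFatou hw hp)] at h1
  exact h1

theorem diagNuclear_dualCoord_isoEq {p : ℝ} (hw : IsLorentzWeight w) (hp : 1 ≤ p) {n : ℕ}
    (hn : 1 ≤ n) : (diagNuclear n (dualCoord w p hw.toIsWeight hp)).IsoEq
      (seqSpaceOf (polarENorm (powPolar n {g | lorentzENorm w p g ≤ 1}))) := by
  obtain ⟨e, he⟩ := exists_isUncond_dualCoord hw.toIsWeight hp
  have h1 := he.diagNuclear_isoEq hn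
  rw [(lorentz_isModel hw.toIsWeight hp).dualBall_dualCoordMap
    (lorentz_isFatou hw.toIsWeight hp)] at h1
  exact h1 fun α hα => lorentz_ball_polar_tail hw (by linarith) hn hα

/-- The polar norm is that of ℓ₁ or of the dual of a Lorentz space with exponent p/D. The strict
inequality p/D > 1, needed for the gliding hump, is where `1 < p` enters. -/
theorem diagNuclear_lorentz_isoEq {p : ℝ} (hw : IsWeight w) (hp : 1 < p) {n : ℕ} (hn : 1 ≤ n) :
    (diagNuclear n (lorentz w p hw hp.le).coord).IsoEq
      (diagIntegral n (lorentz w p hw hp.le).coord) := by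
  have hunc := (lorentz_isModel hw hp.le).isUncond (lorentz_isFatou hw hp.le)
  refine (hunc.diagNuclear_isoEq hn fun α hα => ?_).trans (hunc.diagIntegral_isoEq hn).symm
  have hn1 : (1 : ℝ) ≤ n := by exact_mod_cast hn
  rcases le_or_gt ((n : ℝ) - p * (n - 1)) 0 with hD | hD
  · rw [powPolar_dualBall_lorentz_of_nonpos hw hp hn (by linarith)] at hα ⊢
    exact supBall_polar_tail hα
  · rw [powPolar_dualBall_lorentz hw hp.le hn rfl hD] at hα ⊢
    refine lorentz_polar_tail (hw.rpow (by positivity)) ?_ hα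
    rw [one_lt_div hD]
    nlinarith

end Lorentz

end

end LorentzForms

/-! ### Assembly of the cases -/

theorem mainTheorem7 (w : ℕ → ℝ) (hw : IsLorentzWeight w) (n : ℕ) (hn : 1 ≤ n)
    (p : ℝ) (hp : 1 ≤ p) :
    -- integral diagonal forms on `d(w, p)`: the case `p = 1`
    (p = 1 →
      (diagIntegral n (lorentz w p hw.toIsWeight hp).coord).IsoEq
          (kotheDual (lorentzENorm (fun k => w k ^ n) 1)) ∧
        ((¬ Summable fun k => w k ^ n) →
          IsBanachDual (lorentz (fun k => w k ^ n) 1 (hw.toIsWeight.pow n) le_rfl).coord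
            (diagIntegral n (lorentz w p hw.toIsWeight hp).coord))) ∧
    -- the case `1 < p < n'`, for `n ≥ 2`
    (∀ (h2 : 2 ≤ n) (h1p : 1 < p) (hpn : p < conjExp n),
      (diagIntegral n (lorentz w p hw.toIsWeight hp).coord).IsoEq
          (kotheDual (lorentzENorm (fun k => w k ^ (conjExp n / (conjExp n - p)))
            (conjExp p / (conjExp p - n)))) ∧
        ((¬ Summable fun k => w k ^ (conjExp n / (conjExp n - p))) →
          IsBanachDual (lorentz (fun k => w k ^ (conjExp n / (conjExp n - p)))
              (conjExp p / (conjExp p - n))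
              (hw.toIsWeight.rpow (weightExp_nonneg h2 hpn))
              (one_le_lorentzExp h2 h1p hpn)).coord
            (diagIntegral n (lorentz w p hw.toIsWeight hp).coord))) ∧
    -- the case `1 < p < n' = ∞`, for `n = 1`
    (n = 1 → 1 < p →
      (diagIntegral n (lorentz w p hw.toIsWeight hp).coord).IsoEq
          (kotheDual (lorentzENorm w p)) ∧
        IsBanachDual (lorentz w p hw.toIsWeight hp).coord
          (diagIntegral n (lorentz w p hw.toIsWeight hp).coord)) ∧
    -- the case `n' ≤ p`
    (2 ≤ n → conjExp n ≤ p →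
      (diagIntegral n (lorentz w p hw.toIsWeight hp).coord).IsoEq ellOne) ∧
    -- integral diagonal forms on `d(w, p)*`: the case `p < n`, with `Ψ(N) = (∑_{k ≤ N} w(k))^{n/p}`
    (p < n →
      (diagIntegral n (dualCoord w p hw.toIsWeight hp)).IsoEq
          (kotheDual (marcinkiewicz fun N => partialSum w N ^ (n / p)).toFun) ∧
        IsBanachDual
          (fun x : (marcinkiewicz fun N => partialSum w N ^ (n / p)).orderContinuous =>
            (marcinkiewicz fun N => partialSum w N ^ (n / p)).coord x)
          (diagIntegral n (dualCoord w p hw.toIsWeight hp))) ∧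
    -- the case `n ≤ p`
    ((n : ℝ) ≤ p →
      (diagIntegral n (dualCoord w p hw.toIsWeight hp)).IsoEq
        (seqSpaceOf (lorentzENorm w (p / n)))) ∧
    -- nuclear diagonal forms: the reflexive case
    (1 < p →
      (diagNuclear n (lorentz w p hw.toIsWeight hp).coord).IsoEq
          (diagIntegral n (lorentz w p hw.toIsWeight hp).coord) ∧
        (diagNuclear n (dualCoord w p hw.toIsWeight hp)).IsoEq
          (diagIntegral n (dualCoord w p hw.toIsWeight hp))) ∧
    -- nuclear diagonal forms: the space `d_*(w, 1)`, whose dual is separable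
    ((diagNuclear n fun x : lorentzPredual w => (marcinkiewicz (partialSum w)).coord x).IsoEq
          (diagIntegral n fun x : lorentzPredual w => (marcinkiewicz (partialSum w)).coord x) ∧
        (diagIntegral n fun x : lorentzPredual w => (marcinkiewicz (partialSum w)).coord x).IsoEq
          (diagIntegral n (dualCoord w 1 hw.toIsWeight le_rfl))) := by
  have hw1 := hw.toIsWeight
  have hn1 : (1 : ℝ) ≤ n := by exact_mod_cast hn
  have hn0 : (0 : ℝ) < n := by linarith
  refine ⟨?_, ?_, ?_, ?_, ?_, ?_, ?_, ?_⟩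
  · rintro rfl
    have h1 := diagIntegral_lorentz_isoEq hw1 hp hn (hw1.pow n) le_rfl (D := 1) (by ring) one_pos
      (fun k => by rw [div_one, Real.rpow_natCast]) (by rw [div_one])
    exact ⟨h1, fun hns => lorentz_isBanachDual (hw1.pow n) le_rfl hns h1⟩
  · intro h2 h1p hpn
    have hn2 : (2 : ℝ) ≤ n := by exact_mod_cast h2
    have hD0 : 0 < (n : ℝ) - p * (n - 1) := by
      rw [conjExp, lt_div_iff₀ (by linarith)] at hpn
      linarith
    have hp1 : p - 1 ≠ 0 := by linarith
    have hn1' : (n : ℝ) - 1 ≠ 0 := by linarith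
    -- Clearing denominators in both conjugate exponents leaves the same denominator D = n - p(n-1).
    have e1 : conjExp n / (conjExp n - p) = n / (n - p * (n - 1)) := by
      have : conjExp n - p = (n - p * (n - 1)) / (n - 1) := by
        rw [conjExp]; field_simp
      rw [this, conjExp, div_div_div_cancel_right₀ hn1']
    have e2 : conjExp p / (conjExp p - n) = p / (n - p * (n - 1)) := by
      have : conjExp p - n = (n - p * (n - 1)) / (p - 1) := by
        rw [conjExp]; field_simp; ring
      rw [this, conjExp, div_div_div_cancel_right₀ hp1]
    have h1 := diagIntegral_lorentz_isoEq hw1 hp hn (hw1.rpow (weightExp_nonneg h2 hpn))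
      (one_le_lorentzExp h2 h1p hpn) rfl hD0 (fun k => by rw [e1]) e2
    exact ⟨h1, fun hns => lorentz_isBanachDual _ _ hns h1⟩
  · rintro rfl h1p
    have h1 := diagIntegral_lorentz_isoEq hw1 hp hn hw1 hp (D := 1) (by push_cast; ring) one_pos
      (fun k => by simp) (by rw [div_one])
    exact ⟨h1, lorentz_isBanachDual hw1 hp hw.not_summable h1⟩
  · intro h2 hpn
    have hn2 : (2 : ℝ) ≤ n := by exact_mod_cast h2
    have hp1 : 1 < p := by
      refine lt_of_lt_of_le ?_ hpn
      rw [conjExp, lt_div_iff₀ (by linarith)]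
      linarith
    rw [conjExp, div_le_iff₀ (by linarith)] at hpn
    have h1 := ((lorentz_isModel hw1 hp).isUncond (lorentz_isFatou hw1 hp)).diagIntegral_isoEq hn
    rw [powPolar_dualBall_lorentz_of_nonpos hw1 hp1 hn hpn] at h1
    exact h1.trans supBall_isoEq_ellOne
  · intro hpn
    have h1 := diagIntegral_dualCoord_isoEq hw1 hp hn
    rw [powPolar_lorentz_ball hw1 (by linarith) hpn.le] at h1
    have hρ := marcinkiewicz_isFatou (isFundamental_partialSum hw1 (t := n / p) (by positivity))
    exact ⟨h1.trans hρ.kotheDual_isoEq.symm, (orderContinuous_isBanachDual hρ).congr h1.symm⟩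
  · intro hpn
    have h1 := diagIntegral_dualCoord_isoEq hw1 hp hn
    rwa [funext (polarENorm_powPolar_lorentz_ball hw1 hn hpn)] at h1
  · intro h1p
    exact ⟨diagNuclear_lorentz_isoEq hw1 h1p hn,
      (diagNuclear_dualCoord_isoEq hw hp hn).trans (diagIntegral_dualCoord_isoEq hw1 hp hn).symm⟩
  · obtain ⟨e, hm⟩ := exists_isModel_lorentzPredual hw
    have hunc := hm.isUncond (marcinkiewicz_isFatou (isFundamental_partialSum_one hw1))
    have h1 := hunc.diagNuclear_isoEq hn
    have h2 := hunc.diagIntegral_isoEq hn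
    rw [dualBall_lorentzPredual hw] at h1 h2
    exact ⟨(h1 fun α hα => lorentz_ball_polar_tail hw one_pos hn hα).trans h2.symm,
      h2.trans (diagIntegral_dualCoord_isoEq hw1 le_rfl hn).symm⟩
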